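/- **Setting.** Let $\Omega\subseteq\mathbb R^d$ be open. $\mathcal P(\Omega)$ is the set of smooth $\rho\ge 0$ on $\Omega$ with $\int_\Omega\rho\,dx=1$ (extended by $0$). A domain is a set $\mathcal A\subseteq\mathcal P(\Omega)$ such that $\rho\in\mathcal A$, $\rho'\in\mathcal P(\Omega)$, $\rho'-\rho\in C_c^\infty(\Omega)$ (and $\rho'>0$ on $\Omega$ in case $\rho>0$ on $\Omega$) imply $\rho'\in\mathcal A$. *Variations.* $E:\mathcal A\to\mathbb R$ is $C^2$ with first variation $\frac{\delta E}{\delta\rho}\in C^2(\Omega)$ and second variation $\frac{\delta^2E}{\delta\rho^2}(x,y)$ if for all $\rho,\rho'\in\mathcal A$ with $\sigma=\rho'-\rho\in C_c^\infty(\Omega)$ one has $\frac{d}{dt}\big|_{0^+}E(\rho+t\sigma)=\int\frac{\delta E}{\delta\rho}\sigma$ and, for each $x\in\Omega$, $\frac{d}{dt}\big|_{0^+}\frac{\delta E}{\delta(\rho+t\sigma)}(x)=(L_\rho\sigma)(x):=\int\frac{\delta^2E}{\delta\rho^2}(x,y)\sigma(y)\,dy$. The kernel may be a distribution. $L_\rho$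 is linear and symmetric on mean-zero test functions with $L_\rho\sigma\in C^1(\Omega)$, and $\frac{\delta E}{\delta\rho}$, $L_\rho\sigma$ depend continuously on $\rho,\sigma$: if $\rho_n-\rho\to0$ and $\sigma_n\to\sigma$ in $C_c^\infty(\Omega)$, then $\frac{\delta E}{\delta\rho_n}\to\frac{\delta E}{\delta\rho}$ and $L_{\rho_n}\sigma_n\to L_\rho\sigma$ locally uniformly on $\Omega$. *Hessian.* A Wasserstein geodesic from $(\rho,\Phi)$, $\Phi\in C_c^\infty(\Omega)$, is a smooth solution on some $(-\varepsilon,\varepsilon)\times\Omega$ of $\partial_s\hat\rho_s+\nabla\cdot(\hat\rho_s\nabla\Phi_s)=0$, $\partial_s\Phi_s+\frac12\|\nabla\Phi_s\|^2=0$, with $\hat\rho_s\in\mathcal P(\Omega)$, the $\Phi_s$ supported in a common compact subset of $\Omega$, $\hat\rho_0=\rho$, $\Phi_0=\Phi$. "The Hessian of $E$ at $\rho$ is the form $\int\Psi\,\mathcal H_E^W(\rho)\Phi\,dx$" means: it is a symmetric bilinear form on $C_c^\infty(\Omega)$, and for each $\Phi\in C_c^\infty(\Omega)$ a geodesic from $(\rho,\Phi)$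 exists and along each such geodesic $\frac{d^2}{ds^2}\big|_{s=0}E(\hat\rho_s)$ exists and equals $\int\Phi\,\mathcal H^W_E(\rho)\Phi\,dx$. A potential at $\rho$ is a smooth $\Phi$ on $\Omega$ with $\nabla\Phi$ in the $L^2(\rho)$-closure of $\{\nabla\varphi:\varphi\in C_c^\infty(\Omega)\}$. For a potential $\Phi$ and a continuous $\eta$ on $\Omega$, $\mathcal H_E^W(\rho)\Phi=\eta$ means that $\int\Psi\,\mathcal H_E^W(\rho)\varphi_n\,dx\to\int\Psi\eta\,dx$ for all $\Psi\in C_c^\infty(\Omega)$ and all test functions $\varphi_n$ with $\nabla\varphi_n\to\nabla\Phi$ in $L^2(\rho)$. For $\sigma=-\nabla\cdot(\rho\nabla\Phi)$ with $\Phi$ a potential, $\operatorname{Hess}E(\rho)\sigma=\mathcal H_E^W(\rho)\Phi$. With $\operatorname{grad}E(\rho)=-\nabla\cdot(\rho\nabla\frac{\delta E}{\delta\rho})$, a Newton's flow is a curve with $\partial_t\rho_t=-(\operatorname{Hess}E(\rho_t))^{-1}\operatorname{grad}E(\rho_t)$, i.e. $\operatorname{Hess}E(\rho_t)\,\partial_t\rho_t=-\operatorname{grad}E(\rho_t)$,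 for $t$ in a given set $J$ of times. **(1) General functionals.** Let $E$ be $C^2$ on a domain $\mathcal A$. For $\rho\in\mathcal A$ the Hessian of $E$ at $\rho$ is the form $$\int\Phi\,\mathcal H_E^W(\rho)\Psi\,dx=\iint\Big\langle\nabla\Phi(x),\nabla_x\nabla_y\tfrac{\delta^2E}{\delta\rho^2}(x,y)\nabla\Psi(y)\Big\rangle\rho(x)\rho(y)\,dx\,dy+\int\Big\langle\nabla\Phi,\nabla^2\tfrac{\delta E}{\delta\rho}\nabla\Psi\Big\rangle\rho\,dx,$$ in particular for $\Psi=\Phi$ it gives $\int\Phi\,\mathcal H^W_E(\rho)\Phi\,dx$. For a distributional kernel, $\int\nabla_x\nabla_y\frac{\delta^2E}{\delta\rho^2}(x,y)\nabla\Psi(y)\rho(y)\,dy$ means $-\nabla_x\big(L_\rho[\nabla\cdot(\rho\nabla\Psi)]\big)(x)$; if every $\frac{\delta^2E}{\delta\rho^2}$ is a $C^2$ function on $\Omega\times\Omega$, the formula holds literally. Moreover, if $\rho_t\in\mathcal A$ and this vector field, at $\rho=\rho_t$, is in $L^2(\rho_t)$ for all $\Psi\in C_c^\infty(\Omega)$ and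 $t\in J$, then $(\rho_t)$ is a Newton's flow of $E$ on $J$ if and only if there are potentials $\Phi_t$ at $\rho_t$ with, for $t\in J$, $$\partial_t\rho_t+\nabla\cdot(\rho_t\nabla\Phi_t)=0,\qquad \mathcal H_E^W(\rho_t)\Phi_t-\nabla\cdot\Big(\rho_t\nabla\frac{\delta E}{\delta\rho_t}\Big)=0,$$ the second equation being tested against all $\Psi\in C_c^\infty(\Omega)$, with $\mathcal H_E^W(\rho_t)$ given by the above form. **(2) Interaction energy and MMD.** Let $W$ be smooth on $\Omega\times\Omega$ and symmetric, and $\nu=0$ (interaction energy) or $\nu\in\mathcal P(\Omega)$ (half the squared MMD), and let $E(\rho)=\frac12\iint(\rho-\nu)(x)W(x,y)(\rho-\nu)(y)\,dx\,dy$. Let $\mathcal A$ be the set of $\rho\in\mathcal P(\Omega)$ for which this integral converges absolutely and, for all compact $K\subset\Omega$ and $m\le3$, there is $g$ with $g\rho,g\nu\in L^1(\Omega)$ and $\|\nabla_x^mW(x,y)\|\le g(y)$ for $x\in K$, $y\in\Omega$. Then $\mathcal A$ is a domain, $E$ is $C^2$ on it with $\frac{\delta E}{\delta\rho}=W*(\rho-\nu)$,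 where $(W*f)(x)=\int W(x,y)f(y)\,dy$, and $\frac{\delta^2E}{\delta\rho^2}=W$, and the Hessian of $E$ at $\rho\in\mathcal A$ satisfies, for $\Phi\in C_c^\infty(\Omega)$, $$\int\Phi\,\mathcal H^W_E(\rho)\Phi\,dx=\iint\langle\nabla\Phi(x),\nabla_x\nabla_yW(x,y)\nabla\Phi(y)\rangle\rho(x)\rho(y)\,dx\,dy+\int\Big\langle\nabla\Phi(x),\int\nabla_x^2W(x,y)(\rho-\nu)(y)\,dy\,\nabla\Phi(x)\Big\rangle\rho(x)\,dx,$$ for $\nu=0$ also $$\int\Phi\,\mathcal H^W_E(\rho)\Phi\,dx=\frac12\iint\begin{bmatrix}\nabla\Phi(x)\\\nabla\Phi(y)\end{bmatrix}^T\begin{bmatrix}\nabla^2_{xx}W&\nabla^2_{xy}W\\\nabla^2_{yx}W&\nabla^2_{yy}W\end{bmatrix}(x,y)\begin{bmatrix}\nabla\Phi(x)\\\nabla\Phi(y)\end{bmatrix}\rho(x)\rho(y)\,dx\,dy,$$ and $$\mathcal H_E^W(\rho)\Phi=-\nabla\cdot\big(\rho\,(\nabla^2_{xy}W*(\rho\nabla\Phi))\big)-\nabla\cdot\big(\rho\,(\nabla^2_{xx}W*(\rho-\nu))\nabla\Phi\big).$$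 If $\rho_t\in\mathcal A$ and $\nabla_x\nabla_yW$ and its first $x$-derivatives are, for $x$ in compact sets, bounded by functions of $y$ in $L^2(\rho_t)$ for $t\in J$, then $(\rho_t)$ is a Newton's flow on $J$ iff there are potentials $\Phi_t$ such that the system in (1) holds pointwise on $\Omega$ with this operator. **(3) Cross entropy.** Let $\rho^*\in\mathcal P(\Omega)$ and $E(\rho)=-\int(\log\rho)\rho^*dx$ or $E(\rho)=-\int\log(\rho/\rho^*)\rho^*dx$, on the set $\mathcal A$ of $\rho\in\mathcal P(\Omega)$ that are positive on $\Omega$ and for which the integrand is integrable. Then $\mathcal A$ is a domain, $E$ is $C^2$ on it with $\frac{\delta E}{\delta\rho}=-\frac{\rho^*}{\rho}$, $\frac{\delta^2E}{\delta\rho^2}(x,y)=\frac{\rho^*(x)}{\rho(x)^2}\delta(x-y)$, and the Hessian of $E$ at $\rho\in\mathcal A$ satisfies, for $\Phi\in C_c^\infty(\Omega)$, $$\int\Phi\,\mathcal H^W_E(\rho)\Phi\,dx=\int\big(\rho^{-1}\nabla\cdot(\rho\nabla\Phi)\big)^2\rho^*dx-\int\Big\langle\nabla\Phi,\nabla^2\Big(\frac{\rho^*}{\rho}\Big)\nabla\Phi\Big\rangle\rho\,dx,$$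 $$\mathcal H_E^W(\rho)\Phi=\nabla\cdot\Big(\rho\nabla\Big(\frac{\rho^*}{\rho^2}\nabla\cdot(\rho\nabla\Phi)\Big)\Big)+\nabla\cdot\Big(\rho\nabla^2\Big(\frac{\rho^*}{\rho}\Big)\nabla\Phi\Big).$$ A curve $(\rho_t)$ with $\rho_t\in\mathcal A$ for $t\in J$ is a Newton's flow on $J$ iff there are potentials $\Phi_t$ such that the system in (1) holds pointwise on $\Omega$ with this operator. -/

import Mathlib

open MeasureTheory Filter Topology Set Matrix
open scoped ContDiff

namespace WassersteinNewton

noncomputable section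

/-- Euclidean `d`-space. Functions on an open set `Ω` are represented by functions on the whole
space; only their values on `Ω` matter. -/
abbrev Sp (d : ℕ) : Type := EuclideanSpace ℝ (Fin d)

/-! ### Vector calculus in coordinates -/

/-- The partial derivative `∂ᵢ f (x)`. -/
def pd {d : ℕ} (i : Fin d) (f : Sp d → ℝ) (x : Sp d) : ℝ :=
  fderiv ℝ f x (EuclideanSpace.single i 1)

/-- The gradient `∇f(x)`, as a coordinate vector. -/
def grad {d : ℕ} (f : Sp d → ℝ) (x : Sp d) : Fin d → ℝ := fun i => pd i f x

/-- The divergence `∇·V (x)` of a vector field. -/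
def div {d : ℕ} (V : Sp d → Fin d → ℝ) (x : Sp d) : ℝ := ∑ i, pd i (fun y => V y i) x

/-- The Hessian matrix `∇²f(x)`. -/
def hess {d : ℕ} (f : Sp d → ℝ) (x : Sp d) : Matrix (Fin d) (Fin d) ℝ :=
  Matrix.of fun i j => pd i (pd j f) x

/-- The matrix `∇ₓ∇_y k(x,y)` with entries `∂_{xᵢ} ∂_{yⱼ} k (x,y)`. -/
def mixedHess {d : ℕ} (k : Sp d → Sp d → ℝ) (x y : Sp d) : Matrix (Fin d) (Fin d) ℝ :=
  Matrix.of fun i j => pd i (fun x' => pd j (k x') y) x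

/-- `∇·(ρ∇Φ)`. Thus `-wDiv ρ Φ` is the inverse Wasserstein metric tensor at `ρ` applied to `Φ`. -/
def wDiv {d : ℕ} (ρ Φ : Sp d → ℝ) : Sp d → ℝ := div (fun y => ρ y • grad Φ y)

/-! ### Densities, test functions, potentials -/

/-- `ρ ∈ 𝓟(Ω)`: a smooth probability density on `Ω`, extended by zero. -/
structure Density {d : ℕ} (Ω : Set (Sp d)) (ρ : Sp d → ℝ) : Prop where
  smooth : ContDiffOn ℝ ∞ ρ Ω
  nonneg : ∀ x, 0 ≤ ρ x
  zero_off : ∀ x, x ∉ Ω → ρ x = 0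
  mass : ∫ x in Ω, ρ x = 1

/-- `φ ∈ C_c^∞(Ω)`. -/
structure IsTest {d : ℕ} (Ω : Set (Sp d)) (φ : Sp d → ℝ) : Prop where
  smooth : ContDiff ℝ ∞ φ
  compact : HasCompactSupport φ
  support : tsupport φ ⊆ Ω

/-- Compactly supported tangent vectors: test functions of mean zero. -/
def IsTangentTest {d : ℕ} (Ω : Set (Sp d)) (σ : Sp d → ℝ) : Prop :=
  IsTest Ω σ ∧ ∫ x in Ω, σ x = 0

/-- Convergence of a sequence in `C_c^∞(Ω)`: supports in one compact subset of `Ω`, and uniform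
convergence of all derivatives. -/
def TestTendsto {d : ℕ} (Ω : Set (Sp d)) (φ : ℕ → Sp d → ℝ) (φ₀ : Sp d → ℝ) : Prop :=
  (∀ n, IsTest Ω (φ n)) ∧ IsTest Ω φ₀ ∧
  (∃ K : Set (Sp d), IsCompact K ∧ K ⊆ Ω ∧ ∀ n, tsupport (φ n) ⊆ K) ∧
  ∀ m : ℕ, TendstoUniformly (fun n => iteratedFDeriv ℝ m (φ n)) (iteratedFDeriv ℝ m φ₀) atTop

/-- `∇φₙ → ∇Φ` in `L²(ρ)`. -/
def EnergyTendsto {d : ℕ} (Ω : Set (Sp d)) (ρ : Sp d → ℝ) (φ : ℕ → Sp d → ℝ)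
    (Φ : Sp d → ℝ) : Prop :=
  Tendsto (fun n => ∫⁻ x in Ω, ENNReal.ofReal
    (((grad Φ x - grad (φ n) x) ⬝ᵥ (grad Φ x - grad (φ n) x)) * ρ x)) atTop (𝓝 0)

/-- Cotangent vectors at `ρ`: smooth functions on `Ω` whose gradient lies in the `L²(ρ)`-closure of
the gradients of test functions (the usual Wasserstein tangent space at `ρ`). -/
def IsPotential {d : ℕ} (Ω : Set (Sp d)) (ρ Φ : Sp d → ℝ) : Prop :=
  ContDiffOn ℝ ∞ Φ Ω ∧ ∃ φ : ℕ → Sp d → ℝ, (∀ n, IsTest Ω (φ n)) ∧ EnergyTendsto Ω ρ φ Φ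

/-! ### Wasserstein geodesics and the Hessian -/

/-- A Wasserstein geodesic `(r, φ)` in `𝓟(Ω)`, parametrised by `(-ε, ε)`, with initial density `ρ`
and initial potential `Φ`:  `∂ₛ rₛ + ∇·(rₛ ∇φₛ) = 0`,  `∂ₛ φₛ + ½ ‖∇φₛ‖² = 0`. -/
structure IsGeodesic {d : ℕ} (Ω : Set (Sp d)) (ρ Φ : Sp d → ℝ) (ε : ℝ)
    (r φ : ℝ → Sp d → ℝ) : Prop where
  pos : 0 < ε
  density : ∀ s ∈ Ioo (-ε) ε, Density Ω (r s)
  smooth_density : ContDiffOn ℝ ∞ (fun p : ℝ × Sp d => r p.1 p.2) (Ioo (-ε) ε ×ˢ Ω)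
  smooth_potential : ContDiffOn ℝ ∞ (fun p : ℝ × Sp d => φ p.1 p.2) (Ioo (-ε) ε ×ˢ Ω)
  support : ∃ K : Set (Sp d), IsCompact K ∧ K ⊆ Ω ∧ ∀ s ∈ Ioo (-ε) ε, ∀ x, x ∉ K → φ s x = 0
  init_density : r 0 = ρ
  init_potential : φ 0 = Φ
  continuity_eq : ∀ s ∈ Ioo (-ε) ε, ∀ x ∈ Ω,
    deriv (fun s' => r s' x) s + wDiv (r s) (φ s) x = 0
  hamilton_jacobi : ∀ s ∈ Ioo (-ε) ε, ∀ x ∈ Ω,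
    deriv (fun s' => φ s' x) s + (1 / 2) * (grad (φ s) x ⬝ᵥ grad (φ s) x) = 0

/-- `e` is twice differentiable at `0` with `e''(0) = q`. -/
def HasSecondDerivAtZero (e : ℝ → ℝ) (q : ℝ) : Prop :=
  ∃ e' : ℝ → ℝ, (∀ᶠ s in 𝓝 (0 : ℝ), HasDerivAt e (e' s) s) ∧ HasDerivAt e' q 0

/-- `g_ρ(Hess E(ρ) σ, σ) = q` for `σ = -∇·(ρ∇Φ)`, `Φ ∈ C_c^∞(Ω)`: there is a geodesic with initial
data `(ρ, Φ)`, and along every such geodesic the second derivative of `E` at `s = 0` exists and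
equals `q`. -/
def HasHessianValue {d : ℕ} (Ω : Set (Sp d)) (E : (Sp d → ℝ) → ℝ) (ρ Φ : Sp d → ℝ)
    (q : ℝ) : Prop :=
  (∃ (ε : ℝ) (r φ : ℝ → Sp d → ℝ), IsGeodesic Ω ρ Φ ε r φ) ∧
  ∀ (ε : ℝ) (r φ : ℝ → Sp d → ℝ), IsGeodesic Ω ρ Φ ε r φ →
    HasSecondDerivAtZero (fun s => E (r s)) q

/-- `Q` is the Hessian of `E` at `ρ`, as the symmetric bilinear form
`(Φ, Ψ) ↦ ∫ Ψ 𝓗_E(ρ)Φ dx` on `C_c^∞(Ω)`. (Such a `Q` is unique on `C_c^∞(Ω)`, by polarisation.) -/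
structure IsHessianForm {d : ℕ} (Ω : Set (Sp d)) (E : (Sp d → ℝ) → ℝ) (ρ : Sp d → ℝ)
    (Q : (Sp d → ℝ) → (Sp d → ℝ) → ℝ) : Prop where
  symm : ∀ Φ Ψ, IsTest Ω Φ → IsTest Ω Ψ → Q Φ Ψ = Q Ψ Φ
  add_left : ∀ Φ₁ Φ₂ Ψ, IsTest Ω Φ₁ → IsTest Ω Φ₂ → IsTest Ω Ψ →
    Q (Φ₁ + Φ₂) Ψ = Q Φ₁ Ψ + Q Φ₂ Ψ
  smul_left : ∀ (c : ℝ) (Φ Ψ), IsTest Ω Φ → IsTest Ω Ψ → Q (c • Φ) Ψ = c * Q Φ Ψ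
  value : ∀ Φ, IsTest Ω Φ → HasHessianValue Ω E ρ Φ (Q Φ Φ)

/-- `𝓗_E(ρ) Φ = η` for a potential `Φ`: tested against `Ψ ∈ C_c^∞(Ω)`, the Hessian form extends
continuously from `C_c^∞(Ω)` to `Φ`, and the value is `∫ Ψ η dx`. -/
def HessOpEq {d : ℕ} (Ω : Set (Sp d)) (E : (Sp d → ℝ) → ℝ) (ρ Φ η : Sp d → ℝ) : Prop :=
  ContinuousOn η Ω ∧ ∃ Q, IsHessianForm Ω E ρ Q ∧
    ∀ Ψ, IsTest Ω Ψ → ∀ φ : ℕ → Sp d → ℝ, (∀ n, IsTest Ω (φ n)) → EnergyTendsto Ω ρ φ Φ →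
      Tendsto (fun n => Q (φ n) Ψ) atTop (𝓝 (∫ x in Ω, Ψ x * η x))

/-- `Hess E(ρ) σ = η` for a tangent vector `σ = -∇·(ρ∇Φ)`, where `Hess E(ρ) σ = 𝓗_E(ρ) Φ`. -/
def HessianApplyEq {d : ℕ} (Ω : Set (Sp d)) (E : (Sp d → ℝ) → ℝ) (ρ σ η : Sp d → ℝ) : Prop :=
  ∃ Φ, IsPotential Ω ρ Φ ∧ (∀ x ∈ Ω, σ x = -wDiv ρ Φ x) ∧ HessOpEq Ω E ρ Φ η

/-- The Wasserstein gradient `-∇·(ρ ∇ δE/δρ)`, where `D ρ = δE/δρ`. -/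
def wGrad {d : ℕ} (D : (Sp d → ℝ) → Sp d → ℝ) (ρ : Sp d → ℝ) : Sp d → ℝ :=
  fun x => -wDiv ρ (D ρ) x

/-- The curve `r` is a Wasserstein Newton's flow of `E` on the time set `J`:
`∂ₜ rₜ = -(Hess E(rₜ))⁻¹ grad E(rₜ)`, i.e. `Hess E(rₜ) ∂ₜrₜ = -grad E(rₜ)`. -/
def IsNewtonFlow {d : ℕ} (Ω : Set (Sp d)) (E : (Sp d → ℝ) → ℝ) (D : (Sp d → ℝ) → Sp d → ℝ)
    (J : Set ℝ) (r : ℝ → Sp d → ℝ) : Prop :=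
  ∀ t ∈ J, ∃ σ : Sp d → ℝ, (∀ x ∈ Ω, HasDerivAt (fun t' => r t' x) (σ x) t) ∧
    HessianApplyEq Ω E (r t) σ (fun x => -wGrad D (r t) x)

/-- `∂ₜ rₜ + ∇·(rₜ ∇Φₜ) = 0` on `Ω` for `t ∈ J`, with `Φₜ` a potential at `rₜ`. -/
def FlowEquation {d : ℕ} (Ω : Set (Sp d)) (J : Set ℝ) (r Φ : ℝ → Sp d → ℝ) : Prop :=
  ∀ t ∈ J, IsPotential Ω (r t) (Φ t) ∧
    ∀ x ∈ Ω, HasDerivAt (fun t' => r t' x) (-wDiv (r t) (Φ t) x) t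

/-! ### Functionals on densities and their variations -/

/-- A domain for functionals: a set of densities stable under compactly supported changes of the
density (which, if the density is positive on `Ω`, keep it positive). -/
structure EnergyDomain {d : ℕ} (Ω : Set (Sp d)) (A : Set (Sp d → ℝ)) : Prop where
  density : ∀ ρ ∈ A, Density Ω ρ
  stable : ∀ ρ ∈ A, ∀ ρ', Density Ω ρ' → IsTest Ω (ρ' - ρ) →
    ((∀ x ∈ Ω, 0 < ρ x) → ∀ x ∈ Ω, 0 < ρ' x) → ρ' ∈ A

/-- `E` is of class `C²` on `A`, with first variation `δE/δρ = D ρ` and second variation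
`(L ρ σ)(x) = ∫ δ²E/δρ²(x,y) σ(y) dy`; the operator `L ρ` stands for the kernel `δ²E/δρ²`, which
may be a distribution. The derivatives are directional ones along segments of densities: `D ρ` is
the first variation of `E`, and `σ ↦ L ρ σ x` is the first variation of `ρ ↦ D ρ x`. -/
structure HasVariations {d : ℕ} (Ω : Set (Sp d)) (A : Set (Sp d → ℝ)) (E : (Sp d → ℝ) → ℝ)
    (D : (Sp d → ℝ) → Sp d → ℝ) (L : (Sp d → ℝ) → (Sp d → ℝ) → Sp d → ℝ) : Prop where
  first_regular : ∀ ρ ∈ A, ContDiffOn ℝ 2 (D ρ) Ω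
  first : ∀ ρ ∈ A, ∀ ρ' ∈ A, IsTest Ω (ρ' - ρ) →
    HasDerivWithinAt (fun t : ℝ => E (ρ + t • (ρ' - ρ)))
      (∫ x in Ω, D ρ x * (ρ' x - ρ x)) (Ici 0) 0
  second : ∀ ρ ∈ A, ∀ ρ' ∈ A, IsTest Ω (ρ' - ρ) → ∀ x ∈ Ω,
    HasDerivWithinAt (fun t : ℝ => D (ρ + t • (ρ' - ρ)) x) (L ρ (ρ' - ρ) x) (Ici 0) 0
  second_regular : ∀ ρ ∈ A, ∀ σ, IsTangentTest Ω σ → ContDiffOn ℝ 1 (L ρ σ) Ω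
  second_add : ∀ ρ ∈ A, ∀ σ τ, IsTangentTest Ω σ → IsTangentTest Ω τ → ∀ x ∈ Ω,
    L ρ (σ + τ) x = L ρ σ x + L ρ τ x
  second_smul : ∀ ρ ∈ A, ∀ (c : ℝ) (σ), IsTangentTest Ω σ → ∀ x ∈ Ω,
    L ρ (c • σ) x = c * L ρ σ x
  second_symm : ∀ ρ ∈ A, ∀ σ τ, IsTangentTest Ω σ → IsTangentTest Ω τ →
    ∫ x in Ω, τ x * L ρ σ x = ∫ x in Ω, σ x * L ρ τ x
  first_continuous : ∀ ρ ∈ A, ∀ ρs : ℕ → Sp d → ℝ, (∀ n, ρs n ∈ A) →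
    TestTendsto Ω (fun n => ρs n - ρ) 0 →
    TendstoLocallyUniformlyOn (fun n => D (ρs n)) (D ρ) atTop Ω
  second_continuous : ∀ ρ ∈ A, ∀ ρs : ℕ → Sp d → ℝ, (∀ n, ρs n ∈ A) →
    TestTendsto Ω (fun n => ρs n - ρ) 0 →
    ∀ (σ : Sp d → ℝ) (σs : ℕ → Sp d → ℝ), IsTangentTest Ω σ → (∀ n, IsTangentTest Ω (σs n)) →
    TestTendsto Ω σs σ →
    TendstoLocallyUniformlyOn (fun n => L (ρs n) (σs n)) (L ρ σ) atTop Ω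

/-- The operator with kernel `k ρ (x,y)`. -/
def kernelOp {d : ℕ} (Ω : Set (Sp d)) (k : (Sp d → ℝ) → Sp d → Sp d → ℝ) :
    (Sp d → ℝ) → (Sp d → ℝ) → Sp d → ℝ :=
  fun ρ σ x => ∫ y in Ω, k ρ x y * σ y

/-- The vector field `x ↦ ∫ ∇ₓ∇_y δ²E/δρ²(x,y) ∇Ψ(y) ρ(y) dy`, with the derivatives of the kernel
in the sense of distributions: `-∇ₓ ∫ δ²E/δρ²(x,y) ∇·(ρ∇Ψ)(y) dy`. -/
def mixedAction {d : ℕ} (L : (Sp d → ℝ) → (Sp d → ℝ) → Sp d → ℝ) (ρ Ψ : Sp d → ℝ)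
    (x : Sp d) : Fin d → ℝ :=
  -grad (L ρ (wDiv ρ Ψ)) x

/-- `∫∫ ⟨∇Φ(x), ∇ₓ∇_y δ²E/δρ²(x,y) ∇Ψ(y)⟩ ρ(x) ρ(y) dx dy + ∫ ⟨∇Φ, ∇²(δE/δρ) ∇Ψ⟩ ρ dx`, where
`∇ₓ∇_y δ²E/δρ²` is taken in the sense of distributions. -/
def hessFormL {d : ℕ} (Ω : Set (Sp d)) (D : (Sp d → ℝ) → Sp d → ℝ)
    (L : (Sp d → ℝ) → (Sp d → ℝ) → Sp d → ℝ) (ρ Φ Ψ : Sp d → ℝ) : ℝ :=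
  (∫ x in Ω, (grad Φ x ⬝ᵥ mixedAction L ρ Ψ x) * ρ x) +
  ∫ x in Ω, (grad Φ x ⬝ᵥ (hess (D ρ) x *ᵥ grad Ψ x)) * ρ x

/-- `∫∫ ⟨∇Φ(x), ∇ₓ∇_y k(x,y) ∇Ψ(y)⟩ ρ(x) ρ(y) dx dy + ∫ ⟨∇Φ, ∇²(δE/δρ) ∇Ψ⟩ ρ dx`, where
`k = δ²E/δρ²`. -/
def hessFormK {d : ℕ} (Ω : Set (Sp d)) (D : (Sp d → ℝ) → Sp d → ℝ)
    (k : (Sp d → ℝ) → Sp d → Sp d → ℝ) (ρ Φ Ψ : Sp d → ℝ) : ℝ :=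
  (∫ x in Ω, ∫ y in Ω, (grad Φ x ⬝ᵥ (mixedHess (k ρ) x y *ᵥ grad Ψ y)) * ρ x * ρ y) +
  ∫ x in Ω, (grad Φ x ⬝ᵥ (hess (D ρ) x *ᵥ grad Ψ x)) * ρ x

/-- For every test function `Ψ`, the field `∫ ∇ₓ∇_y δ²E/δρ²(x,y) ∇Ψ(y) ρ(y) dy` is in `L²(ρ)`. -/
def MixedL2 {d : ℕ} (Ω : Set (Sp d)) (L : (Sp d → ℝ) → (Sp d → ℝ) → Sp d → ℝ)
    (ρ : Sp d → ℝ) : Prop :=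
  ∀ Ψ, IsTest Ω Ψ →
    IntegrableOn (fun x => (mixedAction L ρ Ψ x ⬝ᵥ mixedAction L ρ Ψ x) * ρ x) Ω

/-! ### Interaction energy and maximum mean discrepancy -/

/-- `½ ∫∫ (ρ-ν)(x) W(x,y) (ρ-ν)(y) dx dy`: the interaction energy for `ν = 0`, and half the squared
maximum mean discrepancy between `ρ` and `ν` for a density `ν`. -/
def interactionEnergy {d : ℕ} (Ω : Set (Sp d)) (W : Sp d → Sp d → ℝ) (ν ρ : Sp d → ℝ) : ℝ :=
  (1 / 2) * ∫ x in Ω, ∫ y in Ω, (ρ x - ν x) * W x y * (ρ y - ν y)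

/-- Densities for which the energy is finite and `∫ W(x,y) (ρ-ν)(y) dy` can be differentiated three
times under the integral sign. -/
def interactionDomain {d : ℕ} (Ω : Set (Sp d)) (W : Sp d → Sp d → ℝ) (ν : Sp d → ℝ) :
    Set (Sp d → ℝ) :=
  {ρ | Density Ω ρ ∧
    IntegrableOn (fun p : Sp d × Sp d => (ρ p.1 - ν p.1) * W p.1 p.2 * (ρ p.2 - ν p.2)) (Ω ×ˢ Ω) ∧
    ∀ K : Set (Sp d), IsCompact K → K ⊆ Ω → ∀ m : ℕ, m ≤ 3 → ∃ g : Sp d → ℝ,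
      IntegrableOn (fun y => g y * ρ y) Ω ∧ IntegrableOn (fun y => g y * ν y) Ω ∧
      ∀ x ∈ K, ∀ y ∈ Ω, ‖iteratedFDeriv ℝ m (fun x' => W x' y) x‖ ≤ g y}

/-- `W * (ρ - ν)`. -/
def interactionFirst {d : ℕ} (Ω : Set (Sp d)) (W : Sp d → Sp d → ℝ) (ν ρ : Sp d → ℝ)
    (x : Sp d) : ℝ :=
  ∫ y in Ω, W x y * (ρ y - ν y)

/-- `-∇·(ρ (∇²_{xy}W * (ρ∇Φ))) - ∇·(ρ (∇²_{xx}W * (ρ-ν)) ∇Φ)`. -/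
def interactionOp {d : ℕ} (Ω : Set (Sp d)) (W : Sp d → Sp d → ℝ) (ν ρ Φ : Sp d → ℝ)
    (x : Sp d) : ℝ :=
  -div (fun y => ρ y • fun i => ∫ z in Ω, (mixedHess W y z *ᵥ grad Φ z) i * ρ z) x
  - div (fun y => ρ y • ((Matrix.of fun i j =>
      ∫ z in Ω, hess (fun y' => W y' z) y i j * (ρ z - ν z)) *ᵥ grad Φ y)) x

/-- `∇ₓ∇_yW` and its first `x`-derivatives are, locally uniformly in `x`, bounded by functions of `y`
in `L²(ρ)`. -/
def InteractionL2 {d : ℕ} (Ω : Set (Sp d)) (W : Sp d → Sp d → ℝ) (ρ : Sp d → ℝ) : Prop :=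
  ∀ K : Set (Sp d), IsCompact K → K ⊆ Ω → ∃ g : Sp d → ℝ,
    IntegrableOn (fun y => g y ^ 2 * ρ y) Ω ∧
    ∀ x ∈ K, ∀ y ∈ Ω, ∀ i j, |mixedHess W x y i j| ≤ g y ∧
      ∀ l, |pd l (fun x' => mixedHess W x' y i j) x| ≤ g y

/-! ### Cross entropy -/

/-- The cross entropy `-∫ (log ρ) ρ* dx`. -/
def crossEntropy {d : ℕ} (Ω : Set (Sp d)) (ρs ρ : Sp d → ℝ) : ℝ :=
  -∫ x in Ω, Real.log (ρ x) * ρs x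

/-- The reverse Kullback–Leibler divergence `-∫ log(ρ/ρ*) ρ* dx`. -/
def reverseKL {d : ℕ} (Ω : Set (Sp d)) (ρs ρ : Sp d → ℝ) : ℝ :=
  -∫ x in Ω, Real.log (ρ x / ρs x) * ρs x

/-- Positive densities of finite cross entropy. -/
def crossEntropyDomain {d : ℕ} (Ω : Set (Sp d)) (ρs : Sp d → ℝ) : Set (Sp d → ℝ) :=
  {ρ | Density Ω ρ ∧ (∀ x ∈ Ω, 0 < ρ x) ∧ IntegrableOn (fun x => Real.log (ρ x) * ρs x) Ω}

/-- Positive densities of finite reverse Kullback–Leibler divergence. -/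
def reverseKLDomain {d : ℕ} (Ω : Set (Sp d)) (ρs : Sp d → ℝ) : Set (Sp d → ℝ) :=
  {ρ | Density Ω ρ ∧ (∀ x ∈ Ω, 0 < ρ x) ∧
    IntegrableOn (fun x => Real.log (ρ x / ρs x) * ρs x) Ω}

/-- `-ρ*/ρ`. -/
def crossEntropyFirst {d : ℕ} (ρs ρ : Sp d → ℝ) (x : Sp d) : ℝ := -(ρs x / ρ x)

/-- The operator with kernel `(ρ*(x)/ρ(x)²) δ(x-y)`. -/
def crossEntropySecond {d : ℕ} (ρs ρ σ : Sp d → ℝ) (x : Sp d) : ℝ := ρs x / ρ x ^ 2 * σ x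

/-- `∇·(ρ∇((ρ*/ρ²) ∇·(ρ∇Φ))) + ∇·(ρ ∇²(ρ*/ρ) ∇Φ)`. -/
def crossEntropyOp {d : ℕ} (ρs ρ Φ : Sp d → ℝ) (x : Sp d) : ℝ :=
  wDiv ρ (fun y => ρs y / ρ y ^ 2 * wDiv ρ Φ y) x
  + div (fun y => ρ y • (hess (fun z => ρs z / ρ z) y *ᵥ grad Φ y)) x

end

end WassersteinNewton

open WassersteinNewton

/-! Along a geodesic `(r, φ)` from `(ρ, Φ)` the initial velocity is σ = -∇·(ρ∇Φ), and the first
derivative of E is ∫ D(r_s) ∂ₛr_s. Differentiating again at s = 0 splits into ∫ (L_ρσ) σ, from the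
change of D, and the derivative of ∫ D(ρ) ∂ₛr_s with D(ρ) frozen. Integration by parts turns the
first into the term with ∇ₓ∇_y δ²E/δρ². In the second, the continuity equation gives ∫ ⟨∇D(ρ), ∇φ_s⟩
r_s. Its s-derivative, by Hamilton–Jacobi and one more integration by parts, is ∫ ⟨∇Φ, ∇²D(ρ) ∇Φ⟩ ρ,
because the two terms containing ∇²Φ cancel. This is `IsGeodesic.hasSecondDerivAtZero`.

The variations are only one-sided derivatives along segments of densities, whereas a geodesic is a
curve. From an interior point of a segment both endpoints are admissible directions, so the
one-sided derivatives combine into an ordinary one and the mean value theorem applies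
(`exists_eq_of_segment_derivatives`). Difference quotients of the curve converge in C_c^∞, and the
continuity of D and L then gives the limits (`DensityCurve.hasDerivAt_energy`,
`DensityCurve.hasDerivAt_energy_deriv`).

Geodesics exist by characteristics (`exists_geodesic`): for small s the map x ↦ x + s∇Φ(x) is a
diffeomorphism. Transport ρ with its Jacobian, and Φ + (s/2)‖∇Φ‖² as a function. Existence also
makes the Hessian form unique on test functions, by polarisation (`IsHessianForm.unique`).

For fixed test Ψ the form depends on Φ only through the pairing of ∇Φ with fields that lie in L²(ρ).
It therefore passes to the limit along test functions approximating a potential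
(`tendsto_hessFormL`), and the equivalence for Newton's flows follows (`isNewtonFlow_iff`).

The examples reduce to checking the hypotheses. The interaction energy is exactly quadratic along
segments, and its kernel is differentiated under the integral sign. The two entropies differ from a
base value by a compactly supported integrand, and their second variation is local. Integrating by
parts against Ψ identifies the operators, and continuity makes the weak equations pointwise. -/

namespace WassersteinNewton

/-! ### Coordinate calculus and integration by parts on an open set. -/

section Calculus

variable {d : ℕ} {Ω K : Set (Sp d)} {f g : Sp d → ℝ} {x : Sp d}

theorem pd_contDiffOn (hΩ : IsOpen Ω) {m n : WithTop ℕ∞} (hf : ContDiffOn ℝ n f Ω)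
    (hmn : m + 1 ≤ n) (i : Fin d) : ContDiffOn ℝ m (pd i f) Ω :=
  (hf.fderiv_of_isOpen hΩ hmn).clm_apply contDiffOn_const

theorem pd_continuousOn (hΩ : IsOpen Ω) (hf : ContDiffOn ℝ 1 f Ω) (i : Fin d) :
    ContinuousOn (pd i f) Ω :=
  (pd_contDiffOn (m := 0) hΩ hf (by simp) i).continuousOn

theorem pd_congr (h : f =ᶠ[𝓝 x] g) (i : Fin d) : pd i f x = pd i g x := by
  simp only [pd, h.fderiv_eq]

theorem pd_congr_on (hΩ : IsOpen Ω) (h : ∀ y ∈ Ω, f y = g y) (hx : x ∈ Ω) (i : Fin d) :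
    pd i f x = pd i g x :=
  pd_congr (by filter_upwards [hΩ.mem_nhds hx] with y hy using h y hy) i

theorem pd_const (c : ℝ) (i : Fin d) : pd i (fun _ : Sp d => c) x = 0 := by
  simp [pd]

theorem pd_add (hf : DifferentiableAt ℝ f x) (hg : DifferentiableAt ℝ g x) (i : Fin d) :
    pd i (fun y => f y + g y) x = pd i f x + pd i g x := by
  simp [pd, fderiv_fun_add hf hg]

theorem pd_neg (i : Fin d) : pd i (fun y => -f y) x = -pd i f x := by
  simp [pd, fderiv_fun_neg]

theorem pd_mul (hf : DifferentiableAt ℝ f x) (hg : DifferentiableAt ℝ g x) (i : Fin d) :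
    pd i (fun y => f y * g y) x = f x * pd i g x + g x * pd i f x := by
  simp [pd, fderiv_fun_mul hf hg]

theorem pd_const_mul (c : ℝ) (i : Fin d) : pd i (fun y => c * f y) x = c * pd i f x := by
  have : (fun y => c * f y) = c • f := rfl
  simp [pd, this, fderiv_const_smul_field]

theorem pd_sum {ι : Type*} (s : Finset ι) {F : ι → Sp d → ℝ}
    (hF : ∀ j ∈ s, DifferentiableAt ℝ (F j) x) (i : Fin d) :
    pd i (fun y => ∑ j ∈ s, F j y) x = ∑ j ∈ s, pd i (F j) x := by
  simp [pd, fderiv_fun_sum hF]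

theorem pd_eq_zero_off (hK : IsClosed K) (h : ∀ y, y ∉ K → f y = 0) (hx : x ∉ K) (i : Fin d) :
    pd i f x = 0 := by
  rw [pd_congr (g := fun _ => 0) (by
    filter_upwards [hK.isOpen_compl.mem_nhds hx] with y hy using h y hy), pd_const]

theorem grad_eq_zero_off (hK : IsClosed K) (h : ∀ y, y ∉ K → f y = 0) (hx : x ∉ K) :
    grad f x = 0 :=
  funext fun i => pd_eq_zero_off hK h hx i

theorem pd_comm (hf : ContDiffAt ℝ 2 f x) (i j : Fin d) :
    pd i (pd j f) x = pd j (pd i f) x := by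
  have hs : IsSymmSndFDerivAt ℝ f x := hf.isSymmSndFDerivAt (by simp)
  have hd : DifferentiableAt ℝ (fderiv ℝ f) x :=
    (hf.fderiv_right (m := 1) (by norm_num)).differentiableAt (by simp)
  have key : ∀ a b : Fin d, pd a (pd b f) x =
      fderiv ℝ (fderiv ℝ f) x (EuclideanSpace.single a 1) (EuclideanSpace.single b 1) := by
    intro a b
    unfold pd
    rw [fderiv_clm_apply hd (differentiableAt_const _)]
    simp
  rw [key, key, hs]

theorem hess_symm (hf : ContDiffAt ℝ 2 f x) (i j : Fin d) : hess f x i j = hess f x j i :=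
  pd_comm hf i j

theorem fderiv_apply_eq_sum_pd (f : Sp d → ℝ) (x v : Sp d) :
    fderiv ℝ f x v = ∑ i, pd i f x * v i := by
  have hv : v = ∑ i, v i • EuclideanSpace.single i (1 : ℝ) := by
    ext j
    simp [Pi.single_apply]
  conv_lhs => rw [hv]
  rw [map_sum]
  simp [pd, mul_comm]

theorem fderiv_eq_sum_pd (f : Sp d → ℝ) (x : Sp d) :
    fderiv ℝ f x = ∑ i, pd i f x • (EuclideanSpace.proj i : Sp d →L[ℝ] ℝ) := by
  ext v
  simp [fderiv_apply_eq_sum_pd]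

theorem contDiffOn_succ_of_pd (hΩ : IsOpen Ω) {n : ℕ} (hf : DifferentiableOn ℝ f Ω)
    (h : ∀ i, ContDiffOn ℝ n (pd i f) Ω) : ContDiffOn ℝ (n + 1) f Ω := by
  rw [contDiffOn_succ_iff_fderiv_of_isOpen hΩ]
  refine ⟨hf, by simp, ?_⟩
  have : fderiv ℝ f = fun x => ∑ i, pd i f x • (EuclideanSpace.proj i : Sp d →L[ℝ] ℝ) :=
    funext (fderiv_eq_sum_pd f)
  rw [this]
  exact ContDiffOn.sum fun i _ => (h i).smul contDiffOn_const

/-- Gluing: near a point of C the regularity on U applies, and the complement of C is open and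
carries the zero function. Regularity on Ω thus becomes regularity on the whole space. -/
theorem contDiffAt_of_zero_off {E F : Type*} [NormedAddCommGroup E] [NormedSpace ℝ E]
    [NormedAddCommGroup F] [NormedSpace ℝ F] {U C : Set E} {u : E → F} {n : WithTop ℕ∞}
    (hU : IsOpen U) (hu : ContDiffOn ℝ n u U) (hC : IsClosed C) (hu0 : ∀ y, y ∉ C → u y = 0)
    {y : E} (hy : y ∈ C → y ∈ U) : ContDiffAt ℝ n u y := by
  by_cases h : y ∈ C
  · exact hu.contDiffAt (hU.mem_nhds (hy h))
  · refine (contDiffAt_const (c := (0 : F))).congr_of_eventuallyEq ?_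
    filter_upwards [hC.isOpen_compl.mem_nhds h] with z hz using hu0 z hz

theorem contDiff_of_zero_off {n : WithTop ℕ∞} (hΩ : IsOpen Ω) (hf : ContDiffOn ℝ n f Ω)
    (hK : IsCompact K) (hKΩ : K ⊆ Ω) (h0 : ∀ y, y ∉ K → f y = 0) : ContDiff ℝ n f :=
  contDiff_iff_contDiffAt.2 fun _ =>
    contDiffAt_of_zero_off hΩ hf hK.isClosed h0 fun h => hKΩ h

theorem tsupport_subset_of_zero_off (hK : IsClosed K) (h0 : ∀ y, y ∉ K → f y = 0) :
    tsupport f ⊆ K :=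
  closure_minimal (fun y hy => by by_contra h; exact hy (h0 y h)) hK

theorem isTest_of_zero_off (hΩ : IsOpen Ω) (hf : ContDiffOn ℝ ∞ f Ω)
    (hK : IsCompact K) (hKΩ : K ⊆ Ω) (h0 : ∀ y, y ∉ K → f y = 0) : IsTest Ω f where
  smooth := contDiff_of_zero_off hΩ hf hK hKΩ h0
  compact := HasCompactSupport.intro hK (fun y hy => h0 y hy)
  support := (tsupport_subset_of_zero_off hK.isClosed h0).trans hKΩ

theorem IsTest.zero_off (_ : IsTest Ω f) : ∀ y, y ∉ tsupport f → f y = 0 :=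
  fun _ hy => image_eq_zero_of_notMem_tsupport hy

theorem IsTest.isCompact (h : IsTest Ω f) : IsCompact (tsupport f) := h.compact

/-- Vanishing is asked only on Ω, since values elsewhere are irrelevant to the integral and often
uncontrolled. -/
theorem integrableOn_of_zero_off (hΩ : IsOpen Ω) (hf : ContinuousOn f Ω) (hK : IsCompact K) (hKΩ : K ⊆ Ω)
    (h0 : ∀ y ∈ Ω, y ∉ K → f y = 0) : IntegrableOn f Ω := by
  have h1 : IntegrableOn f K := (hf.mono hKΩ).integrableOn_compact hK
  exact h1.of_forall_sdiff_eq_zero hΩ.measurableSet fun y hy => h0 y hy.1 hy.2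

theorem setIntegral_of_zero_off (hΩ : IsOpen Ω) (hKΩ : K ⊆ Ω)
    (h0 : ∀ y ∈ Ω, y ∉ K → f y = 0) : ∫ y in Ω, f y = ∫ y in K, f y :=
  setIntegral_eq_of_subset_of_forall_sdiff_eq_zero hΩ.measurableSet hKΩ fun y hy => h0 y hy.1 hy.2

/-- The indicator extension of f is C¹ on the whole space because it vanishes off K. There, a
derivative of a compactly supported function integrates to zero. -/
theorem integral_pd_eq_zero (hΩ : IsOpen Ω) (hf : ContDiffOn ℝ 1 f Ω) (hK : IsCompact K)
    (hKΩ : K ⊆ Ω) (h0 : ∀ y ∈ Ω, y ∉ K → f y = 0) (i : Fin d) : ∫ y in Ω, pd i f y = 0 := by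
  classical
  set g : Sp d → ℝ := Ω.indicator f with hg
  have hfg : ∀ y ∈ Ω, f y = g y := fun y hy => by simp [hg, hy]
  have hg0 : ∀ y, y ∉ K → g y = 0 := by
    intro y hy
    by_cases hyΩ : y ∈ Ω
    · rw [← hfg y hyΩ, h0 y hyΩ hy]
    · simp [hg, hyΩ]
  have hgs : ContDiff ℝ 1 g :=
    contDiff_of_zero_off hΩ (hf.congr fun y hy => (hfg y hy).symm) hK hKΩ hg0
  have hgc : HasCompactSupport g := HasCompactSupport.intro hK fun y hy => hg0 y hy
  have e1 : ∫ y in Ω, pd i f y = ∫ y in Ω, pd i g y :=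
    setIntegral_congr_fun hΩ.measurableSet fun y hy => pd_congr_on hΩ hfg hy i
  have e2 : ∫ y in Ω, pd i g y = ∫ y, pd i g y :=
    setIntegral_eq_integral_of_forall_compl_eq_zero fun y hy =>
      pd_eq_zero_off hK.isClosed hg0 (fun h => hy (hKΩ h)) i
  rw [e1, e2]
  have hcont : Continuous (pd i g) :=
    (hgs.continuous_fderiv (by simp)).clm_apply continuous_const
  have hint : Integrable (pd i g) := hcont.integrable_of_hasCompactSupport
    (HasCompactSupport.intro hK fun y hy => pd_eq_zero_off hK.isClosed hg0 hy i)
  -- Integration by parts against the constant function 1.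
  have := integral_mul_fderiv_eq_neg_fderiv_mul_of_integrable (μ := (volume : Measure (Sp d)))
    (f := fun _ => (1 : ℝ)) (g := g) (v := EuclideanSpace.single i 1)
    (by simp) (by simpa using! hint)
    (by simpa using hgs.continuous.integrable_of_hasCompactSupport hgc)
    (fun _ _ => differentiableAt_const _) (fun y _ => hgs.differentiable (by simp) y)
  simpa [pd] using this

/-- Either factor may carry the compact support: potentials do not have it, so it must sometimes
come from the test function and sometimes from the field. -/
theorem integral_mul_div (hΩ : IsOpen Ω) {V : Sp d → Fin d → ℝ} (hf : ContDiffOn ℝ 1 f Ω)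
    (hV : ∀ i, ContDiffOn ℝ 1 (fun y => V y i) Ω) (hK : IsCompact K) (hKΩ : K ⊆ Ω)
    (h0 : (∀ y, y ∉ K → f y = 0) ∨ ∀ y, y ∉ K → V y = 0) :
    ∫ y in Ω, f y * div V y = -∫ y in Ω, grad f y ⬝ᵥ V y := by
  have hz1 : ∀ y ∈ Ω, y ∉ K → ∀ i, f y * pd i (fun z => V z i) y = 0 := by
    intro y _ hy i
    rcases h0 with h0 | h0
    · simp [h0 y hy]
    · rw [pd_eq_zero_off hK.isClosed (fun z hz => by rw [h0 z hz]; rfl) hy, mul_zero]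
  have hz2 : ∀ y ∈ Ω, y ∉ K → ∀ i, pd i f y * V y i = 0 := by
    intro y _ hy i
    rcases h0 with h0 | h0
    · rw [pd_eq_zero_off hK.isClosed h0 hy, zero_mul]
    · simp [h0 y hy]
  have hz3 : ∀ y ∈ Ω, y ∉ K → ∀ i, f y * V y i = 0 := by
    intro y _ hy i
    rcases h0 with h0 | h0
    · simp [h0 y hy]
    · simp [h0 y hy]
  have i1 : ∀ i, IntegrableOn (fun y => f y * pd i (fun z => V z i) y) Ω := fun i =>
    integrableOn_of_zero_off hΩ (hf.continuousOn.mul (pd_continuousOn hΩ (hV i) i)) hK hKΩ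
      fun y h1 h2 => hz1 y h1 h2 i
  have i2 : ∀ i, IntegrableOn (fun y => pd i f y * V y i) Ω := fun i =>
    integrableOn_of_zero_off hΩ ((pd_continuousOn hΩ hf i).mul (hV i).continuousOn) hK hKΩ
      fun y h1 h2 => hz2 y h1 h2 i
  have key : ∀ i, (∫ y in Ω, f y * pd i (fun z => V z i) y) + ∫ y in Ω, pd i f y * V y i = 0 := by
    intro i
    rw [← integral_add (i1 i) (i2 i), ← integral_pd_eq_zero hΩ (hf.mul (hV i)) hK hKΩ
      (fun y h1 h2 => hz3 y h1 h2 i) i]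
    refine setIntegral_congr_fun hΩ.measurableSet fun y hy => ?_
    have hy' := hΩ.mem_nhds hy
    have := pd_mul ((hf.contDiffAt hy').differentiableAt (by simp))
      (((hV i).contDiffAt hy').differentiableAt (by simp)) i
    rw [this]; ring
  simp only [div, dotProduct, grad, Finset.mul_sum]
  rw [integral_finsetSum _ fun i _ => i1 i, integral_finsetSum _ fun i _ => i2 i,
    ← Finset.sum_neg_distrib]
  exact Finset.sum_congr rfl fun i _ => by linarith [key i]

theorem integral_div_eq_zero (hΩ : IsOpen Ω) {V : Sp d → Fin d → ℝ}
    (hV : ∀ i, ContDiffOn ℝ 1 (fun y => V y i) Ω) (hK : IsCompact K) (hKΩ : K ⊆ Ω)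
    (h0 : ∀ y, y ∉ K → V y = 0) : ∫ y in Ω, div V y = 0 := by
  have := integral_mul_div hΩ (contDiffOn_const (c := (1 : ℝ))) hV hK hKΩ (Or.inr h0)
  simpa [grad, pd_const, dotProduct] using this

theorem wDiv_zero_off {ρ Φ : Sp d → ℝ} (hK : IsClosed K) (h : ∀ y, y ∉ K → Φ y = 0)
    (hx : x ∉ K) : wDiv ρ Φ x = 0 := by
  unfold wDiv div
  refine Finset.sum_eq_zero fun i _ => pd_eq_zero_off hK (fun y hy => ?_) hx i
  simp [grad_eq_zero_off hK h hy]

theorem wDiv_contDiffOn (hΩ : IsOpen Ω) {ρ Φ : Sp d → ℝ} {m n : WithTop ℕ∞} {l : WithTop ℕ∞}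
    (hρ : ContDiffOn ℝ m ρ Ω) (hΦ : ContDiffOn ℝ n Φ Ω) (hm : l + 1 ≤ m) (hn : l + 1 + 1 ≤ n) :
    ContDiffOn ℝ l (wDiv ρ Φ) Ω := by
  unfold wDiv div
  refine ContDiffOn.sum fun i _ => pd_contDiffOn hΩ (n := l + 1) ?_ le_rfl i
  exact (hρ.of_le hm).mul (pd_contDiffOn hΩ hΦ hn i)

/-- Green's identity with weight ρ; nearly every later identity for the Hessian form comes from it.
-/
theorem integral_mul_wDiv (hΩ : IsOpen Ω) {ρ Φ : Sp d → ℝ} (hf : ContDiffOn ℝ 1 f Ω)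
    (hρ : ContDiffOn ℝ 1 ρ Ω) (hΦ : ContDiffOn ℝ 2 Φ Ω) (hK : IsCompact K) (hKΩ : K ⊆ Ω)
    (h0 : (∀ y, y ∉ K → f y = 0) ∨ ∀ y, y ∉ K → Φ y = 0) :
    ∫ y in Ω, f y * wDiv ρ Φ y = -∫ y in Ω, (grad f y ⬝ᵥ grad Φ y) * ρ y := by
  unfold wDiv
  rw [integral_mul_div (V := fun y => ρ y • grad Φ y) hΩ hf (fun i => hρ.mul (pd_contDiffOn hΩ hΦ (by norm_num) i)) hK hKΩ]
  · congr 1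
    refine integral_congr_ae (Eventually.of_forall fun y => ?_)
    simp [dotProduct_smul, mul_comm]
  · exact h0.imp id fun h y hy => by simp [grad_eq_zero_off hK.isClosed h hy]

/-- The fundamental lemma of the calculus of variations gives vanishing almost everywhere, and
continuity upgrades it to every point of the open set. -/
theorem eq_zero_of_integral_test_mul (hΩ : IsOpen Ω) (hf : ContinuousOn f Ω)
    (h : ∀ Ψ, IsTest Ω Ψ → ∫ y in Ω, Ψ y * f y = 0) : ∀ y ∈ Ω, f y = 0 := by
  have h1 := hΩ.ae_eq_zero_of_integral_contDiff_smul_eq_zero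
    (μ := (volume : Measure (Sp d))) (f := f) (hf.locallyIntegrableOn hΩ.measurableSet) (by
      intro Ψ hΨ hc hs
      have := h Ψ ⟨hΨ, hc, hs⟩
      rw [setIntegral_eq_integral_of_forall_compl_eq_zero] at this
      · simpa using this
      · intro y hy
        rw [image_eq_zero_of_notMem_tsupport (fun h => hy (hs h)), zero_mul])
  have h2 : f =ᵐ[volume.restrict Ω] 0 := (ae_restrict_iff' hΩ.measurableSet).2 h1
  exact Measure.eqOn_open_of_ae_eq h2 hΩ hf continuousOn_const

end Calculus

end WassersteinNewton

namespace WassersteinNewton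

/-! ### Time-dependent functions: uniform difference quotients and a mean value theorem. -/

section TimeDependent

variable {E F : Type*} [NormedAddCommGroup E] [NormedSpace ℝ E]
  [NormedAddCommGroup F] [NormedSpace ℝ F] {u : ℝ → E → F} {s : ℝ} {x : E}

theorem hasDerivAt_time (h : DifferentiableAt ℝ (fun p : ℝ × E => u p.1 p.2) (s, x)) :
    HasDerivAt (fun s' => u s' x) (fderiv ℝ (fun p : ℝ × E => u p.1 p.2) (s, x) (1, 0)) s := by
  have h1 : HasDerivAt (fun s' : ℝ => (s', x)) ((1 : ℝ), (0 : E)) s :=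
    (hasDerivAt_id s).prodMk (hasDerivAt_const s x)
  exact h.hasFDerivAt.comp_hasDerivAt_of_eq s h1 rfl

theorem hasFDerivAt_space (h : DifferentiableAt ℝ (fun p : ℝ × E => u p.1 p.2) (s, x)) :
    HasFDerivAt (u s) ((fderiv ℝ (fun p : ℝ × E => u p.1 p.2) (s, x)).comp
      (ContinuousLinearMap.inr ℝ ℝ E)) x := by
  have h1 : HasFDerivAt (fun y : E => (s, y)) (ContinuousLinearMap.inr ℝ ℝ E) x :=
    hasFDerivAt_prodMk_right s x
  exact h.hasFDerivAt.comp x h1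

/-- Both sides, applied to v, are the second derivative of the joint function on the pair (1,0),
(0,v), in the two orders. -/
theorem deriv_fderiv_comm (h : ContDiffAt ℝ 2 (fun p : ℝ × E => u p.1 p.2) (s, x)) :
    deriv (fun s' => fderiv ℝ (u s') x) s =
      fderiv ℝ (fun y => deriv (fun s' => u s' y) s) x := by
  set U : ℝ × E → F := fun p => u p.1 p.2 with hU
  have hev : ∀ᶠ p : ℝ × E in 𝓝 (s, x), DifferentiableAt ℝ U p :=
    (h.eventually (by simp)).mono fun p hp => hp.differentiableAt (by simp)
  have hd : DifferentiableAt ℝ (fderiv ℝ U) (s, x) :=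
    (h.fderiv_right (m := 1) (by norm_num)).differentiableAt (by simp)
  have hs : IsSymmSndFDerivAt ℝ U (s, x) := h.isSymmSndFDerivAt (by simp)
  have hc1 : Tendsto (fun s' : ℝ => (s', x)) (𝓝 s) (𝓝 (s, x)) :=
    (continuous_id.prodMk continuous_const).tendsto s
  have hc2 : Tendsto (fun y : E => (s, y)) (𝓝 x) (𝓝 (s, x)) :=
    (continuous_const.prodMk continuous_id).tendsto x
  have e1 : (fun s' => fderiv ℝ (u s') x) =ᶠ[𝓝 s]
      fun s' => (fderiv ℝ U (s', x)).comp (ContinuousLinearMap.inr ℝ ℝ E) := by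
    filter_upwards [hc1.eventually hev] with s' hs'
    exact (hasFDerivAt_space hs').fderiv
  have e2 : (fun y => deriv (fun s' => u s' y) s) =ᶠ[𝓝 x]
      fun y => fderiv ℝ U (s, y) (1, 0) := by
    filter_upwards [hc2.eventually hev] with y hy
    exact (hasDerivAt_time hy).deriv
  have d1 : HasDerivAt (fun s' => fderiv ℝ U (s', x)) (fderiv ℝ (fderiv ℝ U) (s, x) (1, 0)) s :=
    hasDerivAt_time (u := fun s' y => fderiv ℝ U (s', y)) hd
  have d2 : HasFDerivAt (fun y => fderiv ℝ U (s, y)) ((fderiv ℝ (fderiv ℝ U) (s, x)).comp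
      (ContinuousLinearMap.inr ℝ ℝ E)) x :=
    hasFDerivAt_space (u := fun s' y => fderiv ℝ U (s', y)) hd
  rw [e1.deriv_eq, e2.fderiv_eq]
  have d1' := (ContinuousLinearMap.precomp F (ContinuousLinearMap.inr ℝ ℝ E)).hasFDerivAt.comp_hasDerivAt
    s d1
  have d2' := d2.clm_apply (hasFDerivAt_const ((1 : ℝ), (0 : E)) x)
  rw [d2'.fderiv]
  refine d1'.deriv.trans ?_
  ext v
  simpa using hs (1, 0) (0, v)

theorem contDiffOn_time {W : Set (ℝ × E)} (hW : IsOpen W)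
    (h : ContDiffOn ℝ ∞ (fun p : ℝ × E => u p.1 p.2) W) :
    ContDiffOn ℝ ∞ (fun p : ℝ × E => deriv (fun s' => u s' p.2) p.1) W := by
  refine ((h.fderiv_of_isOpen hW (m := ∞) (by simp)).clm_apply
    (contDiffOn_const (c := ((1 : ℝ), (0 : E))))).congr fun p hp => ?_
  exact (hasDerivAt_time ((h.contDiffAt (hW.mem_nhds hp)).differentiableAt (by simp))).deriv

theorem contDiffOn_space {W : Set (ℝ × E)} (hW : IsOpen W)
    (h : ContDiffOn ℝ ∞ (fun p : ℝ × E => u p.1 p.2) W) :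
    ContDiffOn ℝ ∞ (fun p : ℝ × E => fderiv ℝ (u p.1) p.2) W := by
  refine ((ContinuousLinearMap.precomp F (ContinuousLinearMap.inr ℝ ℝ E)).contDiff.comp_contDiffOn
    (h.fderiv_of_isOpen hW (m := ∞) (by simp))).congr fun p hp => ?_
  exact (hasFDerivAt_space ((h.contDiffAt (hW.mem_nhds hp)).differentiableAt (by simp))).fderiv

/-- Joint continuity of ∂ₛG and compactness of K make ∂ₛG(s,y) - ∂ₛG(s₀,y) uniformly small. The mean
value inequality transfers this to the quotients, and off K everything vanishes. -/
theorem eventually_norm_quotient_le {I : Set ℝ} {K : Set E} {G : ℝ → E → F} (hI : IsOpen I)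
    (hG : ContDiffOn ℝ ∞ (fun p : ℝ × E => G p.1 p.2) (I ×ˢ univ)) (hK : IsCompact K)
    (h0 : ∀ s ∈ I, ∀ y, y ∉ K → G s y = 0) {s₀ : ℝ} (hs₀ : s₀ ∈ I) {δ : ℝ} (hδ : 0 < δ) :
    ∀ᶠ s in 𝓝[≠] s₀, ∀ y, ‖(s - s₀)⁻¹ • (G s y - G s₀ y) - deriv (fun s' => G s' y) s₀‖ ≤ δ := by
  have hW : IsOpen (I ×ˢ (univ : Set E)) := hI.prod isOpen_univ
  have hcont := (contDiffOn_time hW hG).continuousOn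
  have hdiff : ∀ s ∈ I, ∀ y, HasDerivAt (fun s' => G s' y) (deriv (fun s' => G s' y) s) s := by
    intro s hs y
    exact (hasDerivAt_time ((hG.contDiffAt (hW.mem_nhds ⟨hs, mem_univ y⟩)).differentiableAt
      (by simp))).differentiableAt.hasDerivAt
  have h1 : ∀ᶠ s in 𝓝 s₀, ∀ y ∈ K,
      ‖deriv (fun s' => G s' y) s - deriv (fun s' => G s' y) s₀‖ ≤ δ := by
    refine hK.eventually_forall_of_forall_eventually (P := fun s y =>
      ‖deriv (fun s' => G s' y) s - deriv (fun s' => G s' y) s₀‖ ≤ δ) fun y _ => ?_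
    have c1 : ContinuousAt (fun p : ℝ × E => deriv (fun s' => G s' p.2) p.1) (s₀, y) :=
      hcont.continuousAt (hW.mem_nhds ⟨hs₀, mem_univ y⟩)
    have c2 : ContinuousAt (fun p : ℝ × E => deriv (fun s' => G s' p.2) s₀) (s₀, y) :=
      ContinuousAt.comp_of_eq (g := fun p : ℝ × E => deriv (fun s' => G s' p.2) p.1)
        (f := fun p : ℝ × E => (s₀, p.2)) c1 (by fun_prop) rfl
    have c3 := (c1.sub c2).norm
    have : (0 : ℝ) < δ := hδ
    have c4 := c3.tendsto.eventually_le_const (u := δ) (by simpa using hδ)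
    exact c4
  obtain ⟨η, hη, hball⟩ := Metric.eventually_nhds_iff_ball.1 (h1.and (hI.mem_nhds hs₀))
  rw [eventually_nhdsWithin_iff]
  filter_upwards [Metric.ball_mem_nhds s₀ hη] with s hs hne y
  have hne' : s - s₀ ≠ 0 := sub_ne_zero.2 hne
  by_cases hy : y ∈ K
  -- With its linear part at s₀ subtracted, the curve s ↦ G s y has derivative at most δ on the
  -- ball.
  · have hconv := convex_ball s₀ η
    have := hconv.norm_image_sub_le_of_norm_hasDerivWithin_le
      (f := fun s' => G s' y - s' • deriv (fun s' => G s' y) s₀)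
      (f' := fun s' => deriv (fun s' => G s' y) s' - deriv (fun s' => G s' y) s₀) (C := δ)
      (fun s' hs' => by
        have := (hdiff s' (hball s' hs').2 y).fun_sub
          ((hasDerivAt_id s').smul_const (deriv (fun s' => G s' y) s₀))
        simpa using this.hasDerivWithinAt)
      (fun s' hs' => (hball s' hs').1 y hy) (Metric.mem_ball_self hη) hs
    have e : (s - s₀)⁻¹ • (G s y - G s₀ y) - deriv (fun s' => G s' y) s₀ =
        (s - s₀)⁻¹ • ((G s y - s • deriv (fun s' => G s' y) s₀) -
          (G s₀ y - s₀ • deriv (fun s' => G s' y) s₀)) := by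
      rw [sub_sub_sub_comm, ← sub_smul, smul_sub (s - s₀)⁻¹ (G s y - G s₀ y), smul_smul,
        inv_mul_cancel₀ hne', one_smul]
    rw [e, norm_smul, norm_inv]
    rw [inv_mul_le_iff₀ (norm_pos_iff.2 hne'), mul_comm]
    exact this
  · have hz : deriv (fun s' => G s' y) s₀ = 0 := by
      have : (fun s' => G s' y) =ᶠ[𝓝 s₀] fun _ => 0 := by
        filter_upwards [hI.mem_nhds hs₀] with s' hs' using h0 s' hs' y hy
      rw [this.deriv_eq]; simp
    rw [hz, h0 s (hball s hs).2 y hy, h0 s₀ hs₀ y hy]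
    simpa using hδ.le

end TimeDependent

/-- Induction on m, replacing G by its space derivative. The target changes from F to E →L[ℝ] F, so
F and G must vary in the induction, and both spaces sit in `Type` to keep the universe fixed. -/
theorem eventually_norm_iteratedFDeriv_quotient_le {E F : Type} [NormedAddCommGroup E]
    [NormedSpace ℝ E] [NormedAddCommGroup F] [NormedSpace ℝ F] {I : Set ℝ} {K : Set E}
    (hI : IsOpen I) (hK : IsCompact K) {s₀ : ℝ} (hs₀ : s₀ ∈ I) {δ : ℝ} (hδ : 0 < δ) (m : ℕ) :
    ∀ {G : ℝ → E → F},
      ContDiffOn ℝ ∞ (fun p : ℝ × E => G p.1 p.2) (I ×ˢ univ) →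
      (∀ s ∈ I, ∀ y, y ∉ K → G s y = 0) →
      ∀ᶠ s in 𝓝[≠] s₀, ∀ y, ‖iteratedFDeriv ℝ m
        (fun x => (s - s₀)⁻¹ • (G s x - G s₀ x) - deriv (fun s' => G s' x) s₀) y‖ ≤ δ := by
  induction m generalizing F with
  | zero =>
    intro G hG h0
    filter_upwards [eventually_norm_quotient_le hI hG hK h0 hs₀ hδ] with s hs y
    rw [norm_iteratedFDeriv_zero]
    exact hs y
  | succ m ih =>
    intro G hG h0
    have hW : IsOpen (I ×ˢ (univ : Set E)) := hI.prod isOpen_univ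
    have h0' : ∀ s ∈ I, ∀ y, y ∉ K → fderiv ℝ (G s) y = 0 := by
      intro s hs y hy
      have : G s =ᶠ[𝓝 y] fun _ => 0 := by
        filter_upwards [hK.isClosed.isOpen_compl.mem_nhds hy] with z hz using h0 s hs z hz
      rw [this.fderiv_eq]; simp
    have := ih (G := fun s y => fderiv ℝ (G s) y) (contDiffOn_space hW hG) h0'
    filter_upwards [this, mem_nhdsWithin_of_mem_nhds (hI.mem_nhds hs₀)] with s hs hsI y
    rw [← norm_iteratedFDeriv_fderiv]
    refine le_of_eq_of_le ?_ (hs y)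
    congr 2
    funext z
    have hd : ∀ t ∈ I, DifferentiableAt ℝ (G t) z := fun t ht =>
      (hasFDerivAt_space ((hG.contDiffAt (hW.mem_nhds ⟨ht, mem_univ z⟩)).differentiableAt
        (by simp))).differentiableAt
    have hd2 : DifferentiableAt ℝ (fun x => deriv (fun s' => G s' x) s₀) z :=
      (hasFDerivAt_space (u := fun s x => deriv (fun s' => G s' x) s)
        (((contDiffOn_time hW hG).contDiffAt
        (hW.mem_nhds ⟨hs₀, mem_univ z⟩)).differentiableAt (by simp))).differentiableAt
    -- Commuting the time and space derivatives identifies the derivative of the remainder with the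
    -- remainder of the derivative.
    rw [deriv_fderiv_comm ((hG.contDiffAt (hW.mem_nhds ⟨hs₀, mem_univ z⟩)).of_le (by decide))]
    rw [fderiv_fun_sub (((hd s hsI).fun_sub (hd s₀ hs₀)).fun_const_smul _) hd2,
      fderiv_fun_const_smul ((hd s hsI).fun_sub (hd s₀ hs₀)), fderiv_fun_sub (hd s hsI) (hd s₀ hs₀)]

theorem tendsto_integral_mul {d : ℕ} {Ω K : Set (Sp d)} (hΩ : IsOpen Ω) (hK : IsCompact K)
    (hKΩ : K ⊆ Ω) {f g : ℕ → Sp d → ℝ} {f₀ g₀ : Sp d → ℝ} (hf : ∀ n, ContinuousOn (f n) K)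
    (hf₀ : ContinuousOn f₀ K) (hg : ∀ n, ContinuousOn (g n) K) (hg₀ : ContinuousOn g₀ K)
    (hfu : TendstoUniformlyOn f f₀ atTop K) (hgu : TendstoUniformlyOn g g₀ atTop K)
    (hz : ∀ n, ∀ y ∈ Ω, y ∉ K → g n y = 0) (hz₀ : ∀ y ∈ Ω, y ∉ K → g₀ y = 0) :
    Tendsto (fun n => ∫ y in Ω, f n y * g n y) atTop (𝓝 (∫ y in Ω, f₀ y * g₀ y)) := by
  have e1 : ∀ n, ∫ y in Ω, f n y * g n y = ∫ y in K, f n y * g n y := fun n =>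
    setIntegral_of_zero_off hΩ hKΩ fun y h1 h2 => by rw [hz n y h1 h2, mul_zero]
  have e2 : ∫ y in Ω, f₀ y * g₀ y = ∫ y in K, f₀ y * g₀ y :=
    setIntegral_of_zero_off hΩ hKΩ fun y h1 h2 => by rw [hz₀ y h1 h2, mul_zero]
  simp only [e1, e2]
  obtain ⟨M, hM⟩ := hK.exists_bound_of_continuousOn hf₀
  obtain ⟨N, hN⟩ := hK.exists_bound_of_continuousOn hg₀
  -- The limits are bounded by M and N on K; uniform closeness within 1 adds the two units, for all
  -- large n.
  refine tendsto_integral_filter_of_dominated_convergence (fun _ => (M + 1) * (N + 1)) ?_ ?_ ?_ ?_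
  · exact Eventually.of_forall fun n =>
      ((hf n).mul (hg n)).aestronglyMeasurable hK.measurableSet
  · filter_upwards [Metric.tendstoUniformlyOn_iff.1 hfu 1 one_pos,
      Metric.tendstoUniformlyOn_iff.1 hgu 1 one_pos] with n h1 h2
    refine (ae_restrict_iff' hK.measurableSet).2 (Eventually.of_forall fun y hy => ?_)
    have a1 : ‖f n y‖ ≤ M + 1 := by
      have := h1 y hy
      rw [dist_eq_norm] at this
      have h3 := norm_sub_norm_le (f n y) (f₀ y)
      rw [norm_sub_rev] at h3
      linarith [hM y hy]
    have a2 : ‖g n y‖ ≤ N + 1 := by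
      have := h2 y hy
      rw [dist_eq_norm] at this
      have h3 := norm_sub_norm_le (g n y) (g₀ y)
      rw [norm_sub_rev] at h3
      linarith [hN y hy]
    rw [norm_mul]
    exact mul_le_mul a1 a2 (norm_nonneg _) ((norm_nonneg _).trans a1)
  · exact (integrableOn_const hK.measure_lt_top.ne (by finiteness))
  · refine (ae_restrict_iff' hK.measurableSet).2 (Eventually.of_forall fun y hy => ?_)
    exact (hfu.tendsto_at hy).mul (hgu.tendsto_at hy)

/-- The hypotheses have the shape that segments of densities provide: from the point t one moves to
the endpoint 1 with speed 1 - t, or to the endpoint 0 with speed t. Rescaled, these are right and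
left derivatives with the same value g t. So f is differentiable inside and continuous up to the
ends, and Lagrange's theorem applies. -/
theorem exists_eq_of_segment_derivatives {f g : ℝ → ℝ}
    (hr : ∀ t ∈ Ico (0 : ℝ) 1,
      HasDerivWithinAt (fun τ => f (t + τ * (1 - t))) ((1 - t) * g t) (Ici 0) 0)
    (hl : ∀ t ∈ Ioc (0 : ℝ) 1,
      HasDerivWithinAt (fun τ => f (t - τ * t)) (-t * g t) (Ici 0) 0) :
    ∃ t ∈ Ioo (0 : ℝ) 1, f 1 - f 0 = g t := by
  have hr' : ∀ t ∈ Ico (0 : ℝ) 1, HasDerivWithinAt f (g t) (Ici t) t := by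
    intro t ht
    have hpos : 0 < 1 - t := by linarith [ht.2]
    have hlin : HasDerivWithinAt (fun v : ℝ => (v - t) / (1 - t)) (1 / (1 - t)) (Ici t) t :=
      (((hasDerivAt_id t).sub_const t).div_const (1 - t)).hasDerivWithinAt
    have := HasDerivWithinAt.comp_of_eq t (h := fun v : ℝ => (v - t) / (1 - t)) (s' := Ici 0)
      (hr t ht) hlin (fun v hv => div_nonneg (by simpa using hv) hpos.le) (by simp)
    refine (this.congr_deriv (by field_simp)).congr (fun v _ => ?_) ?_ <;>
    · simp only [Function.comp]; congr 1; field_simp; ring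
  have hl' : ∀ t ∈ Ioc (0 : ℝ) 1, HasDerivWithinAt f (g t) (Iic t) t := by
    intro t ht
    have hpos : 0 < t := ht.1
    have hlin : HasDerivWithinAt (fun v : ℝ => (t - v) / t) (-1 / t) (Iic t) t :=
      (((hasDerivAt_id t).const_sub t).div_const t).hasDerivWithinAt
    have := HasDerivWithinAt.comp_of_eq t (h := fun v : ℝ => (t - v) / t) (s' := Ici 0)
      (hl t ht) hlin (fun v hv => div_nonneg (by simpa using hv) hpos.le) (by simp)
    refine (this.congr_deriv (by field_simp)).congr (fun v _ => ?_) ?_ <;>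
    · simp only [Function.comp]; congr 1; field_simp; ring
  have hd : ∀ t ∈ Ioo (0 : ℝ) 1, HasDerivAt f (g t) t := by
    intro t ht
    have := (hl' t ⟨ht.1, ht.2.le⟩).union (hr' t ⟨ht.1.le, ht.2⟩)
    rwa [Iic_union_Ici, hasDerivWithinAt_univ] at this
  have hc : ContinuousOn f (Icc 0 1) := by
    intro t ht
    rcases eq_or_lt_of_le ht.1 with h | h
    · subst h
      exact (hr' 0 ⟨le_rfl, one_pos⟩).continuousWithinAt.mono Icc_subset_Ici_self
    rcases eq_or_lt_of_le ht.2 with h' | h'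
    · subst h'
      exact (hl' 1 ⟨one_pos, le_rfl⟩).continuousWithinAt.mono Icc_subset_Iic_self
    · exact (hd t ⟨h, h'⟩).continuousAt.continuousWithinAt
  obtain ⟨t, ht, h⟩ := exists_hasDerivAt_eq_slope f g one_pos hc hd
  exact ⟨t, ht, by rw [h]; simp⟩

end WassersteinNewton

namespace WassersteinNewton

/-! ### Convergence in C_c^∞(Ω) and mean values of the variations along segments. -/

section TestFunctions

variable {d : ℕ} {Ω K : Set (Sp d)} {φ ψ : Sp d → ℝ}

theorem IsTest.add (hφ : IsTest Ω φ) (hψ : IsTest Ω ψ) : IsTest Ω (φ + ψ) where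
  smooth := hφ.smooth.add hψ.smooth
  compact := hφ.compact.add hψ.compact
  support := (tsupport_add φ ψ).trans (union_subset hφ.support hψ.support)

theorem IsTest.smul (hφ : IsTest Ω φ) (c : ℝ) : IsTest Ω (c • φ) where
  smooth := contDiff_const.smul hφ.smooth
  compact := hφ.compact.smul_left (f := fun _ => c)
  support := (tsupport_smul_subset_right (fun _ => c) φ).trans hφ.support

theorem isTest_zero : IsTest Ω (0 : Sp d → ℝ) where
  smooth := contDiff_const
  compact := HasCompactSupport.zero
  support := by simp [tsupport]

theorem IsTest.continuous (hφ : IsTest Ω φ) : Continuous φ := hφ.smooth.continuous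

theorem TestTendsto.smul_zero {φs : ℕ → Sp d → ℝ} (h : TestTendsto Ω φs φ) {c : ℕ → ℝ}
    (hc : Tendsto c atTop (𝓝 0)) : TestTendsto Ω (fun n => c n • φs n) 0 := by
  obtain ⟨h1, h2, ⟨K, hK, hKΩ, hs⟩, h3⟩ := h
  refine ⟨fun n => (h1 n).smul _, isTest_zero, ⟨K, hK, hKΩ, fun n =>
    (tsupport_smul_subset_right (fun _ => c n) (φs n)).trans (hs n)⟩, fun m => ?_⟩
  -- The m-th derivatives of a convergent sequence are eventually bounded by B + 1, so null scalars
  -- send them uniformly to zero.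
  have hb : ∃ B, ∀ x, ‖iteratedFDeriv ℝ m φ x‖ ≤ B :=
    (h2.smooth.continuous_iteratedFDeriv (by exact_mod_cast le_top)).bounded_above_of_compact_support
      (h2.compact.iteratedFDeriv m)
  obtain ⟨B, hB⟩ := hb
  have hB0 : 0 ≤ B := (norm_nonneg _).trans (hB 0)
  rw [Metric.tendstoUniformly_iff]
  intro δ hδ
  have hc' : Tendsto (fun n => ‖c n‖ * (B + 1)) atTop (𝓝 0) := by
    simpa using hc.norm.mul_const (B + 1)
  filter_upwards [Metric.tendstoUniformly_iff.1 (h3 m) 1 one_pos, hc'.eventually_lt_const hδ]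
    with n hn hcn x
  have e : iteratedFDeriv ℝ m (c n • φs n) x = c n • iteratedFDeriv ℝ m (φs n) x :=
    iteratedFDeriv_const_smul_apply ((h1 n).smooth.contDiffAt.of_le (by exact_mod_cast le_top))
  have e0 : iteratedFDeriv ℝ m (0 : Sp d → ℝ) x = 0 := by
    rw [show (0 : Sp d → ℝ) = fun _ => 0 from rfl, iteratedFDeriv_fun_zero]; rfl
  rw [e, e0, dist_zero_left, norm_smul]
  have hx := hn x
  rw [dist_eq_norm] at hx
  have h4 := norm_sub_norm_le (iteratedFDeriv ℝ m (φs n) x) (iteratedFDeriv ℝ m φ x)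
  rw [norm_sub_rev] at h4
  calc ‖c n‖ * ‖iteratedFDeriv ℝ m (φs n) x‖ ≤ ‖c n‖ * (B + 1) := by
        gcongr; linarith [hB x]
    _ < δ := hcn

theorem TestTendsto.tendstoUniformlyOn {φs : ℕ → Sp d → ℝ} (h : TestTendsto Ω φs φ)
    (S : Set (Sp d)) : TendstoUniformlyOn φs φ atTop S := by
  have h0 := h.2.2.2 0
  rw [Metric.tendstoUniformly_iff] at h0
  rw [Metric.tendstoUniformlyOn_iff]
  intro δ hδ
  filter_upwards [h0 δ hδ] with n hn x _
  have := hn x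
  rw [dist_eq_norm, ← iteratedFDeriv_sub_apply
    (h.2.1.smooth.contDiffAt.of_le (by exact_mod_cast le_top))
    ((h.1 n).smooth.contDiffAt.of_le (by exact_mod_cast le_top)), norm_iteratedFDeriv_zero] at this
  rwa [dist_eq_norm]

theorem testTendsto_quotient {I : Set ℝ} {G : ℝ → Sp d → ℝ} (hI : IsOpen I)
    (hG : ContDiffOn ℝ ∞ (fun p : ℝ × Sp d => G p.1 p.2) (I ×ˢ univ)) (hK : IsCompact K)
    (hKΩ : K ⊆ Ω) (h0 : ∀ s ∈ I, ∀ y, y ∉ K → G s y = 0) {s₀ : ℝ} (hs₀ : s₀ ∈ I)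
    {s : ℕ → ℝ} (hs : ∀ n, s n ∈ I) (hs' : Tendsto s atTop (𝓝[≠] s₀)) :
    TestTendsto Ω (fun n => (s n - s₀)⁻¹ • (G (s n) - G s₀))
      (fun x => deriv (fun s' => G s' x) s₀) := by
  have hsm : ∀ t ∈ I, ContDiff ℝ ∞ (G t) := fun t ht =>
    contDiffOn_univ.1 (hG.comp (contDiff_prodMk_right t).contDiffOn fun y hy => ⟨ht, hy⟩)
  have hG' := contDiffOn_time (hI.prod isOpen_univ) hG
  have hsm' : ContDiff ℝ ∞ (fun x => deriv (fun s' => G s' x) s₀) :=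
    contDiffOn_univ.1 (hG'.comp (contDiff_prodMk_right s₀).contDiffOn fun y hy => ⟨hs₀, hy⟩)
  have hz : ∀ y, y ∉ K → deriv (fun s' => G s' y) s₀ = 0 := by
    intro y hy
    have : (fun s' => G s' y) =ᶠ[𝓝 s₀] fun _ => 0 := by
      filter_upwards [hI.mem_nhds hs₀] with t ht using h0 t ht y hy
    rw [this.deriv_eq]; simp
  have hq : ∀ n, ∀ y, y ∉ K → ((s n - s₀)⁻¹ • (G (s n) - G s₀)) y = 0 := fun n y hy => by
    simp [h0 _ (hs n) y hy, h0 _ hs₀ y hy]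
  have hqs : ∀ n, ContDiff ℝ ∞ ((s n - s₀)⁻¹ • (G (s n) - G s₀)) := fun n =>
    contDiff_const.smul ((hsm _ (hs n)).sub (hsm _ hs₀))
  refine ⟨fun n => ⟨hqs n, HasCompactSupport.intro hK (hq n),
    (tsupport_subset_of_zero_off hK.isClosed (hq n)).trans hKΩ⟩,
    ⟨hsm', HasCompactSupport.intro hK hz,
    (tsupport_subset_of_zero_off hK.isClosed hz).trans hKΩ⟩, ⟨K, hK, hKΩ, fun n =>
    tsupport_subset_of_zero_off hK.isClosed (hq n)⟩, fun m => ?_⟩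
  rw [Metric.tendstoUniformly_iff]
  intro δ hδ
  have := hs'.eventually (eventually_norm_iteratedFDeriv_quotient_le hI hK hs₀ (half_pos hδ) m hG h0)
  filter_upwards [this] with n hn x
  rw [dist_comm, dist_eq_norm, ← iteratedFDeriv_sub_apply
    ((hqs n).contDiffAt.of_le (by exact_mod_cast le_top))
    (hsm'.contDiffAt.of_le (by exact_mod_cast le_top))]
  exact lt_of_le_of_lt (hn x) (half_lt_self hδ)

/-- At the intermediate density the directions towards ρ₂ and ρ₁ are (1 - t)(ρ₂ - ρ₁) and -t(ρ₂ -
ρ₁). Both are admissible, so the one-sided first variation is enough. -/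
theorem HasVariations.exists_energy_sub_eq {A : Set (Sp d → ℝ)} {E : (Sp d → ℝ) → ℝ}
    {D : (Sp d → ℝ) → Sp d → ℝ} {L : (Sp d → ℝ) → (Sp d → ℝ) → Sp d → ℝ}
    (hV : HasVariations Ω A E D L) {ρ₁ ρ₂ : Sp d → ℝ}
    (hseg : ∀ t ∈ Icc (0 : ℝ) 1, ρ₁ + t • (ρ₂ - ρ₁) ∈ A) (ht : IsTest Ω (ρ₂ - ρ₁)) :
    ∃ t ∈ Ioo (0 : ℝ) 1, E ρ₂ - E ρ₁ =
      ∫ x in Ω, D (ρ₁ + t • (ρ₂ - ρ₁)) x * (ρ₂ x - ρ₁ x) := by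
  have h1 : ρ₁ ∈ A := by simpa using hseg 0 (by simp)
  have h2 : ρ₂ ∈ A := by simpa using hseg 1 (by simp)
  obtain ⟨t, ht', h⟩ := exists_eq_of_segment_derivatives (f := fun t => E (ρ₁ + t • (ρ₂ - ρ₁)))
    (g := fun t => ∫ x in Ω, D (ρ₁ + t • (ρ₂ - ρ₁)) x * (ρ₂ x - ρ₁ x)) (fun t htt => by
      have e : ρ₂ - (ρ₁ + t • (ρ₂ - ρ₁)) = (1 - t) • (ρ₂ - ρ₁) := by
        rw [sub_smul, one_smul]; abel
      have := hV.first _ (hseg t ⟨htt.1, htt.2.le⟩) ρ₂ h2 (by rw [e]; exact ht.smul _)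
      rw [e] at this
      refine (this.congr_deriv ?_).congr (fun τ _ => ?_) ?_
      · rw [← integral_const_mul]
        refine integral_congr_ae (Eventually.of_forall fun x => ?_)
        simp; ring
      · simp only [smul_smul, add_smul, add_assoc]
      · simp) (fun t htt => by
      have e : ρ₁ - (ρ₁ + t • (ρ₂ - ρ₁)) = (-t) • (ρ₂ - ρ₁) := by
        rw [neg_smul]; abel
      have := hV.first _ (hseg t ⟨htt.1.le, htt.2⟩) ρ₁ h1 (by rw [e]; exact ht.smul _)
      rw [e] at this
      refine (this.congr_deriv ?_).congr (fun τ _ => ?_) ?_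
      · rw [← integral_const_mul]
        refine integral_congr_ae (Eventually.of_forall fun x => ?_)
        simp; ring
      · simp only [show ρ₁ + (t - τ * t) • (ρ₂ - ρ₁) =
          ρ₁ + t • (ρ₂ - ρ₁) + τ • (-t) • (ρ₂ - ρ₁) by module]
      · simp)
  exact ⟨t, ht', by simpa using h⟩

/-- The same argument for δE/δρ at a fixed point. The intermediate parameter t depends on x, which
costs an extra step when uniformity in x is needed. -/
theorem HasVariations.exists_first_sub_eq {A : Set (Sp d → ℝ)} {E : (Sp d → ℝ) → ℝ}
    {D : (Sp d → ℝ) → Sp d → ℝ} {L : (Sp d → ℝ) → (Sp d → ℝ) → Sp d → ℝ}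
    (hV : HasVariations Ω A E D L) {ρ₁ ρ₂ : Sp d → ℝ}
    (hseg : ∀ t ∈ Icc (0 : ℝ) 1, ρ₁ + t • (ρ₂ - ρ₁) ∈ A) (ht : IsTangentTest Ω (ρ₂ - ρ₁))
    {x : Sp d} (hx : x ∈ Ω) :
    ∃ t ∈ Ioo (0 : ℝ) 1, D ρ₂ x - D ρ₁ x = L (ρ₁ + t • (ρ₂ - ρ₁)) (ρ₂ - ρ₁) x := by
  have h1 : ρ₁ ∈ A := by simpa using hseg 0 (by simp)
  have h2 : ρ₂ ∈ A := by simpa using hseg 1 (by simp)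
  obtain ⟨t, ht', h⟩ := exists_eq_of_segment_derivatives
    (f := fun t => D (ρ₁ + t • (ρ₂ - ρ₁)) x)
    (g := fun t => L (ρ₁ + t • (ρ₂ - ρ₁)) (ρ₂ - ρ₁) x) (fun t htt => by
      have e : ρ₂ - (ρ₁ + t • (ρ₂ - ρ₁)) = (1 - t) • (ρ₂ - ρ₁) := by
        rw [sub_smul, one_smul]; abel
      have hm := hseg t ⟨htt.1, htt.2.le⟩
      have := hV.second _ hm ρ₂ h2 (by rw [e]; exact ht.1.smul _) x hx
      rw [e] at this
      refine (this.congr_deriv (hV.second_smul _ hm _ _ ht x hx)).congr (fun τ _ => ?_) ?_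
      · simp only [smul_smul, add_smul, add_assoc]
      · simp) (fun t htt => by
      have e : ρ₁ - (ρ₁ + t • (ρ₂ - ρ₁)) = (-t) • (ρ₂ - ρ₁) := by
        rw [neg_smul]; abel
      have hm := hseg t ⟨htt.1.le, htt.2⟩
      have := hV.second _ hm ρ₁ h1 (by rw [e]; exact ht.1.smul _) x hx
      rw [e] at this
      refine (this.congr_deriv (hV.second_smul _ hm _ _ ht x hx)).congr (fun τ _ => ?_) ?_
      · simp only [show ρ₁ + (t - τ * t) • (ρ₂ - ρ₁) =
          ρ₁ + t • (ρ₂ - ρ₁) + τ • (-t) • (ρ₂ - ρ₁) by module]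
      · simp)
  exact ⟨t, ht', by simpa using h⟩

end TestFunctions

end WassersteinNewton

namespace WassersteinNewton

/-! ### Differentiating an energy twice along a smooth curve of densities. -/

section Curves

variable {d : ℕ} {Ω K : Set (Sp d)} {A : Set (Sp d → ℝ)} {E : (Sp d → ℝ) → ℝ}
  {D : (Sp d → ℝ) → Sp d → ℝ} {L : (Sp d → ℝ) → (Sp d → ℝ) → Sp d → ℝ}

/-- A smooth curve of densities, parametrised by `I`, that is constant off the compact set `K`. -/
structure DensityCurve (Ω K : Set (Sp d)) (I : Set ℝ) (r : ℝ → Sp d → ℝ) : Prop where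
  isOpen : IsOpen I
  zero_mem : (0 : ℝ) ∈ I
  density : ∀ s ∈ I, Density Ω (r s)
  smooth : ContDiffOn ℝ ∞ (fun p : ℝ × Sp d => r p.1 p.2) (I ×ˢ Ω)
  compact : IsCompact K
  subset : K ⊆ Ω
  off : ∀ s ∈ I, ∀ x, x ∉ K → r s x = r 0 x

/-- The integral of a non-integrable function is 0 by convention, which the mass 1 excludes. -/
theorem Density.integrableOn {ρ : Sp d → ℝ} (h : Density Ω ρ) : IntegrableOn ρ Ω := by
  by_contra hn
  have := h.mass
  rw [integral_undef hn] at this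
  exact zero_ne_one this

theorem Density.segment {ρ₁ ρ₂ : Sp d → ℝ} (h₁ : Density Ω ρ₁) (h₂ : Density Ω ρ₂) {t : ℝ}
    (ht : t ∈ Icc (0 : ℝ) 1) : Density Ω (ρ₁ + t • (ρ₂ - ρ₁)) where
  smooth := h₁.smooth.add (contDiffOn_const.smul (h₂.smooth.sub h₁.smooth))
  nonneg x := by
    have e : (ρ₁ + t • (ρ₂ - ρ₁)) x = (1 - t) * ρ₁ x + t * ρ₂ x := by simp; ring
    rw [e]
    have := h₁.nonneg x
    have := h₂.nonneg x
    have := sub_nonneg.2 ht.2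
    have := ht.1
    positivity
  zero_off x hx := by simp [h₁.zero_off x hx, h₂.zero_off x hx]
  mass := by
    have i1 := h₁.integrableOn
    have i2 := h₂.integrableOn
    simp only [Pi.add_apply, Pi.smul_apply, Pi.sub_apply, smul_eq_mul]
    have i3 : IntegrableOn (fun x => t * (ρ₂ x - ρ₁ x)) Ω := (i2.sub i1).const_mul t
    rw [integral_add i1 i3, integral_const_mul, integral_sub i2 i1, h₁.mass, h₂.mass]
    simp

namespace DensityCurve

variable {I : Set ℝ} {r : ℝ → Sp d → ℝ}

/-- Extended by zero, r s itself need not be smooth across the boundary of Ω. The difference from r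
0 vanishes off K and is smooth on the whole space. -/
theorem smooth_diff (h : DensityCurve Ω K I r) (hΩ : IsOpen Ω) :
    ContDiffOn ℝ ∞ (fun p : ℝ × Sp d => r p.1 p.2 - r 0 p.2) (I ×ˢ univ) := by
  rintro ⟨s, x⟩ ⟨hs, -⟩
  refine ContDiffAt.contDiffWithinAt ?_
  by_cases hx : x ∈ K
  · have hxΩ := h.subset hx
    have h1 := h.smooth.contDiffAt ((h.isOpen.prod hΩ).mem_nhds ⟨hs, hxΩ⟩)
    have h2 : ContDiffAt ℝ ∞ (fun p : ℝ × Sp d => r 0 p.2) (s, x) :=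
      ((h.density 0 h.zero_mem).smooth.contDiffAt (hΩ.mem_nhds hxΩ)).comp (s, x) contDiffAt_snd
    exact h1.sub h2
  · refine (contDiffAt_const (c := (0 : ℝ))).congr_of_eventuallyEq ?_
    filter_upwards [(h.isOpen.prod h.compact.isClosed.isOpen_compl).mem_nhds
      (show (s, x) ∈ I ×ˢ Kᶜ from ⟨hs, hx⟩)] with p hp
    simp [h.off p.1 hp.1 p.2 hp.2]

theorem smooth_vel (h : DensityCurve Ω K I r) (hΩ : IsOpen Ω) :
    ContDiffOn ℝ ∞ (fun p : ℝ × Sp d => deriv (fun s => r s p.2) p.1) (I ×ˢ univ) := by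
  refine (contDiffOn_time (u := fun s x => r s x - r 0 x) (h.isOpen.prod isOpen_univ)
    (h.smooth_diff hΩ)).congr fun p _ => ?_
  simp [deriv_sub_const_fun]

theorem vel_off (h : DensityCurve Ω K I r) {s : ℝ} (hs : s ∈ I) {x : Sp d} (hx : x ∉ K) :
    deriv (fun s => r s x) s = 0 := by
  have : (fun s => r s x) =ᶠ[𝓝 s] fun _ => r 0 x := by
    filter_upwards [h.isOpen.mem_nhds hs] with t ht using h.off t ht x hx
  rw [this.deriv_eq]; simp

theorem contDiff_vel (h : DensityCurve Ω K I r) (hΩ : IsOpen Ω) {s : ℝ} (hs : s ∈ I) :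
    ContDiff ℝ ∞ (fun x => deriv (fun s => r s x) s) :=
  contDiffOn_univ.1 ((h.smooth_vel hΩ).comp (contDiff_prodMk_right s).contDiffOn
    fun _ hy => ⟨hs, hy⟩)

theorem isTest_sub (h : DensityCurve Ω K I r) (hΩ : IsOpen Ω) {s t : ℝ} (hs : s ∈ I)
    (ht : t ∈ I) : IsTest Ω (r s - r t) :=
  isTest_of_zero_off hΩ ((h.density s hs).smooth.sub (h.density t ht).smooth) h.compact h.subset
    fun y hy => by simp [h.off s hs y hy, h.off t ht y hy]

theorem isTangentTest_sub (h : DensityCurve Ω K I r) (hΩ : IsOpen Ω) {s t : ℝ} (hs : s ∈ I)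
    (ht : t ∈ I) : IsTangentTest Ω (r s - r t) := by
  refine ⟨h.isTest_sub hΩ hs ht, ?_⟩
  simp only [Pi.sub_apply]
  rw [integral_sub (h.density s hs).integrableOn (h.density t ht).integrableOn,
    (h.density s hs).mass, (h.density t ht).mass, sub_self]

theorem testTendsto (h : DensityCurve Ω K I r) (hΩ : IsOpen Ω) {s₀ : ℝ} (hs₀ : s₀ ∈ I)
    {s : ℕ → ℝ} (hs : ∀ n, s n ∈ I) (hs' : Tendsto s atTop (𝓝[≠] s₀)) :
    TestTendsto Ω (fun n => (s n - s₀)⁻¹ • (r (s n) - r s₀))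
      (fun x => deriv (fun s' => r s' x) s₀) := by
  have := testTendsto_quotient (G := fun s x => r s x - r 0 x) h.isOpen (h.smooth_diff hΩ) h.compact h.subset
    (fun t ht y hy => by simp [h.off t ht y hy]) hs₀ hs hs'
  convert! this using 1
  · funext n; congr 1; ext x; simp
  · funext x; simp [deriv_sub_const_fun]

/-- The offset is tₙ(sₙ - s₀) times a difference quotient: null scalars times a convergent sequence.
This brings the intermediate densities of the mean value theorem back to r s₀. -/
theorem testTendsto_segment (h : DensityCurve Ω K I r) (hΩ : IsOpen Ω) {s₀ : ℝ} (hs₀ : s₀ ∈ I)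
    {s : ℕ → ℝ} (hs : ∀ n, s n ∈ I) (hs' : Tendsto s atTop (𝓝[≠] s₀)) {t : ℕ → ℝ}
    (ht : ∀ n, t n ∈ Icc (0 : ℝ) 1) :
    TestTendsto Ω (fun n => (r s₀ + t n • (r (s n) - r s₀)) - r s₀) 0 := by
  have hT := h.testTendsto hΩ hs₀ hs hs'
  have hs0 : Tendsto (fun n => s n - s₀) atTop (𝓝 0) := by
    have := (hs'.mono_right nhdsWithin_le_nhds).sub_const s₀
    simpa using this
  have hc : Tendsto (fun n => t n * (s n - s₀)) atTop (𝓝 0) := by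
    refine squeeze_zero_norm (fun n => ?_) (by simpa using hs0.norm)
    rw [norm_mul]
    refine mul_le_of_le_one_left (norm_nonneg _) ?_
    rw [Real.norm_of_nonneg (ht n).1]; exact (ht n).2
  have := hT.smul_zero hc
  convert this using 1
  funext n
  by_cases hz : s n - s₀ = 0
  · rw [sub_eq_zero] at hz
    simp [hz]
  · rw [smul_smul, mul_assoc, mul_inv_cancel₀ hz]; simp

/-- Mass is conserved, so every difference quotient has mean zero, and this survives the uniform
limit on K. -/
theorem isTangentTest_vel (h : DensityCurve Ω K I r) (hΩ : IsOpen Ω) {s : ℝ} (hs : s ∈ I) :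
    IsTangentTest Ω (fun x => deriv (fun s => r s x) s) := by
  refine ⟨isTest_of_zero_off hΩ (h.contDiff_vel hΩ hs).contDiffOn h.compact h.subset
    fun y hy => h.vel_off hs hy, ?_⟩
  have h1 : ∀ᶠ t in 𝓝[≠] s, t ∈ I := mem_nhdsWithin_of_mem_nhds (h.isOpen.mem_nhds hs)
  obtain ⟨u, hu⟩ := exists_seq_tendsto (𝓝[≠] s)
  obtain ⟨N, hN⟩ := eventually_atTop.1 (hu.eventually h1)
  have hu' := hu.comp (tendsto_add_atTop_nat N)
  have hT := h.testTendsto hΩ hs (fun n => hN (n + N) (Nat.le_add_left _ _)) hu'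
  have := tendsto_integral_mul hΩ h.compact h.subset (f := fun _ _ => (1 : ℝ)) (f₀ := fun _ => 1)
    (fun _ => continuousOn_const) continuousOn_const
    (fun n => (hT.1 n).continuous.continuousOn) hT.2.1.continuous.continuousOn
    (Metric.tendstoUniformlyOn_iff.2 fun δ hδ => by simp [hδ]) (hT.tendstoUniformlyOn K) (fun n y _ hy => by
      simp only [Pi.smul_apply, Pi.sub_apply]
      rw [h.off _ (hN (n + N) (Nat.le_add_left _ _)) y hy, h.off s hs y hy, sub_self, smul_zero])
    (fun y _ hy => h.vel_off hs hy)
  refine tendsto_nhds_unique (by simpa using this) ?_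
  refine tendsto_const_nhds.congr fun n => ?_
  have := (h.isTangentTest_sub hΩ (hN (n + N) (Nat.le_add_left _ _)) hs).2
  change 0 = ∫ y in Ω, (u (n + N) - s)⁻¹ * (r (u (n + N)) - r s) y
  rw [integral_const_mul, this, mul_zero]

/-- On the compact set K positivity is stable for small s; off K the density does not move. The form
is the positivity proviso in `EnergyDomain.stable`. -/
theorem eventually_pos (h : DensityCurve Ω K I r) (hΩ : IsOpen Ω) :
    ∀ᶠ s in 𝓝 (0 : ℝ), (∀ x ∈ Ω, 0 < r 0 x) → ∀ x ∈ Ω, 0 < r s x := by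
  by_cases hp : ∀ x ∈ Ω, 0 < r 0 x
  · have h1 : ∀ᶠ s in 𝓝 (0 : ℝ), ∀ x ∈ K, 0 < r s x := by
      refine h.compact.eventually_forall_of_forall_eventually (P := fun s x => 0 < r s x)
        fun x hx => ?_
      have := h.smooth.continuousOn.continuousAt
        ((h.isOpen.prod hΩ).mem_nhds (show ((0 : ℝ), x) ∈ I ×ˢ Ω from ⟨h.zero_mem, h.subset hx⟩))
      exact this.tendsto.eventually_const_lt (hp x (h.subset hx))
    filter_upwards [h1, h.isOpen.mem_nhds h.zero_mem] with s hs hsI _ x hx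
    by_cases hxK : x ∈ K
    · exact hs x hxK
    · rw [h.off s hsI x hxK]; exact hp x hx
  · exact Eventually.of_forall fun s h' => absurd h' hp

theorem segment_mem (h : DensityCurve Ω K I r) (hΩ : IsOpen Ω) (hA : EnergyDomain Ω A)
    (h0 : r 0 ∈ A) {s s' : ℝ} (hs : s ∈ I) (hs' : s' ∈ I)
    (hp : (∀ x ∈ Ω, 0 < r 0 x) → ∀ x ∈ Ω, 0 < r s x)
    (hp' : (∀ x ∈ Ω, 0 < r 0 x) → ∀ x ∈ Ω, 0 < r s' x) {t : ℝ} (ht : t ∈ Icc (0 : ℝ) 1) :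
    r s + t • (r s' - r s) ∈ A := by
  refine hA.stable _ h0 _ ((h.density s hs).segment (h.density s' hs') ht) ?_ fun hpos x hx => ?_
  · have : r s + t • (r s' - r s) - r 0 = (r s - r 0) + t • (r s' - r s) := by abel
    rw [this]
    exact (h.isTest_sub hΩ hs h.zero_mem).add ((h.isTest_sub hΩ hs' hs).smul t)
  · have e : (r s + t • (r s' - r s)) x = (1 - t) * r s x + t * r s' x := by simp; ring
    rw [e]
    have a := hp hpos x hx
    have b := hp' hpos x hx
    rcases eq_or_lt_of_le ht.1 with h | h
    · subst h; simpa using a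
    · have := sub_nonneg.2 ht.2
      positivity

/-- Each secant of the energy is, by the mean value along a straight segment, the integral of D at
an intermediate density times a difference quotient of the curve. Both factors converge uniformly on
K. -/
theorem hasDerivAt_energy (h : DensityCurve Ω K I r) (hΩ : IsOpen Ω)
    (hV : HasVariations Ω A E D L)
    (hseg : ∀ s ∈ I, ∀ s' ∈ I, ∀ t ∈ Icc (0 : ℝ) 1, r s + t • (r s' - r s) ∈ A)
    {s₀ : ℝ} (hs₀ : s₀ ∈ I) :
    HasDerivAt (fun s => E (r s))
      (∫ x in Ω, D (r s₀) x * deriv (fun s' => r s' x) s₀) s₀ := by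
  have hmem : ∀ s ∈ I, r s ∈ A := fun s hs => by
    simpa using hseg s hs s hs 0 (by simp)
  rw [hasDerivAt_iff_tendsto_slope]
  refine tendsto_of_seq_tendsto fun u hu => ?_
  obtain ⟨N, hN⟩ := eventually_atTop.1 (hu.eventually
    (mem_nhdsWithin_of_mem_nhds (h.isOpen.mem_nhds hs₀)))
  rw [← tendsto_add_atTop_iff_nat N]
  -- Dropping finitely many terms puts the whole sequence in I, as the lemmas require for every n.
  set s : ℕ → ℝ := fun n => u (n + N) with hsdef
  have hs : ∀ n, s n ∈ I := fun n => hN (n + N) (Nat.le_add_left _ _)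
  have hs' : Tendsto s atTop (𝓝[≠] s₀) := hu.comp (tendsto_add_atTop_nat N)
  have hT := h.testTendsto hΩ hs₀ hs hs'
  have hne : ∀ᶠ n in atTop, s n ≠ s₀ := hs'.eventually self_mem_nhdsWithin
  choose t ht hE using fun n => hV.exists_energy_sub_eq (hseg s₀ hs₀ (s n) (hs n))
    (h.isTest_sub hΩ (hs n) hs₀)
  set q : ℕ → Sp d → ℝ := fun n => (s n - s₀)⁻¹ • (r (s n) - r s₀) with hq
  have hTρ := h.testTendsto_segment hΩ hs₀ hs hs' fun n => Ioo_subset_Icc_self (ht n)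
  have hmemρ : ∀ n, r s₀ + t n • (r (s n) - r s₀) ∈ A := fun n =>
    hseg s₀ hs₀ (s n) (hs n) (t n) (Ioo_subset_Icc_self (ht n))
  have hD := hV.first_continuous _ (hmem s₀ hs₀) _ hmemρ hTρ
  have hDu := (tendstoLocallyUniformlyOn_iff_forall_isCompact hΩ).1 hD K h.subset h.compact
  have hlim := tendsto_integral_mul hΩ h.compact h.subset
    (fun n => (hV.first_regular _ (hmemρ n)).continuousOn.mono h.subset)
    ((hV.first_regular _ (hmem s₀ hs₀)).continuousOn.mono h.subset)
    (fun n => (hT.1 n).continuous.continuousOn) hT.2.1.continuous.continuousOn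
    hDu (hT.tendstoUniformlyOn K) (fun n y _ hy => by
      simp only [hq, Pi.smul_apply, Pi.sub_apply]
      rw [h.off _ (hs n) y hy, h.off s₀ hs₀ y hy, sub_self, smul_zero])
    (fun y _ hy => h.vel_off hs₀ hy)
  refine hlim.congr fun n => ?_
  change _ = (s n - s₀)⁻¹ • (E (r (s n)) - E (r s₀))
  rw [hE n, smul_eq_mul, ← integral_const_mul]
  refine integral_congr_ae (Eventually.of_forall fun x => ?_)
  simp only [hq, Pi.smul_apply, Pi.sub_apply, smul_eq_mul]
  ring

theorem tendstoUniformlyOn_vel (h : DensityCurve Ω K I r) (hΩ : IsOpen Ω) {s : ℕ → ℝ}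
    (hs : ∀ n, s n ∈ I) (hs' : Tendsto s atTop (𝓝[≠] 0)) :
    TendstoUniformlyOn (fun n x => deriv (fun s' => r s' x) (s n))
      (fun x => deriv (fun s' => r s' x) 0) atTop K := by
  -- The quotients of the velocity converge; multiplying them by s n → 0 undoes the division and
  -- leaves the increments.
  have hT := (testTendsto_quotient (G := fun s x => deriv (fun s' => r s' x) s) h.isOpen
    (h.smooth_vel hΩ) h.compact h.subset (fun s hs y hy => h.vel_off hs hy) h.zero_mem hs
    hs').smul_zero (c := s) (hs'.mono_right nhdsWithin_le_nhds)
  have hne : ∀ᶠ n in atTop, s n ≠ 0 := hs'.eventually self_mem_nhdsWithin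
  have := hT.tendstoUniformlyOn K
  rw [Metric.tendstoUniformlyOn_iff] at this ⊢
  intro δ hδ
  filter_upwards [this δ hδ, hne] with n hn hn0 x hx
  have := hn x hx
  simp only [sub_zero, Pi.smul_apply, Pi.sub_apply, smul_eq_mul, Pi.zero_apply,
    mul_inv_cancel_left₀ hn0] at this
  rw [dist_comm, dist_eq_norm]
  rwa [dist_zero_left] at this

/-- The mean value for D is pointwise, with an intermediate density depending on the point. For
uniformity it is applied only at a point xₙ of K where the deviation from the limit is largest. This
yields one sequence of densities, for which the continuity of L controls the deviation at xₙ, hence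
everywhere on K. -/
theorem tendstoUniformlyOn_first_quotient (h : DensityCurve Ω K I r) (hΩ : IsOpen Ω)
    (hV : HasVariations Ω A E D L)
    (hseg : ∀ s ∈ I, ∀ s' ∈ I, ∀ t ∈ Icc (0 : ℝ) 1, r s + t • (r s' - r s) ∈ A)
    {s : ℕ → ℝ} (hs : ∀ n, s n ∈ I) (hs' : Tendsto s atTop (𝓝[≠] 0)) :
    TendstoUniformlyOn (fun n x => (s n)⁻¹ * (D (r (s n)) x - D (r 0) x))
      (L (r 0) (fun x => deriv (fun s' => r s' x) 0)) atTop K := by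
  rcases K.eq_empty_or_nonempty with hK | hK
  · rw [hK]; exact tendstoUniformlyOn_empty
  have hmem : ∀ s ∈ I, r s ∈ A := fun s hs => by
    simpa using hseg s hs s hs 0 (by simp)
  have hσ := h.isTangentTest_vel hΩ h.zero_mem
  set σ : Sp d → ℝ := fun x => deriv (fun s' => r s' x) 0 with hσdef
  have hDc : ∀ t ∈ I, ContinuousOn (D (r t)) K := fun t ht =>
    (hV.first_regular _ (hmem t ht)).continuousOn.mono h.subset
  have hLc : ContinuousOn (L (r 0) σ) K :=
    (hV.second_regular _ (hmem 0 h.zero_mem) σ hσ).continuousOn.mono h.subset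
  -- The worst point of K for the n-th quotient; it exists by continuity and because K is nonempty
  -- here.
  choose x hx hmax using fun n => h.compact.exists_isMaxOn hK (f := fun x =>
    ‖(s n)⁻¹ * (D (r (s n)) x - D (r 0) x) - L (r 0) σ x‖)
    (((continuousOn_const.mul ((hDc _ (hs n)).sub (hDc 0 h.zero_mem))).sub hLc).norm)
  choose t ht hL using fun n => hV.exists_first_sub_eq (hseg 0 h.zero_mem (s n) (hs n))
    (h.isTangentTest_sub hΩ (hs n) h.zero_mem) (h.subset (hx n))
  have hmemρ : ∀ n, r 0 + t n • (r (s n) - r 0) ∈ A := fun n =>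
    hseg 0 h.zero_mem (s n) (hs n) (t n) (Ioo_subset_Icc_self (ht n))
  have hTρ := h.testTendsto_segment hΩ h.zero_mem hs hs' fun n => Ioo_subset_Icc_self (ht n)
  have hT := h.testTendsto hΩ h.zero_mem hs hs'
  have hq : ∀ n, IsTangentTest Ω ((s n - 0)⁻¹ • (r (s n) - r 0)) := by
    intro n
    refine ⟨hT.1 n, ?_⟩
    have := (h.isTangentTest_sub hΩ (hs n) h.zero_mem).2
    change ∫ y in Ω, (s n - 0)⁻¹ * (r (s n) - r 0) y = 0
    rw [integral_const_mul, this, mul_zero]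
  have hlim := (tendstoLocallyUniformlyOn_iff_forall_isCompact hΩ).1
    (hV.second_continuous _ (hmem 0 h.zero_mem) _ hmemρ hTρ σ _ hσ hq hT) K h.subset h.compact
  rw [Metric.tendstoUniformlyOn_iff] at hlim ⊢
  intro δ hδ
  filter_upwards [hlim δ hδ] with n hn y hy
  have h1 := hn (x n) (hx n)
  rw [hV.second_smul _ (hmemρ n) _ _ (h.isTangentTest_sub hΩ (hs n) h.zero_mem) _
    (h.subset (hx n)), ← hL n, sub_zero] at h1
  rw [dist_comm, dist_eq_norm] at h1 ⊢
  exact (hmax n hy).trans_lt h1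

/-- Write D(r s) as D(r s) - D(r 0) plus the frozen D(r 0). The first part contributes zero at s =
0, so only the quotient of D matters and no second time derivative of r enters. The frozen part is
left to `hc`, since its derivative uses the geodesic equations. -/
theorem hasDerivAt_energy_deriv (h : DensityCurve Ω K I r) (hΩ : IsOpen Ω)
    (hV : HasVariations Ω A E D L)
    (hseg : ∀ s ∈ I, ∀ s' ∈ I, ∀ t ∈ Icc (0 : ℝ) 1, r s + t • (r s' - r s) ∈ A) {c : ℝ}
    (hc : HasDerivAt (fun s => ∫ x in Ω, D (r 0) x * deriv (fun s' => r s' x) s) c 0) :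
    HasDerivAt (fun s => ∫ x in Ω, D (r s) x * deriv (fun s' => r s' x) s)
      ((∫ x in Ω, L (r 0) (fun x => deriv (fun s' => r s' x) 0) x * deriv (fun s' => r s' x) 0)
        + c) 0 := by
  have hmem : ∀ s ∈ I, r s ∈ A := fun s hs => by
    simpa using hseg s hs s hs 0 (by simp)
  have hDc : ∀ t ∈ I, ContinuousOn (D (r t)) Ω := fun t ht =>
    (hV.first_regular _ (hmem t ht)).continuousOn
  have hint : ∀ t ∈ I, ∀ s ∈ I, IntegrableOn (fun x => D (r t) x * deriv (fun s' => r s' x) s) Ω :=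
    fun t ht s hs => integrableOn_of_zero_off hΩ
      ((hDc t ht).mul (h.contDiff_vel hΩ hs).continuous.continuousOn) h.compact h.subset
      fun y _ hy => by rw [h.vel_off hs hy, mul_zero]
  have h1 : HasDerivAt (fun s => ∫ x in Ω, (D (r s) x - D (r 0) x) * deriv (fun s' => r s' x) s)
      (∫ x in Ω, L (r 0) (fun x => deriv (fun s' => r s' x) 0) x *
        deriv (fun s' => r s' x) 0) 0 := by
    rw [hasDerivAt_iff_tendsto_slope]
    refine tendsto_of_seq_tendsto fun u hu => ?_
    obtain ⟨N, hN⟩ := eventually_atTop.1 (hu.eventually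
      (mem_nhdsWithin_of_mem_nhds (h.isOpen.mem_nhds h.zero_mem)))
    rw [← tendsto_add_atTop_iff_nat N]
    set s : ℕ → ℝ := fun n => u (n + N) with hsdef
    have hs : ∀ n, s n ∈ I := fun n => hN (n + N) (Nat.le_add_left _ _)
    have hs' : Tendsto s atTop (𝓝[≠] 0) := hu.comp (tendsto_add_atTop_nat N)
    have hlim := tendsto_integral_mul hΩ h.compact h.subset
      (fun n => continuousOn_const.mul (((hDc _ (hs n)).sub (hDc 0 h.zero_mem)).mono h.subset))
      ((hV.second_regular _ (hmem 0 h.zero_mem) _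
        (h.isTangentTest_vel hΩ h.zero_mem)).continuousOn.mono h.subset)
      (fun n => (h.contDiff_vel hΩ (hs n)).continuous.continuousOn)
      (h.contDiff_vel hΩ h.zero_mem).continuous.continuousOn
      (h.tendstoUniformlyOn_first_quotient hΩ hV hseg hs hs')
      (h.tendstoUniformlyOn_vel hΩ hs hs') (fun n y _ hy => h.vel_off (hs n) hy)
      (fun y _ hy => h.vel_off h.zero_mem hy)
    refine hlim.congr fun n => ?_
    change _ = (s n - 0)⁻¹ •
      ((∫ x in Ω, (D (r (s n)) x - D (r 0) x) * deriv (fun s' => r s' x) (s n)) -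
        ∫ x in Ω, (D (r 0) x - D (r 0) x) * deriv (fun s' => r s' x) 0)
    simp only [sub_self, zero_mul, integral_zero, sub_zero, smul_eq_mul]
    rw [← integral_const_mul]
    refine integral_congr_ae (Eventually.of_forall fun x => ?_)
    simp only [hsdef, Pi.mul_apply, Pi.sub_apply]
    ring
  refine (h1.add hc).congr_of_eventuallyEq ?_
  filter_upwards [h.isOpen.mem_nhds h.zero_mem] with s hs
  simp only [Pi.add_apply]
  have e : ∫ x in Ω, (D (r s) x - D (r 0) x) * deriv (fun s' => r s' x) s =
      (∫ x in Ω, D (r s) x * deriv (fun s' => r s' x) s) -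
        ∫ x in Ω, D (r 0) x * deriv (fun s' => r s' x) s := by
    rw [← integral_sub (hint s hs s hs) (hint 0 h.zero_mem s hs)]
    simp only [sub_mul]
  rw [e, sub_add_cancel]

end DensityCurve

end Curves

end WassersteinNewton

namespace WassersteinNewton

/-! ### The second derivative of the energy along a geodesic. -/

section GeodesicValue

variable {d : ℕ} {Ω K : Set (Sp d)} {A : Set (Sp d → ℝ)} {E : (Sp d → ℝ) → ℝ}
  {D : (Sp d → ℝ) → Sp d → ℝ} {L : (Sp d → ℝ) → (Sp d → ℝ) → Sp d → ℝ} {ρ Φ Ψ : Sp d → ℝ}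

theorem isTangentTest_wDiv (hΩ : IsOpen Ω) (hρ : ContDiffOn ℝ ∞ ρ Ω) (hΦ : IsTest Ω Φ) :
    IsTangentTest Ω (wDiv ρ Φ) := by
  refine ⟨isTest_of_zero_off hΩ (wDiv_contDiffOn hΩ hρ hΦ.smooth.contDiffOn (by simp) (by simp))
    hΦ.isCompact hΦ.support fun y hy => wDiv_zero_off hΦ.isCompact.isClosed hΦ.zero_off hy, ?_⟩
  refine integral_div_eq_zero hΩ (fun i => ?_) hΦ.isCompact hΦ.support fun y hy => ?_
  · exact (hρ.of_le (by simp)).mul (pd_contDiffOn hΩ (n := ∞) hΦ.smooth.contDiffOn (by decide) i)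
  · simp [grad_eq_zero_off hΦ.isCompact.isClosed hΦ.zero_off hy]

theorem contDiffOn_pd_space {I : Set ℝ} {u : ℝ → Sp d → ℝ} (hI : IsOpen I) (hΩ : IsOpen Ω)
    (h : ContDiffOn ℝ ∞ (fun p : ℝ × Sp d => u p.1 p.2) (I ×ˢ Ω)) (i : Fin d) :
    ContDiffOn ℝ ∞ (fun p : ℝ × Sp d => pd i (u p.1) p.2) (I ×ˢ Ω) :=
  (contDiffOn_space (hI.prod hΩ) h).clm_apply contDiffOn_const

theorem hasDerivAt_pd_time {I : Set ℝ} {u : ℝ → Sp d → ℝ} (hI : IsOpen I) (hΩ : IsOpen Ω)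
    (h : ContDiffOn ℝ ∞ (fun p : ℝ × Sp d => u p.1 p.2) (I ×ˢ Ω)) {s : ℝ} (hs : s ∈ I) {x : Sp d}
    (hx : x ∈ Ω) (i : Fin d) :
    HasDerivAt (fun s' => pd i (u s') x) (pd i (fun y => deriv (fun s' => u s' y) s) x) s := by
  have hn := (hI.prod hΩ).mem_nhds (show (s, x) ∈ I ×ˢ Ω from ⟨hs, hx⟩)
  have h1 := hasDerivAt_time (u := fun s x => fderiv ℝ (u s) x)
    (((contDiffOn_space (hI.prod hΩ) h).contDiffAt hn).differentiableAt (by simp))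
  have h2 := h1.differentiableAt.hasDerivAt
  rw [deriv_fderiv_comm ((h.contDiffAt hn).of_le (by decide))] at h2
  simpa [pd] using h2.clm_apply (hasDerivAt_const s (EuclideanSpace.single i (1 : ℝ)))

/-- The factor f only has to be continuous: the derivative falls on G, whose quotients converge
uniformly with support in K. -/
theorem hasDerivAt_integral_mul {I : Set ℝ} {G : ℝ → Sp d → ℝ} {f : Sp d → ℝ} (hI : IsOpen I)
    (hΩ : IsOpen Ω) (hf : ContinuousOn f Ω)
    (hG : ContDiffOn ℝ ∞ (fun p : ℝ × Sp d => G p.1 p.2) (I ×ˢ Ω)) (hK : IsCompact K)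
    (hKΩ : K ⊆ Ω) (h0 : ∀ s ∈ I, ∀ y, y ∉ K → G s y = 0) {s₀ : ℝ} (hs₀ : s₀ ∈ I) :
    HasDerivAt (fun s => ∫ x in Ω, f x * G s x)
      (∫ x in Ω, f x * deriv (fun s => G s x) s₀) s₀ := by
  have hG' : ContDiffOn ℝ ∞ (fun p : ℝ × Sp d => G p.1 p.2) (I ×ˢ univ) := by
    rintro ⟨s, x⟩ ⟨hs, -⟩
    refine ContDiffAt.contDiffWithinAt ?_
    by_cases hx : x ∈ K
    · exact hG.contDiffAt ((hI.prod hΩ).mem_nhds ⟨hs, hKΩ hx⟩)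
    · refine (contDiffAt_const (c := (0 : ℝ))).congr_of_eventuallyEq ?_
      filter_upwards [(hI.prod hK.isClosed.isOpen_compl).mem_nhds
        (show (s, x) ∈ I ×ˢ Kᶜ from ⟨hs, hx⟩)] with p hp using h0 p.1 hp.1 p.2 hp.2
  have hint : ∀ s ∈ I, IntegrableOn (fun x => f x * G s x) Ω := fun s hs =>
    integrableOn_of_zero_off hΩ (hf.mul ((hG.comp (contDiff_prodMk_right s).contDiffOn
      fun y hy => ⟨hs, hy⟩).continuousOn)) hK hKΩ fun y _ hy => by rw [h0 s hs y hy, mul_zero]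
  rw [hasDerivAt_iff_tendsto_slope]
  refine tendsto_of_seq_tendsto fun u hu => ?_
  obtain ⟨N, hN⟩ := eventually_atTop.1 (hu.eventually
    (mem_nhdsWithin_of_mem_nhds (hI.mem_nhds hs₀)))
  rw [← tendsto_add_atTop_iff_nat N]
  set s : ℕ → ℝ := fun n => u (n + N) with hsdef
  have hs : ∀ n, s n ∈ I := fun n => hN (n + N) (Nat.le_add_left _ _)
  have hs' : Tendsto s atTop (𝓝[≠] s₀) := hu.comp (tendsto_add_atTop_nat N)
  have hT := testTendsto_quotient hI hG' hK hKΩ h0 hs₀ hs hs'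
  have hlim := tendsto_integral_mul hΩ hK hKΩ (f := fun _ => f) (f₀ := f)
    (fun _ => hf.mono hKΩ) (hf.mono hKΩ)
    (fun n => (hT.1 n).continuous.continuousOn) hT.2.1.continuous.continuousOn
    (Metric.tendstoUniformlyOn_iff.2 fun δ hδ => by simp [hδ]) (hT.tendstoUniformlyOn K)
    (fun n y _ hy => by
      simp only [Pi.smul_apply, Pi.sub_apply]
      rw [h0 _ (hs n) y hy, h0 s₀ hs₀ y hy, sub_self, smul_zero])
    (fun y _ hy => by
      have : (fun s' => G s' y) =ᶠ[𝓝 s₀] fun _ => 0 := by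
        filter_upwards [hI.mem_nhds hs₀] with t ht using h0 t ht y hy
      rw [this.deriv_eq]; simp)
  refine hlim.congr fun n => ?_
  change _ = (s n - s₀)⁻¹ • ((∫ x in Ω, f x * G (s n) x) - ∫ x in Ω, f x * G s₀ x)
  rw [← integral_sub (hint _ (hs n)) (hint _ hs₀), smul_eq_mul, ← integral_const_mul]
  refine integral_congr_ae (Eventually.of_forall fun x => ?_)
  simp only [Pi.smul_apply, Pi.sub_apply, smul_eq_mul]
  ring

/-- Off the common support of the potentials the continuity equation reads ∂ₛr = 0, so the density
is constant in time there. -/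
theorem IsGeodesic.densityCurve (hΩ : IsOpen Ω) {ε : ℝ} {r φ : ℝ → Sp d → ℝ}
    (h : IsGeodesic Ω ρ Φ ε r φ) (hK : IsCompact K) (hKΩ : K ⊆ Ω)
    (hs : ∀ s ∈ Ioo (-ε) ε, ∀ x, x ∉ K → φ s x = 0) : DensityCurve Ω K (Ioo (-ε) ε) r where
  isOpen := isOpen_Ioo
  zero_mem := ⟨by linarith [h.pos], h.pos⟩
  density := h.density
  smooth := h.smooth_density
  compact := hK
  subset := hKΩ
  off s hsI x hx := by
    have h0 : (0 : ℝ) ∈ Ioo (-ε) ε := ⟨by linarith [h.pos], h.pos⟩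
    by_cases hxΩ : x ∈ Ω
    · refine isOpen_Ioo.is_const_of_deriv_eq_zero (𝕜 := ℝ) isPreconnected_Ioo
        (f := fun s' => r s' x) ?_ ?_ hsI h0
      · intro t ht
        exact (hasDerivAt_time ((h.smooth_density.contDiffAt
          ((isOpen_Ioo.prod hΩ).mem_nhds ⟨ht, hxΩ⟩)).differentiableAt
            (by simp))).differentiableAt.differentiableWithinAt
      · intro t ht
        have := h.continuity_eq t ht x hxΩ
        rw [wDiv_zero_off hK.isClosed (hs t ht) hx, add_zero] at this
        exact this
    · rw [(h.density s hsI).zero_off x hxΩ, (h.density 0 h0).zero_off x hxΩ]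

/-- After Green's identity the integral is ∫ ⟨∇f, ∇φ_s⟩ r_s. The Hamilton–Jacobi equation gives ∂ₛ∇φ
= -∇²Φ∇Φ at s = 0, and the continuity equation gives ∂ₛr = -∇·(ρ∇Φ). Integrating the latter term by
parts produces ∇²f and a ∇²Φ term that cancels the former. Only two derivatives of f are used. -/
theorem IsGeodesic.hasDerivAt_integral_first (hΩ : IsOpen Ω) {ε : ℝ} {r φ : ℝ → Sp d → ℝ}
    (h : IsGeodesic Ω ρ Φ ε r φ) (hΦ : IsTest Ω Φ) {f : Sp d → ℝ} (hf : ContDiffOn ℝ 2 f Ω) :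
    HasDerivAt (fun s => ∫ x in Ω, f x * deriv (fun s' => r s' x) s)
      (∫ x in Ω, (grad Φ x ⬝ᵥ (hess f x *ᵥ grad Φ x)) * ρ x) 0 := by
  obtain ⟨K, hK, hKΩ, hs⟩ := h.support
  have h0 : (0 : ℝ) ∈ Ioo (-ε) ε := ⟨by linarith [h.pos], h.pos⟩
  have hΦ0 : ∀ y, y ∉ K → Φ y = 0 := fun y hy => by
    rw [← h.init_potential]; exact hs 0 h0 y hy
  have hρ : ContDiffOn ℝ ∞ ρ Ω := by rw [← h.init_density]; exact (h.density 0 h0).smooth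
  have hΦs : ContDiffOn ℝ ∞ Φ Ω := hΦ.smooth.contDiffOn
  have hf1 : ContDiffOn ℝ 1 f Ω := hf.of_le (by decide)
  have hslice : ∀ {u : ℝ → Sp d → ℝ},
      ContDiffOn ℝ ∞ (fun p : ℝ × Sp d => u p.1 p.2) (Ioo (-ε) ε ×ˢ Ω) →
      ∀ s ∈ Ioo (-ε) ε, ContDiffOn ℝ ∞ (u s) Ω := fun hu s hs =>
    hu.comp (contDiff_prodMk_right s).contDiffOn fun y hy => ⟨hs, hy⟩
  set G : Fin d → ℝ → Sp d → ℝ := fun i s x => pd i (φ s) x * r s x with hGdef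
  have hG : ∀ i, ContDiffOn ℝ ∞ (fun p : ℝ × Sp d => G i p.1 p.2) (Ioo (-ε) ε ×ˢ Ω) := fun i =>
    (contDiffOn_pd_space isOpen_Ioo hΩ h.smooth_potential i).mul h.smooth_density
  have hG0 : ∀ i, ∀ s ∈ Ioo (-ε) ε, ∀ y, y ∉ K → G i s y = 0 := fun i s hsI y hy => by
    simp only [hGdef]; rw [pd_eq_zero_off hK.isClosed (hs s hsI) hy, zero_mul]
  have hd : ∀ i, HasDerivAt (fun s => ∫ x in Ω, pd i f x * G i s x)
      (∫ x in Ω, pd i f x * deriv (fun s => G i s x) 0) 0 := fun i =>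
    hasDerivAt_integral_mul isOpen_Ioo hΩ (pd_continuousOn hΩ hf1 i) (hG i) hK hKΩ (hG0 i) h0
  have hsum := HasDerivAt.fun_sum (u := Finset.univ) fun i _ => hd i
  refine (hsum.congr_of_eventuallyEq ?_).congr_deriv ?_
  · filter_upwards [isOpen_Ioo.mem_nhds h0] with s hsI
    have e1 : ∫ x in Ω, f x * deriv (fun s' => r s' x) s =
        -∫ x in Ω, f x * wDiv (r s) (φ s) x := by
      rw [← integral_neg]
      refine setIntegral_congr_fun hΩ.measurableSet fun x hx => ?_
      have := h.continuity_eq s hsI x hx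
      simp only [eq_neg_of_add_eq_zero_left this, mul_neg]
    rw [e1, integral_mul_wDiv hΩ hf1 ((hslice h.smooth_density s hsI).of_le (by decide))
      ((hslice h.smooth_potential s hsI).of_le (by decide)) hK hKΩ (Or.inr (hs s hsI)), neg_neg,
      ← integral_finsetSum]
    · refine integral_congr_ae (Eventually.of_forall fun x => ?_)
      simp only [dotProduct, grad, hGdef, Finset.sum_mul, mul_assoc]
    · exact fun i _ => integrableOn_of_zero_off hΩ ((pd_continuousOn hΩ hf1 i).mul
        (hslice (hG i) s hsI).continuousOn) hK hKΩ fun y _ hy => by rw [hG0 i s hsI y hy, mul_zero]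
  · have hGd : ∀ i, ∀ x ∈ Ω, deriv (fun s => G i s x) 0 =
        -(∑ j, pd j Φ x * pd i (pd j Φ) x) * ρ x - pd i Φ x * wDiv ρ Φ x := by
      intro i x hx
      have d1 := hasDerivAt_pd_time isOpen_Ioo hΩ h.smooth_potential h0 hx i
      have d2 := (hasDerivAt_time (u := r) ((h.smooth_density.contDiffAt
        ((isOpen_Ioo.prod hΩ).mem_nhds
          (show ((0 : ℝ), x) ∈ Ioo (-ε) ε ×ˢ Ω from ⟨h0, hx⟩))).differentiableAt
        (by simp))).differentiableAt.hasDerivAt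
      have d3 : deriv (fun s' => r s' x) 0 = -wDiv ρ Φ x := by
        have := h.continuity_eq 0 h0 x hx
        rw [h.init_density, h.init_potential] at this
        linarith
      -- The spatial derivative of the Hamilton–Jacobi equation at s = 0.
      have d4 : pd i (fun y => deriv (fun s' => φ s' y) 0) x =
          -∑ j, pd j Φ x * pd i (pd j Φ) x := by
        have e : ∀ y ∈ Ω, deriv (fun s' => φ s' y) 0 = -(1 / 2) * ∑ j, pd j Φ y * pd j Φ y := by
          intro y hy
          have := h.hamilton_jacobi 0 h0 y hy
          rw [h.init_potential] at this
          simp only [dotProduct, grad] at this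
          linarith
        have hdj : ∀ j, DifferentiableAt ℝ (pd j Φ) x := fun j =>
          ((pd_contDiffOn (m := 1) hΩ hΦs (by decide) j).contDiffAt
            (hΩ.mem_nhds hx)).differentiableAt (by simp)
        rw [pd_congr_on hΩ e hx, pd_const_mul,
          pd_sum _ (fun j _ => (hdj j).fun_mul (hdj j)), Finset.mul_sum, ← Finset.sum_neg_distrib]
        refine Finset.sum_congr rfl fun j _ => ?_
        rw [pd_mul (hdj j) (hdj j)]; ring
      have := (d1.fun_mul d2).deriv
      rw [d3, d4, h.init_density, h.init_potential] at this
      rw [this]; ring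
    set w := wDiv ρ Φ with hw
    have hw0 : ∀ y, y ∉ K → w y = 0 := fun y hy => wDiv_zero_off hK.isClosed hΦ0 hy
    have hwc : ContinuousOn w Ω :=
      (wDiv_contDiffOn hΩ (l := 0) hρ hΦs (by decide) (by decide)).continuousOn
    have hf' : ContDiffOn ℝ 1 (fun x => ∑ i, pd i f x * pd i Φ x) Ω :=
      ContDiffOn.sum fun i _ => (pd_contDiffOn hΩ hf (by decide) i).mul
        (pd_contDiffOn hΩ hΦs (by decide) i)
    have hibp := integral_mul_wDiv hΩ hf' (hρ.of_le (by decide)) (hΦs.of_le (by decide)) hK hKΩ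
      (Or.inr hΦ0)
    have c1 : ∀ i, ContinuousOn (pd i f) Ω := fun i => pd_continuousOn hΩ hf1 i
    have c2 : ∀ i, ContinuousOn (pd i Φ) Ω := fun i =>
      pd_continuousOn hΩ (hΦs.of_le (by decide)) i
    have c3 : ∀ i j, ContinuousOn (pd i (pd j Φ)) Ω := fun i j =>
      pd_continuousOn hΩ (pd_contDiffOn hΩ hΦs (by decide) j) i
    have z2 : ∀ i, ∀ y, y ∉ K → pd i Φ y = 0 := fun i y hy =>
      pd_eq_zero_off hK.isClosed hΦ0 hy i
    have i1 : IntegrableOn (fun x => (∑ i, pd i f x * pd i Φ x) * w x) Ω :=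
      integrableOn_of_zero_off hΩ (hf'.continuousOn.mul hwc) hK hKΩ
        fun y _ hy => by rw [hw0 y hy, mul_zero]
    have i2 : IntegrableOn (fun x => ∑ i, ∑ j, pd i f x * pd j Φ x * pd i (pd j Φ) x * ρ x) Ω :=
      integrableOn_of_zero_off hΩ (continuousOn_finsetSum _ fun i _ => continuousOn_finsetSum _
        fun j _ => (((c1 i).mul (c2 j)).mul (c3 i j)).mul hρ.continuousOn) hK hKΩ
        fun y _ hy => by simp [z2 _ y hy]
    have hgi : ∀ i, IntegrableOn (fun x => pd i f x *
        (-(∑ j, pd j Φ x * pd i (pd j Φ) x) * ρ x - pd i Φ x * w x)) Ω := fun i =>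
      integrableOn_of_zero_off hΩ ((c1 i).mul (((continuousOn_finsetSum _ fun j _ =>
        (c2 j).mul (c3 i j)).neg.mul hρ.continuousOn).sub ((c2 i).mul hwc))) hK hKΩ
        fun y _ hy => by simp [z2 _ y hy]
    have e1 : ∀ i, ∫ x in Ω, pd i f x * deriv (fun s => G i s x) 0 = ∫ x in Ω, pd i f x *
        (-(∑ j, pd j Φ x * pd i (pd j Φ) x) * ρ x - pd i Φ x * w x) := fun i =>
      setIntegral_congr_fun hΩ.measurableSet fun x hx => by simp only [hGd i x hx]
    simp only [e1]
    rw [← integral_finsetSum _ fun i _ => hgi i]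
    have e2 : ∀ x, ∑ i, pd i f x * (-(∑ j, pd j Φ x * pd i (pd j Φ) x) * ρ x - pd i Φ x * w x) =
        -(∑ i, ∑ j, pd i f x * pd j Φ x * pd i (pd j Φ) x * ρ x) -
          (∑ i, pd i f x * pd i Φ x) * w x := by
      intro x
      rw [Finset.sum_mul, ← Finset.sum_neg_distrib, ← Finset.sum_sub_distrib]
      refine Finset.sum_congr rfl fun i _ => ?_
      rw [mul_sub, neg_mul, mul_neg, Finset.sum_mul, Finset.mul_sum]
      congr 1
      · congr 1
        exact Finset.sum_congr rfl fun j _ => by ring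
      · ring
    simp only [e2]
    have i2' : IntegrableOn (fun x => -∑ i, ∑ j, pd i f x * pd j Φ x * pd i (pd j Φ) x * ρ x) Ω :=
      i2.neg
    rw [integral_sub i2' i1, integral_neg, hibp, sub_neg_eq_add, neg_add_eq_sub,
      ← integral_sub _ i2]
    · refine setIntegral_congr_fun hΩ.measurableSet fun x hx => ?_
      have hx' := hΩ.mem_nhds hx
      have d1 : ∀ i, DifferentiableAt ℝ (pd i f) x := fun i =>
        ((pd_contDiffOn (m := 1) hΩ hf (by decide) i).contDiffAt hx').differentiableAt (by simp)
      have d2 : ∀ i, DifferentiableAt ℝ (pd i Φ) x := fun i =>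
        ((pd_contDiffOn (m := 1) hΩ hΦs (by decide) i).contDiffAt hx').differentiableAt (by simp)
      -- Product rule for ⟨∇f, ∇Φ⟩; its first summand carries ∇²Φ and cancels the subtracted double
      -- sum.
      have hg : ∀ j, grad (fun x => ∑ i, pd i f x * pd i Φ x) x j =
          ∑ i, (pd i f x * pd i (pd j Φ) x + pd i Φ x * pd j (pd i f) x) := by
        intro j
        rw [grad, pd_sum _ fun i _ => (d1 i).fun_mul (d2 i)]
        refine Finset.sum_congr rfl fun i _ => ?_
        rw [pd_mul (d1 i) (d2 i), pd_comm (hΦ.smooth.contDiffAt.of_le (by decide)) j i]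
      simp only [dotProduct, hg, mulVec, hess, of_apply]
      simp only [grad, Finset.sum_mul, add_mul, Finset.sum_add_distrib, Finset.mul_sum]
      rw [Finset.sum_comm, add_sub_assoc, add_comm, sub_add_eq_add_sub, sub_eq_iff_eq_add]
      congr 1
      · exact Finset.sum_congr rfl fun i _ => Finset.sum_congr rfl fun j _ => by ring
      · exact Finset.sum_congr rfl fun i _ => Finset.sum_congr rfl fun j _ => by ring
    · refine integrableOn_of_zero_off hΩ (ContinuousOn.mul ?_ hρ.continuousOn) hK hKΩ fun y _ hy => ?_
      · exact continuousOn_finsetSum _ fun j _ => (pd_continuousOn hΩ hf' j).mul (c2 j)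
      · simp [dotProduct, grad, z2 _ y hy]

theorem mixedAction_continuousOn (hΩ : IsOpen Ω) (hV : HasVariations Ω A E D L) (hρA : ρ ∈ A)
    (hρ : ContDiffOn ℝ ∞ ρ Ω) (hΨ : IsTest Ω Ψ) (i : Fin d) :
    ContinuousOn (fun x => mixedAction L ρ Ψ x i) Ω :=
  (pd_continuousOn hΩ (hV.second_regular ρ hρA _ (isTangentTest_wDiv hΩ hρ hΨ)) i).neg

/-- Undoes the integration by parts hidden in `mixedAction`. In this form the term is visibly
symmetric and is the second variation on tangent vectors. -/
theorem integral_grad_mixedAction (hΩ : IsOpen Ω) (hV : HasVariations Ω A E D L) (hρA : ρ ∈ A)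
    (hρ : ContDiffOn ℝ ∞ ρ Ω) (hΦ : IsTest Ω Φ) (hΨ : IsTest Ω Ψ) :
    ∫ x in Ω, (grad Φ x ⬝ᵥ mixedAction L ρ Ψ x) * ρ x =
      ∫ x in Ω, L ρ (wDiv ρ Ψ) x * wDiv ρ Φ x := by
  rw [integral_mul_wDiv hΩ (hV.second_regular ρ hρA _ (isTangentTest_wDiv hΩ hρ hΨ))
    (hρ.of_le (by decide)) (hΦ.smooth.contDiffOn.of_le (by decide)) hΦ.isCompact hΦ.support
    (Or.inr hΦ.zero_off), ← integral_neg]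
  refine integral_congr_ae (Eventually.of_forall fun x => ?_)
  simp only [mixedAction, dotProduct_neg, neg_mul, dotProduct_comm]

theorem IsGeodesic.hasSecondDerivAtZero (hΩ : IsOpen Ω) {ε : ℝ} {r φ : ℝ → Sp d → ℝ}
    (h : IsGeodesic Ω ρ Φ ε r φ) (hΦ : IsTest Ω Φ) (hA : EnergyDomain Ω A)
    (hV : HasVariations Ω A E D L) (hρA : ρ ∈ A) :
    HasSecondDerivAtZero (fun s => E (r s)) (hessFormL Ω D L ρ Φ Φ) := by
  obtain ⟨K, hK, hKΩ, hs⟩ := h.support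
  have h0 : (0 : ℝ) ∈ Ioo (-ε) ε := ⟨by linarith [h.pos], h.pos⟩
  have hc := h.densityCurve hΩ hK hKΩ hs
  have hρ : ContDiffOn ℝ ∞ ρ Ω := (hA.density ρ hρA).smooth
  have hr0 : r 0 ∈ A := by rw [h.init_density]; exact hρA
  -- The parameter interval is shrunk so that a positive initial density stays positive, which keeps
  -- all segments in A.
  obtain ⟨I, hIsub, hIo, h0I⟩ := mem_nhds_iff.1
    (inter_mem (hc.eventually_pos hΩ) (isOpen_Ioo.mem_nhds h0))
  have hc' : DensityCurve Ω K I r :=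
    { isOpen := hIo
      zero_mem := h0I
      density := fun s hs => h.density s (hIsub hs).2
      smooth := h.smooth_density.mono (prod_mono (fun s hs => (hIsub hs).2) subset_rfl)
      compact := hK
      subset := hKΩ
      off := fun s hs x hx => hc.off s (hIsub hs).2 x hx }
  have hseg : ∀ s ∈ I, ∀ s' ∈ I, ∀ t ∈ Icc (0 : ℝ) 1, r s + t • (r s' - r s) ∈ A :=
    fun s hs s' hs' t ht => hc'.segment_mem hΩ hA hr0 hs hs' (hIsub hs).1 (hIsub hs').1 ht
  refine ⟨fun s => ∫ x in Ω, D (r s) x * deriv (fun s' => r s' x) s, ?_, ?_⟩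
  · filter_upwards [hIo.mem_nhds h0I] with s hs
    exact hc'.hasDerivAt_energy hΩ hV hseg hs
  · have hfirst := h.hasDerivAt_integral_first hΩ hΦ (hV.first_regular ρ hρA)
    rw [← h.init_density] at hfirst
    refine (hc'.hasDerivAt_energy_deriv hΩ hV hseg hfirst).congr_deriv ?_
    -- The equality is needed as functions on the whole space, since `L ρ` is applied to the
    -- function; off Ω both sides vanish.
    have hvel : (fun x => deriv (fun s' => r s' x) 0) = (-1 : ℝ) • wDiv ρ Φ := by
      funext x
      simp only [Pi.smul_apply, smul_eq_mul, neg_one_mul]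
      by_cases hx : x ∈ Ω
      · have := h.continuity_eq 0 h0 x hx
        rw [h.init_density, h.init_potential] at this
        linarith
      · rw [hc.vel_off h0 fun hxK => hx (hKΩ hxK), wDiv_zero_off hΦ.isCompact.isClosed hΦ.zero_off
          fun hxK => hx (hΦ.support hxK), neg_zero]
    have hvel' : ∀ x, deriv (fun s' => r s' x) 0 = -wDiv ρ Φ x := fun x => by
      have := congrFun hvel x
      simpa using this
    unfold hessFormL
    rw [integral_grad_mixedAction hΩ hV hρA hρ hΦ hΦ, hvel, h.init_density]
    congr 1
    refine setIntegral_congr_fun hΩ.measurableSet fun x hx => ?_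
    simp only [hvel', hV.second_smul ρ hρA _ _ (isTangentTest_wDiv hΩ hρ hΦ) x hx]
    ring

end GeodesicValue

end WassersteinNewton

namespace WassersteinNewton

/-! ### Inverting the maps x ↦ x + s g(x), smoothly in s. -/

section DisplacementInverse

variable {E : Type*} [NormedAddCommGroup E] [NormedSpace ℝ E] [FiniteDimensional ℝ E]

/-- A compactly supported smooth g is Lipschitz, so for small s the map is a half-Lipschitz
perturbation of the identity, hence bijective with injective differential. Smoothness of the inverse
jointly in (s, y) comes from the inverse function theorem for (s, x) ↦ (s, x + s g(x)). -/
theorem exists_displacement_inverse {g : E → E} (hg : ContDiff ℝ ∞ g)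
    (hc : HasCompactSupport g) :
    ∃ ε > 0, ∃ Y : ℝ → E → E,
      (∀ s ∈ Ioo (-ε) ε, ∀ x, Y s (x + s • g x) = x) ∧
      (∀ s ∈ Ioo (-ε) ε, ∀ y, Y s y + s • g (Y s y) = y) ∧
      ContDiffOn ℝ ∞ (fun p : ℝ × E => Y p.1 p.2) (Ioo (-ε) ε ×ˢ univ) ∧
      ∀ s ∈ Ioo (-ε) ε, ∀ x v, v + s • fderiv ℝ g x v = 0 → v = 0 := by
  have : CompleteSpace E := FiniteDimensional.complete ℝ E
  obtain ⟨C, hC⟩ := ContDiff.lipschitzWith_of_hasCompactSupport hc hg (by simp)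
  have hCpos : (0 : ℝ) < C + 1 := by positivity
  -- This makes s g Lipschitz with constant 1/2; the added 1 covers C = 0.
  set ε : ℝ := (2 * (C + 1))⁻¹ with hε
  have hεpos : 0 < ε := by positivity
  have hsC : ∀ s ∈ Ioo (-ε) ε, |s| * C ≤ 1 / 2 := by
    intro s hs
    have h1 : |s| ≤ ε := (abs_lt.2 hs).le
    calc |s| * C ≤ ε * (C + 1) := by gcongr; linarith
      _ = 1 / 2 := by rw [hε]; field_simp
  have happ : ∀ s ∈ Ioo (-ε) ε, ∀ x y,
      ‖s • g x - s • g y‖ ≤ 1 / 2 * ‖x - y‖ := by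
    intro s hs x y
    rw [← smul_sub, norm_smul, Real.norm_eq_abs]
    calc |s| * ‖g x - g y‖ ≤ |s| * (C * ‖x - y‖) := by
          gcongr; exact hC.norm_sub_le x y
      _ = (|s| * C) * ‖x - y‖ := by ring
      _ ≤ 1 / 2 * ‖x - y‖ := by gcongr; exact hsC s hs
  have hinj : ∀ s ∈ Ioo (-ε) ε, Function.Injective (fun x => x + s • g x) := by
    intro s hs x y hxy
    have h1 : x - y = -(s • g x - s • g y) := by
      have : x + s • g x = y + s • g y := hxy
      rw [sub_eq_iff_eq_add, ← sub_eq_zero]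
      rw [← sub_eq_zero] at this
      rw [← this]; abel
    have h2 := happ s hs x y
    rw [← norm_neg, ← h1] at h2
    have h3 : ‖x - y‖ ≤ 0 := by linarith
    exact sub_eq_zero.1 (norm_le_zero_iff.1 h3)
  have hsurj : ∀ s ∈ Ioo (-ε) ε, Function.Surjective (fun x => x + s • g x) := by
    intro s hs
    have hA : ApproximatesLinearOn (fun x => x + s • g x)
        ((ContinuousLinearEquiv.refl ℝ E : E ≃L[ℝ] E) : E →L[ℝ] E) univ (1 / 2) := by
      intro x _ y _
      have := happ s hs x y
      refine le_of_eq_of_le ?_ this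
      congr 1
      simp only [ContinuousLinearEquiv.coe_refl, ContinuousLinearMap.coe_id', id]
      abel
    refine hA.surjective ?_
    rcases subsingleton_or_nontrivial E with h | h
    · exact Or.inl h
    · right
      have : ‖(((ContinuousLinearEquiv.refl ℝ E).symm : E ≃L[ℝ] E) : E →L[ℝ] E)‖₊ = 1 := by
        simp
      rw [this, inv_one]
      exact NNReal.half_lt_self one_ne_zero
  have hker : ∀ s ∈ Ioo (-ε) ε, ∀ x v, v + s • fderiv ℝ g x v = 0 → v = 0 := by
    intro s hs x v hv
    have h1 : v = -(s • fderiv ℝ g x v) := eq_neg_of_add_eq_zero_left hv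
    have h2 : ‖v‖ ≤ 1 / 2 * ‖v‖ := by
      conv_lhs => rw [h1]
      rw [norm_neg, norm_smul, Real.norm_eq_abs]
      calc |s| * ‖fderiv ℝ g x v‖ ≤ |s| * (C * ‖v‖) := by
            gcongr
            exact (ContinuousLinearMap.le_opNorm _ _).trans (by
              gcongr; exact norm_fderiv_le_of_lipschitz ℝ hC)
        _ = (|s| * C) * ‖v‖ := by ring
        _ ≤ 1 / 2 * ‖v‖ := by gcongr; exact hsC s hs
    exact norm_le_zero_iff.1 (by linarith)
  set Y : ℝ → E → E := fun s => Function.invFun (fun x => x + s • g x) with hY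
  have hYl : ∀ s ∈ Ioo (-ε) ε, ∀ x, Y s (x + s • g x) = x := fun s hs =>
    Function.leftInverse_invFun (hinj s hs)
  have hYr : ∀ s ∈ Ioo (-ε) ε, ∀ y, Y s y + s • g (Y s y) = y := fun s hs =>
    Function.rightInverse_invFun (hsurj s hs)
  refine ⟨ε, hεpos, Y, hYl, hYr, ?_, hker⟩
  rintro ⟨s₀, y₀⟩ ⟨hs₀, -⟩
  refine ContDiffAt.contDiffWithinAt ?_
  set x₀ := Y s₀ y₀ with hx₀
  set T : ℝ × E → ℝ × E := fun p => (p.1, p.2 + p.1 • g p.2) with hT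
  have hTs : ContDiff ℝ ∞ T :=
    contDiff_fst.prodMk (contDiff_snd.add (contDiff_fst.smul (hg.comp contDiff_snd)))
  have hTp : T (s₀, x₀) = (s₀, y₀) := by
    simp only [hT]; rw [hYr s₀ hs₀ y₀]
  have hgd : HasFDerivAt g (fderiv ℝ g x₀) x₀ := (hg.differentiable (by simp) x₀).hasFDerivAt
  have hgd' : HasFDerivAt (fun p : ℝ × E => g p.2)
      ((fderiv ℝ g x₀).comp (ContinuousLinearMap.snd ℝ ℝ E)) (s₀, x₀) :=
    HasFDerivAt.comp (s₀, x₀) (f := Prod.snd) hgd hasFDerivAt_snd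
  have hd := (hasFDerivAt_fst (𝕜 := ℝ) (p := (s₀, x₀))).prodMk
    ((hasFDerivAt_snd (𝕜 := ℝ) (p := (s₀, x₀))).add
      ((hasFDerivAt_fst (𝕜 := ℝ) (p := (s₀, x₀))).smul hgd'))
  set T' : ℝ × E →L[ℝ] ℝ × E := fderiv ℝ T (s₀, x₀) with hT'
  have hT'eq := hd.fderiv
  have hTd : HasFDerivAt T T' (s₀, x₀) := (hTs.differentiable (by simp) _).hasFDerivAt
  have hTu := hTd.unique hd
  -- The differential of T is block triangular: the first component forces τ = 0, and then `hker`
  -- forces v = 0. In finite dimension injectivity suffices.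
  have hkerT : (T' : ℝ × E →ₗ[ℝ] ℝ × E).ker = ⊥ := by
    refine LinearMap.ker_eq_bot'.2 ?_
    rintro ⟨τ, v⟩ hv
    have hv' : T' (τ, v) = 0 := hv
    rw [hTu] at hv'
    have h1 : τ = 0 := by simpa using congrArg Prod.fst hv'
    have h2 := congrArg Prod.snd hv'
    subst h1
    have : v = 0 := hker s₀ hs₀ x₀ v (by simpa using h2)
    rw [this]; rfl
  have hrange : (T' : ℝ × E →ₗ[ℝ] ℝ × E).range = ⊤ :=
    LinearMap.range_eq_top.2 (LinearMap.injective_iff_surjective.1 (LinearMap.ker_eq_bot.1 hkerT))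
  set e := ContinuousLinearEquiv.ofBijective T' hkerT hrange with he
  have hTd' : HasFDerivAt T (e : ℝ × E →L[ℝ] ℝ × E) (s₀, x₀) := by
    rw [he, ContinuousLinearEquiv.coe_ofBijective]; exact hTd
  have hn : (∞ : WithTop ℕ∞) ≠ 0 := by simp
  have hinv := hTs.contDiffAt.to_localInverse hTd' hn
  have hright := (hTs.contDiffAt.hasStrictFDerivAt' hTd' hn).eventually_right_inverse
  rw [hTp] at hinv hright
  -- Near (s₀, y₀) the local inverse solves the equation that defines Y, and the global left inverse
  -- identifies the two.
  refine hinv.snd.congr_of_eventuallyEq ?_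
  filter_upwards [hright, (isOpen_Ioo.prod isOpen_univ).mem_nhds
    (show (s₀, y₀) ∈ Ioo (-ε) ε ×ˢ univ from ⟨hs₀, mem_univ _⟩)] with p hp hpI
  set q := hTs.contDiffAt.localInverse hTd' hn p with hq
  have hTq : T q = p := hp
  have h1 : q.1 = p.1 := (congrArg Prod.fst hTq : (T q).1 = p.1)
  have h2 : q.2 + q.1 • g q.2 = p.2 :=
    (congrArg Prod.snd hTq : (T q).2 = p.2)
  rw [h1] at h2
  rw [← h2]
  exact hYl p.1 hpI.1 q.2

end DisplacementInverse

end WassersteinNewton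

namespace WassersteinNewton

/-! ### Jacobian matrices and the derivative of the determinant. -/

noncomputable section JacobianMatrix

variable {d : ℕ}

/-- The matrix of an endomorphism of Euclidean space in the standard basis. -/
def stdMatrix (T : Sp d →L[ℝ] Sp d) : Matrix (Fin d) (Fin d) ℝ :=
  LinearMap.toMatrix (EuclideanSpace.basisFun (Fin d) ℝ).toBasis
    (EuclideanSpace.basisFun (Fin d) ℝ).toBasis (T : Sp d →ₗ[ℝ] Sp d)

theorem stdMatrix_apply (T : Sp d →L[ℝ] Sp d) (i j : Fin d) :
    stdMatrix T i j = T (EuclideanSpace.single j 1) i := by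
  simp [stdMatrix, LinearMap.toMatrix_apply]

theorem stdMatrix_comp (S T : Sp d →L[ℝ] Sp d) :
    stdMatrix (S.comp T) = stdMatrix S * stdMatrix T := by
  simp [stdMatrix, ← LinearMap.toMatrix_comp]

theorem stdMatrix_id : stdMatrix (ContinuousLinearMap.id ℝ (Sp d)) = 1 := by
  ext i j
  rw [stdMatrix_apply]
  simp [Matrix.one_apply]

theorem stdMatrix_add_smul (S T : Sp d →L[ℝ] Sp d) (s : ℝ) :
    stdMatrix (S + s • T) = stdMatrix S + s • stdMatrix T := by
  simp [stdMatrix]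

theorem det_stdMatrix (T : Sp d →L[ℝ] Sp d) : (stdMatrix T).det = T.det :=
  LinearMap.det_toMatrix _ _

theorem det_ne_zero_of_injective {T : Sp d →L[ℝ] Sp d} (h : ∀ v, T v = 0 → v = 0) :
    (stdMatrix T).det ≠ 0 := by
  rw [det_stdMatrix]
  intro h0
  have h1 : LinearMap.det (T : Sp d →ₗ[ℝ] Sp d) = 0 := h0
  have := LinearMap.bot_lt_ker_of_det_eq_zero h1
  exact this.ne' (LinearMap.ker_eq_bot'.2 fun v hv => h v hv)

theorem trace_stdMatrix_fderiv {V : Sp d → Sp d} {x : Sp d} (hV : DifferentiableAt ℝ V x) :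
    (stdMatrix (fderiv ℝ V x)).trace = ∑ i, pd i (fun y => V y i) x := by
  refine Finset.sum_congr rfl fun i _ => ?_
  rw [diag_apply, stdMatrix_apply, pd]
  have := ((EuclideanSpace.proj i : Sp d →L[ℝ] ℝ).hasFDerivAt.comp x hV.hasFDerivAt).fderiv
  simp only [Function.comp_def, PiLp.proj_apply] at this
  rw [this]
  rfl

/-- Jacobi's formula. Since N(1 + sM) = M, one has 1 + tM = (1 + (t - s)N)(1 + sM), which reduces
the claim to det(1 + uN) = 1 + u tr N + O(u²). In the application N is the differential of the
Eulerian velocity, so its trace is the divergence. -/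
theorem hasDerivAt_det_one_add_smul {M N : Matrix (Fin d) (Fin d) ℝ} {s : ℝ}
    (h : N * (1 + s • M) = M) :
    HasDerivAt (fun t : ℝ => (1 + t • M).det) (N.trace * (1 + s • M).det) s := by
  have h1 : ∀ t : ℝ, (1 + t • M).det = (1 + (t - s) • N).det * (1 + s • M).det := by
    intro t
    rw [← det_mul, add_mul, one_mul, smul_mul_assoc, h, add_assoc, ← add_smul, add_sub_cancel]
  have h2 : HasDerivAt (fun u : ℝ => (1 + u • N).det) N.trace 0 := by
    rw [funext fun u : ℝ => det_one_add_smul u N]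
    have h4 := ((hasDerivAt_id (0 : ℝ)).const_mul N.trace).const_add 1
    have h5 := h4.fun_add ((Polynomial.hasDerivAt
      (det (1 + (Polynomial.X : Polynomial ℝ) • N.map Polynomial.C)).divX.divX (0 : ℝ)).fun_mul
        ((hasDerivAt_id (0 : ℝ)).fun_pow 2))
    simpa using h5
  have h6 : HasDerivAt (fun t : ℝ => (1 + (t - s) • N).det) N.trace s := by
    have h7 : HasDerivAt (fun t : ℝ => t - s) 1 s := (hasDerivAt_id s).sub_const s
    have := HasDerivAt.comp_of_eq s (h₂ := fun u : ℝ => (1 + u • N).det) h2 h7 (sub_self s).symm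
    simpa [Function.comp_def] using this
  refine ((h6.mul_const _).congr_of_eventuallyEq ?_)
  exact Eventually.of_forall h1

end JacobianMatrix

/-! ### Existence of geodesics by characteristics. -/

section GeodesicExistence

variable {d : ℕ} {Ω : Set (Sp d)} {ρ Φ : Sp d → ℝ}

theorem contDiff_det {E : Type*} [NormedAddCommGroup E] [NormedSpace ℝ E] {n : WithTop ℕ∞}
    {M : E → Matrix (Fin d) (Fin d) ℝ} (h : ∀ i j, ContDiff ℝ n fun p => M p i j) :
    ContDiff ℝ n fun p => (M p).det := by
  simp only [det_apply']
  exact ContDiff.sum fun σ _ => contDiff_const.mul (contDiff_prod fun i _ => h _ _)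

theorem fderiv_euclidean_apply {g : Sp d → Sp d} {x : Sp d} (hg : DifferentiableAt ℝ g x)
    (v : Sp d) (i : Fin d) : fderiv ℝ g x v i = fderiv ℝ (fun y => g y i) x v := by
  have := ((EuclideanSpace.proj i : Sp d →L[ℝ] ℝ).hasFDerivAt.comp x hg.hasFDerivAt).fderiv
  simp only [Function.comp_def, PiLp.proj_apply] at this
  rw [this]
  rfl

/-- Particles move along straight lines x + s∇Φ(x). The density is transported with the Jacobian
determinant, the potential with the action (s/2)‖∇Φ‖² added. Both equations are obtained by
differentiating these transport identities along the characteristics. -/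
theorem exists_geodesic (hΩ : IsOpen Ω) (hρ : Density Ω ρ) (hΦ : IsTest Ω Φ) :
    ∃ (ε : ℝ) (r φ : ℝ → Sp d → ℝ), IsGeodesic Ω ρ Φ ε r φ := by
  set K := tsupport Φ with hKdef
  have hK : IsCompact K := hΦ.isCompact
  have hKΩ : K ⊆ Ω := hΦ.support
  have hΦ0 := hΦ.zero_off
  set g : Sp d → Sp d := fun x => WithLp.toLp 2 (grad Φ x) with hgdef
  have hgi : ∀ x i, g x i = pd i Φ x := fun x i => rfl
  have hpd : ∀ i, ContDiff ℝ ∞ (pd i Φ) := fun i =>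
    contDiffOn_univ.1 (pd_contDiffOn isOpen_univ hΦ.smooth.contDiffOn (by decide) i)
  have hg : ContDiff ℝ ∞ g := contDiff_euclidean.2 fun i => hpd i
  have hgd : Differentiable ℝ g := hg.differentiable (by simp)
  have hg0 : ∀ x, x ∉ K → g x = 0 := fun x hx => by
    ext i; rw [hgi, pd_eq_zero_off hK.isClosed hΦ0 hx]; rfl
  obtain ⟨ε, hε, Y, hYl, hYr, hYs, hker⟩ := exists_displacement_inverse hg
    (HasCompactSupport.intro hK hg0)
  have h0I : (0 : ℝ) ∈ Ioo (-ε) ε := ⟨by linarith, hε⟩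
  have hYK : ∀ s ∈ Ioo (-ε) ε, ∀ y, y ∉ K → Y s y = y := fun s hs y hy => by
    have := hYl s hs y
    rwa [hg0 y hy, smul_zero, add_zero] at this
  have hY0 : ∀ y, Y 0 y = y := fun y => by simpa using hYl 0 h0I y
  have hYΩ : ∀ s ∈ Ioo (-ε) ε, ∀ y ∈ Ω, Y s y ∈ Ω := fun s hs y hy => by
    by_cases hYy : Y s y ∈ K
    · exact hKΩ hYy
    · have := hYr s hs y
      rw [hg0 _ hYy, smul_zero, add_zero] at this
      rwa [this]
  have hXΩ : ∀ s ∈ Ioo (-ε) ε, ∀ x ∈ Ω, x + s • g x ∈ Ω := fun s hs x hx => by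
    by_contra hn
    have h1 := hYK s hs _ fun h => hn (hKΩ h)
    rw [hYl s hs] at h1
    exact hn (h1 ▸ hx)
  set M : Sp d → Matrix (Fin d) (Fin d) ℝ := fun x => stdMatrix (fderiv ℝ g x) with hM
  set Jc : ℝ → Sp d → ℝ := fun s x => (1 + s • M x).det with hJ
  have hfX : ∀ (s : ℝ) (x : Sp d), HasFDerivAt (fun x => x + s • g x)
      (ContinuousLinearMap.id ℝ (Sp d) + s • fderiv ℝ g x) x := fun s x =>
    (hasFDerivAt_id x).fun_add ((hgd x).hasFDerivAt.fun_const_smul s)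
  have hMX : ∀ (s : ℝ) (x : Sp d), stdMatrix (ContinuousLinearMap.id ℝ (Sp d) + s • fderiv ℝ g x) =
      1 + s • M x := fun s x => by rw [stdMatrix_add_smul, stdMatrix_id]
  have hJne : ∀ s ∈ Ioo (-ε) ε, ∀ x, Jc s x ≠ 0 := fun s hs x => by
    simp only [hJ]
    rw [← hMX]
    exact det_ne_zero_of_injective fun v hv => hker s hs x v (by simpa using hv)
  have hMs : ∀ i j, ContDiff ℝ ∞ fun x => M x i j := fun i j => by
    simp only [hM, stdMatrix_apply]
    exact contDiff_euclidean.1 ((hg.fderiv_right (m := ∞) (by decide)).clm_apply contDiff_const) i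
  have hJs : ContDiff ℝ ∞ fun p : ℝ × Sp d => Jc p.1 p.2 := by
    refine contDiff_det fun i j => ?_
    simp only [Matrix.add_apply, Matrix.smul_apply, smul_eq_mul]
    exact contDiff_const.add (contDiff_fst.mul ((hMs i j).comp contDiff_snd))
  have hJ0 : ∀ x, Jc 0 x = 1 := fun x => by simp [hJ]
  have hJpos : ∀ s ∈ Ioo (-ε) ε, ∀ x, 0 < Jc s x := by
    intro s hs x
    have hcont : ContinuousOn (fun s => Jc s x) (Ioo (-ε) ε) :=
      (hJs.continuous.comp (by fun_prop : Continuous fun s : ℝ => (s, x))).continuousOn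
    by_contra hn
    have h1 := isPreconnected_Ioo.intermediate_value hs h0I hcont
    -- The Jacobian equals 1 at time 0, so reaching a nonpositive value would make it vanish
    -- somewhere, which `hJne` excludes.
    obtain ⟨t, ht, ht0⟩ := h1 ⟨not_lt.1 hn, by rw [hJ0]; exact zero_le_one⟩
    exact hJne t ht x ht0
  set r : ℝ → Sp d → ℝ := fun s y => ρ (Y s y) / Jc s (Y s y) with hr
  set φ : ℝ → Sp d → ℝ := fun s y =>
    Φ (Y s y) + s / 2 * ∑ i, pd i Φ (Y s y) * pd i Φ (Y s y) with hφ
  have hW : IsOpen (Ioo (-ε) ε ×ˢ (univ : Set (Sp d))) := isOpen_Ioo.prod isOpen_univ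
  have hWΩ : IsOpen (Ioo (-ε) ε ×ˢ Ω) := isOpen_Ioo.prod hΩ
  have hsub : Ioo (-ε) ε ×ˢ Ω ⊆ Ioo (-ε) ε ×ˢ (univ : Set (Sp d)) :=
    prod_mono subset_rfl (subset_univ _)
  have hrs : ContDiffOn ℝ ∞ (fun p : ℝ × Sp d => r p.1 p.2) (Ioo (-ε) ε ×ˢ Ω) := by
    refine ContDiffOn.div (hρ.smooth.comp (hYs.mono hsub) fun p hp => hYΩ p.1 hp.1 p.2 hp.2) ?_
      fun p hp => hJne _ hp.1 _
    exact hJs.comp_contDiffOn (contDiffOn_fst.prodMk (hYs.mono hsub))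
  have hφs : ContDiffOn ℝ ∞ (fun p : ℝ × Sp d => φ p.1 p.2) (Ioo (-ε) ε ×ˢ univ) :=
    (hΦ.smooth.comp_contDiffOn hYs).add ((contDiffOn_fst.div_const 2).mul
      (ContDiffOn.sum fun i _ => ((hpd i).comp_contDiffOn hYs).mul ((hpd i).comp_contDiffOn hYs)))
  have hrX : ∀ s ∈ Ioo (-ε) ε, ∀ x, r s (x + s • g x) * Jc s x = ρ x := fun s hs x => by
    simp only [hr]
    rw [hYl s hs, div_mul_cancel₀ _ (hJne s hs x)]
  have hφX : ∀ s ∈ Ioo (-ε) ε, ∀ x, φ s (x + s • g x) =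
      Φ x + s / 2 * ∑ i, pd i Φ x * pd i Φ x := fun s hs x => by
    simp only [hφ]
    rw [hYl s hs]
  have hφd : ∀ s ∈ Ioo (-ε) ε, ∀ y,
      DifferentiableAt ℝ (fun p : ℝ × Sp d => φ p.1 p.2) (s, y) := fun s hs y =>
    (hφs.contDiffAt (hW.mem_nhds ⟨hs, mem_univ y⟩)).differentiableAt (by simp)
  -- The gradient is constant along characteristics. Differentiating φ_s(x + s g(x)) = Φ +
  -- (s/2)‖∇Φ‖² in a direction v gives ⟨∇Φ, v + s Dg v⟩ on the right, and v + s Dg v ranges over all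
  -- vectors.
  have hgrad : ∀ s ∈ Ioo (-ε) ε, ∀ y, grad (φ s) y = grad Φ (Y s y) := by
    intro s hs y
    set x := Y s y with hx
    have hy : x + s • g x = y := hYr s hs y
    have hinj : Function.Injective (((ContinuousLinearMap.id ℝ (Sp d) + s • fderiv ℝ g x :
        Sp d →L[ℝ] Sp d)) : Sp d →ₗ[ℝ] Sp d) :=
      LinearMap.ker_eq_bot.1 (LinearMap.ker_eq_bot'.2 fun v hv => hker s hs x v hv)
    have hsurj := LinearMap.injective_iff_surjective.1 hinj
    have hφsd : HasFDerivAt (φ s) (fderiv ℝ (φ s) y) y :=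
      (hasFDerivAt_space (hφd s hs y)).differentiableAt.hasFDerivAt
    have hcomp := HasFDerivAt.comp x (g := φ s) (f := fun x => x + s • g x)
      (g' := fderiv ℝ (φ s) y) (by rw [hy]; exact hφsd) (hfX s x)
    have hdj : ∀ j, DifferentiableAt ℝ (pd j Φ) x := fun j => (hpd j).differentiable (by simp) x
    have hrhs : HasFDerivAt (fun x => Φ x + s / 2 * ∑ i, pd i Φ x * pd i Φ x)
        (fderiv ℝ Φ x + (s / 2) • ∑ i, (pd i Φ x • fderiv ℝ (pd i Φ) x +
          pd i Φ x • fderiv ℝ (pd i Φ) x)) x :=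
      (hΦ.smooth.differentiable (by simp) x).hasFDerivAt.add
        ((HasFDerivAt.fun_sum fun i _ => (hdj i).hasFDerivAt.mul (hdj i).hasFDerivAt).const_mul _)
    have heq : φ s ∘ (fun x => x + s • g x) = fun x => Φ x + s / 2 * ∑ i, pd i Φ x * pd i Φ x :=
      funext fun x => hφX s hs x
    rw [heq] at hcomp
    have huniq := hcomp.unique hrhs
    funext i
    obtain ⟨v, hv⟩ := hsurj (EuclideanSpace.single i 1)
    have h1 := congrArg (fun T : Sp d →L[ℝ] ℝ => T v) huniq
    have hv' : v + s • fderiv ℝ g x v = EuclideanSpace.single i 1 := hv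
    simp only [ContinuousLinearMap.comp_apply, _root_.add_apply,
      ContinuousLinearMap.coe_id', id, _root_.smul_apply] at h1
    rw [hv'] at h1
    change fderiv ℝ (φ s) y (EuclideanSpace.single i 1) = pd i Φ x
    rw [h1, fderiv_apply_eq_sum_pd]
    have h2 : ∀ j, v j + s * fderiv ℝ (pd j Φ) x v = EuclideanSpace.single i (1 : ℝ) j := fun j => by
      have := congrArg (fun w : Sp d => w j) hv'
      simp only [PiLp.add_apply, PiLp.smul_apply, smul_eq_mul] at this
      rw [fderiv_euclidean_apply (hgd x)] at this
      exact this
    have h3 : pd i Φ x = ∑ j, pd j Φ x * EuclideanSpace.single i (1 : ℝ) j := by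
      simp
    rw [h3]
    simp only [← h2, mul_add, Finset.sum_add_distrib]
    congr 1
    simp only [_root_.sum_apply, _root_.add_apply,
      _root_.smul_apply, smul_eq_mul]
    rw [← two_mul, ← mul_assoc, div_mul_cancel₀ s two_ne_zero, Finset.mul_sum]
    exact Finset.sum_congr rfl fun j _ => by ring
  have hXs : ∀ (s : ℝ) (x : Sp d), HasDerivAt (fun s' : ℝ => (s', x + s' • g x)) ((1 : ℝ), g x) s := fun s x => by
    have := (hasDerivAt_id s).prodMk (((hasDerivAt_id s).smul_const (g x)).const_add x)
    simpa using this
  refine ⟨ε, r, φ, ?_⟩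
  refine
    { pos := hε
      density := ?_
      smooth_density := hrs
      smooth_potential := hφs.mono hsub
      support := ⟨K, hK, hKΩ, ?_⟩
      init_density := ?_
      init_potential := ?_
      continuity_eq := ?_
      hamilton_jacobi := ?_ }
  · intro s hs
    have hrss : ContDiffOn ℝ ∞ (r s) Ω :=
      hrs.comp (contDiff_prodMk_right s).contDiffOn fun y hy => ⟨hs, hy⟩
    refine ⟨hrss, fun y => div_nonneg (hρ.nonneg _) (hJpos s hs _).le, fun y hy => ?_, ?_⟩
    · simp only [hr]
      rw [hYK s hs y fun h => hy (hKΩ h), hρ.zero_off y hy, zero_div]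
    · have himg : (fun x => x + s • g x) '' Ω = Ω := by
        refine Subset.antisymm ?_ fun y hy => ⟨Y s y, hYΩ s hs y hy, hYr s hs y⟩
        rintro _ ⟨x, hx, rfl⟩
        exact hXΩ s hs x hx
      have hinj : InjOn (fun x => x + s • g x) Ω := fun x _ y _ hxy => by
        have h1 := hYl s hs x
        have h2 : x + s • g x = y + s • g y := hxy
        rw [h2, hYl s hs] at h1
        exact h1.symm
      -- Conservation of mass by the change of variables y = x + s g(x), which maps Ω onto itself.
      have := integral_image_eq_integral_abs_det_fderiv_smul (volume : Measure (Sp d))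
        hΩ.measurableSet (fun x _ => (hfX s x).hasFDerivWithinAt) hinj (r s)
      rw [himg] at this
      rw [this, ← hρ.mass]
      refine setIntegral_congr_fun hΩ.measurableSet fun x _ => ?_
      simp only [smul_eq_mul]
      rw [← det_stdMatrix, hMX, abs_of_pos (hJpos s hs x), mul_comm]
      exact hrX s hs x
  · intro s hs y hy
    simp only [hφ]
    rw [hYK s hs y hy, hΦ0 y hy]
    simp [pd_eq_zero_off hK.isClosed hΦ0 hy]
  · funext y
    simp only [hr]
    rw [hY0, hJ0, div_one]
  · funext y
    simp only [hφ]
    rw [hY0]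
    simp
  · intro s hs y hy
    set x := Y s y with hx
    have hyx : x + s • g x = y := hYr s hs y
    have hrd : DifferentiableAt ℝ (fun p : ℝ × Sp d => r p.1 p.2) (s, y) :=
      (hrs.contDiffAt (hWΩ.mem_nhds ⟨hs, hy⟩)).differentiableAt (by simp)
    have hYd : DifferentiableAt ℝ (Y s) y :=
      (hasFDerivAt_space ((hYs.contDiffAt (hW.mem_nhds ⟨hs, mem_univ y⟩)).differentiableAt
        (by simp))).differentiableAt
    set V : Sp d → Sp d := fun z => g (Y s z) with hV
    have hVd : DifferentiableAt ℝ V y := (hgd _).comp y hYd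
    -- V is the velocity in Eulerian coordinates, so V(x + s g(x)) = g(x); this is the chain rule
    -- for that identity.
    have hN : stdMatrix (fderiv ℝ V y) * (1 + s • M x) = M x := by
      rw [← hMX, ← stdMatrix_comp]
      have h1 := HasFDerivAt.comp x (g := V) (f := fun x => x + s • g x)
        (g' := fderiv ℝ V y) (by rw [hyx]; exact hVd.hasFDerivAt) (hfX s x)
      have h2 : V ∘ (fun x => x + s • g x) = g := funext fun z => by
        simp only [Function.comp, hV]
        rw [hYl s hs]
      rw [h2] at h1
      rw [h1.unique (hgd x).hasFDerivAt]
    have hJd : HasDerivAt (fun t => Jc t x) ((stdMatrix (fderiv ℝ V y)).trace * Jc s x) s :=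
      hasDerivAt_det_one_add_smul hN
    have hrcomp := HasFDerivAt.comp_hasDerivAt_of_eq s hrd.hasFDerivAt (hXs s x)
      (show (s, y) = (s, x + s • g x) by rw [hyx])
    have hprod := hrcomp.mul hJd
    -- Density times Jacobian is constant along a characteristic; its vanishing time derivative is
    -- the continuity equation multiplied by the Jacobian.
    have hconst : ((fun p : ℝ × Sp d => r p.1 p.2) ∘ fun s' => (s', x + s' • g x)) *
        (fun t => Jc t x) =ᶠ[𝓝 s] fun _ => ρ x := by
      filter_upwards [isOpen_Ioo.mem_nhds hs] with t ht using hrX t ht x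
    have hzero := hprod.unique ((hasDerivAt_const s (ρ x)).congr_of_eventuallyEq hconst)
    have hsplit : fderiv ℝ (fun p : ℝ × Sp d => r p.1 p.2) (s, y) (1, g x) =
        deriv (fun s' => r s' y) s + ∑ i, pd i (r s) y * pd i Φ x := by
      rw [(hasDerivAt_time hrd).deriv]
      have h1 : ∑ i, pd i (r s) y * pd i Φ x = fderiv ℝ (r s) y (g x) := by
        rw [fderiv_apply_eq_sum_pd]; rfl
      rw [h1, (hasFDerivAt_space hrd).fderiv]
      simp only [ContinuousLinearMap.comp_apply, ContinuousLinearMap.inr_apply]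
      rw [← map_add]
      simp
    rw [trace_stdMatrix_fderiv hVd, hsplit] at hzero
    have hrsd : DifferentiableAt ℝ (r s) y := (hasFDerivAt_space hrd).differentiableAt
    have hVi : ∀ i, DifferentiableAt ℝ (fun z => V z i) y := fun i =>
      (EuclideanSpace.proj i : Sp d →L[ℝ] ℝ).differentiableAt.comp y hVd
    have hw : wDiv (r s) (φ s) y =
        ∑ i, pd i (r s) y * pd i Φ x + r s y * ∑ i, pd i (fun z => V z i) y := by
      unfold wDiv div
      rw [Finset.mul_sum, ← Finset.sum_add_distrib]
      refine Finset.sum_congr rfl fun i _ => ?_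
      have e : (fun z => (r s z • grad (φ s) z) i) = fun z => r s z * V z i := by
        funext z
        rw [hgrad s hs z]
        rfl
      rw [e, pd_mul hrsd (hVi i)]
      have : V y i = pd i Φ x := rfl
      rw [this]; ring
    rw [hw]
    have hJx := hJne s hs x
    simp only [Function.comp, hyx] at hzero
    apply mul_right_cancel₀ hJx
    rw [zero_mul]
    linarith
  · intro s hs y _
    set x := Y s y with hx
    have hyx : x + s • g x = y := hYr s hs y
    have hcomp := HasFDerivAt.comp_hasDerivAt_of_eq s (hφd s hs y).hasFDerivAt (hXs s x)
      (show (s, y) = (s, x + s • g x) by rw [hyx])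
    have hrhs : HasDerivAt (fun s : ℝ => Φ x + s / 2 * ∑ i, pd i Φ x * pd i Φ x)
        (1 / 2 * ∑ i, pd i Φ x * pd i Φ x) s :=
      (((hasDerivAt_id s).div_const 2).mul_const _).const_add _
    -- Along a characteristic the total derivative ∂ₛφ + ‖∇φ‖² equals ½‖∇Φ‖², which is the
    -- Hamilton–Jacobi equation.
    have hev : ((fun p : ℝ × Sp d => φ p.1 p.2) ∘ fun s' => (s', x + s' • g x)) =ᶠ[𝓝 s]
        fun s : ℝ => Φ x + s / 2 * ∑ i, pd i Φ x * pd i Φ x := by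
      filter_upwards [isOpen_Ioo.mem_nhds hs] with t ht using hφX t ht x
    have huniq := hcomp.unique (hrhs.congr_of_eventuallyEq hev)
    have hsplit : fderiv ℝ (fun p : ℝ × Sp d => φ p.1 p.2) (s, y) (1, g x) =
        deriv (fun s' => φ s' y) s + ∑ i, pd i (φ s) y * pd i Φ x := by
      rw [(hasDerivAt_time (hφd s hs y)).deriv]
      have h1 : ∑ i, pd i (φ s) y * pd i Φ x = fderiv ℝ (φ s) y (g x) := by
        rw [fderiv_apply_eq_sum_pd]; rfl
      rw [h1, (hasFDerivAt_space (hφd s hs y)).fderiv]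
      simp only [ContinuousLinearMap.comp_apply, ContinuousLinearMap.inr_apply]
      rw [← map_add]
      simp
    rw [hsplit] at huniq
    have hg' : ∀ i, pd i (φ s) y = pd i Φ x := fun i => congrFun (hgrad s hs y) i
    rw [hgrad s hs y]
    simp only [hg'] at huniq
    simp only [dotProduct, grad]
    linarith

end GeodesicExistence

end WassersteinNewton

namespace WassersteinNewton

/-! ### The Hessian as a bilinear form, and its uniqueness. -/

section HessianForm

variable {d : ℕ} {Ω K : Set (Sp d)} {A : Set (Sp d → ℝ)} {E : (Sp d → ℝ) → ℝ}
  {D : (Sp d → ℝ) → Sp d → ℝ} {L : (Sp d → ℝ) → (Sp d → ℝ) → Sp d → ℝ} {ρ Φ Ψ : Sp d → ℝ}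

theorem IsTest.grad_zero_off (hΦ : IsTest Ω Φ) {y : Sp d} (hy : y ∉ tsupport Φ) :
    grad Φ y = 0 :=
  grad_eq_zero_off hΦ.isCompact.isClosed hΦ.zero_off hy

theorem IsTest.pd_continuous (hΦ : IsTest Ω Φ) (i : Fin d) : Continuous (pd i Φ) :=
  continuousOn_univ.1 (pd_continuousOn isOpen_univ
    (hΦ.smooth.contDiffOn.of_le (by decide)) i)

theorem IsTest.grad_add (hΦ : IsTest Ω Φ) (hΨ : IsTest Ω Ψ) (x : Sp d) :
    grad (Φ + Ψ) x = grad Φ x + grad Ψ x :=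
  funext fun i => pd_add (hΦ.smooth.differentiable (by simp) x)
    (hΨ.smooth.differentiable (by simp) x) i

theorem grad_const_smul (c : ℝ) (x : Sp d) : grad (c • Φ) x = c • grad Φ x :=
  funext fun i => pd_const_mul c i

theorem continuousOn_dotProduct {u v : Sp d → Fin d → ℝ}
    (hu : ∀ i, ContinuousOn (fun x => u x i) Ω) (hv : ∀ i, ContinuousOn (fun x => v x i) Ω) :
    ContinuousOn (fun x => u x ⬝ᵥ v x) Ω :=
  continuousOn_finsetSum _ fun i _ => (hu i).mul (hv i)

theorem integrableOn_grad_dotProduct_mul (hΩ : IsOpen Ω) (hΦ : IsTest Ω Φ) {V : Sp d → Fin d → ℝ}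
    (hV : ∀ i, ContinuousOn (fun x => V x i) Ω) (hρ : ContinuousOn ρ Ω) :
    IntegrableOn (fun x => (grad Φ x ⬝ᵥ V x) * ρ x) Ω :=
  integrableOn_of_zero_off hΩ ((continuousOn_dotProduct
    (fun i => (hΦ.pd_continuous i).continuousOn) hV).mul hρ) hΦ.isCompact hΦ.support
    fun y _ hy => by rw [hΦ.grad_zero_off hy, zero_dotProduct, zero_mul]

theorem continuousOn_hess_mulVec_grad (hΩ : IsOpen Ω) {f g : Sp d → ℝ} (hf : ContDiffOn ℝ 2 f Ω)
    (hg : ContDiffOn ℝ 1 g Ω) (i : Fin d) :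
    ContinuousOn (fun x => (hess f x *ᵥ grad g x) i) Ω := by
  have : ContinuousOn (fun x => ∑ j, pd i (pd j f) x * pd j g x) Ω :=
    continuousOn_finsetSum _ fun j _ => (pd_continuousOn hΩ
      (pd_contDiffOn (m := 1) hΩ hf (by norm_num) j) i).mul (pd_continuousOn hΩ hg j)
  exact this

theorem dotProduct_hess_mulVec_comm {f : Sp d → ℝ} {x : Sp d} (hf : ContDiffAt ℝ 2 f x)
    (u v : Fin d → ℝ) : u ⬝ᵥ (hess f x *ᵥ v) = v ⬝ᵥ (hess f x *ᵥ u) := by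
  have h : (hess f x)ᵀ = hess f x := by
    ext i j; exact hess_symm hf j i
  rw [dotProduct_mulVec, ← mulVec_transpose, h, dotProduct_comm]

/-- Linearity in the left slot is plain, because Φ enters there only through ∇Φ. Symmetry comes from
that of L on tangent vectors and from Schwarz's theorem for D. -/
theorem isHessianForm_hessFormL (hΩ : IsOpen Ω) (hA : EnergyDomain Ω A)
    (hV : HasVariations Ω A E D L) (hρA : ρ ∈ A) :
    IsHessianForm Ω E ρ (hessFormL Ω D L ρ) := by
  have hρD := hA.density ρ hρA
  have hρ := hρD.smooth
  have hD := hV.first_regular ρ hρA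
  refine ⟨fun Φ Ψ hΦ hΨ => ?_, fun Φ₁ Φ₂ Ψ h₁ h₂ hΨ => ?_, fun c Φ Ψ hΦ hΨ => ?_, fun Φ hΦ =>
    ⟨exists_geodesic hΩ hρD hΦ, fun ε r φ h => h.hasSecondDerivAtZero hΩ hΦ hA hV hρA⟩⟩
  · unfold hessFormL
    rw [integral_grad_mixedAction hΩ hV hρA hρ hΦ hΨ, integral_grad_mixedAction hΩ hV hρA hρ hΨ hΦ]
    congr 1
    · have := hV.second_symm ρ hρA _ _ (isTangentTest_wDiv hΩ hρ hΨ) (isTangentTest_wDiv hΩ hρ hΦ)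
      simp only [mul_comm (L _ _ _)]
      exact this
    · refine setIntegral_congr_fun hΩ.measurableSet fun x hx => ?_
      simp only [dotProduct_hess_mulVec_comm (hD.contDiffAt (hΩ.mem_nhds hx)) (grad Φ x)]
  · unfold hessFormL
    have hm := mixedAction_continuousOn hΩ hV hρA hρ hΨ
    have hh := continuousOn_hess_mulVec_grad hΩ hD (hΨ.smooth.contDiffOn.of_le (by decide))
    simp only [h₁.grad_add h₂, add_dotProduct, add_mul]
    rw [integral_add (integrableOn_grad_dotProduct_mul hΩ h₁ hm hρ.continuousOn)
        (integrableOn_grad_dotProduct_mul hΩ h₂ hm hρ.continuousOn),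
      integral_add (integrableOn_grad_dotProduct_mul hΩ h₁ hh hρ.continuousOn)
        (integrableOn_grad_dotProduct_mul hΩ h₂ hh hρ.continuousOn)]
    ring
  · unfold hessFormL
    simp only [grad_const_smul, smul_dotProduct, smul_eq_mul, mul_assoc, integral_const_mul]
    ring

theorem HasSecondDerivAtZero.unique {e : ℝ → ℝ} {p q : ℝ} (hp : HasSecondDerivAtZero e p)
    (hq : HasSecondDerivAtZero e q) : p = q := by
  obtain ⟨e₁, h₁, h₁'⟩ := hp
  obtain ⟨e₂, h₂, h₂'⟩ := hq
  refine h₁'.unique (h₂'.congr_of_eventuallyEq ?_)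
  filter_upwards [h₁, h₂] with s hs₁ hs₂ using hs₁.unique hs₂

theorem HasHessianValue.unique {p q : ℝ} (hp : HasHessianValue Ω E ρ Φ p)
    (hq : HasHessianValue Ω E ρ Φ q) : p = q := by
  obtain ⟨ε, r, φ, h⟩ := hp.1
  exact (hp.2 ε r φ h).unique (hq.2 ε r φ h)

/-- Geodesics determine the diagonal, and polarisation the rest. Hence the form whose existence
`HessOpEq` asserts can be taken to be the explicit one. -/
theorem IsHessianForm.unique {Q Q' : (Sp d → ℝ) → (Sp d → ℝ) → ℝ} (h : IsHessianForm Ω E ρ Q)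
    (h' : IsHessianForm Ω E ρ Q') (hΦ : IsTest Ω Φ) (hΨ : IsTest Ω Ψ) : Q Φ Ψ = Q' Φ Ψ := by
  have polar : ∀ {R : (Sp d → ℝ) → (Sp d → ℝ) → ℝ}, IsHessianForm Ω E ρ R →
      R (Φ + Ψ) (Φ + Ψ) = R Φ Φ + 2 * R Φ Ψ + R Ψ Ψ := by
    intro R hR
    rw [hR.add_left _ _ _ hΦ hΨ (hΦ.add hΨ), hR.symm Φ _ hΦ (hΦ.add hΨ),
      hR.symm Ψ _ hΨ (hΦ.add hΨ), hR.add_left _ _ _ hΦ hΨ hΦ, hR.add_left _ _ _ hΦ hΨ hΨ,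
      hR.symm Ψ Φ hΨ hΦ]
    ring
  have e : ∀ Φ, IsTest Ω Φ → Q Φ Φ = Q' Φ Φ := fun Φ hΦ =>
    (h.value Φ hΦ).unique (h'.value Φ hΦ)
  have := e _ (hΦ.add hΨ)
  rw [polar h, polar h', e Φ hΦ, e Ψ hΨ] at this
  linarith

theorem IsHessianForm.congr {Q Q' : (Sp d → ℝ) → (Sp d → ℝ) → ℝ} (h : IsHessianForm Ω E ρ Q)
    (hQ : ∀ Φ Ψ, IsTest Ω Φ → IsTest Ω Ψ → Q' Φ Ψ = Q Φ Ψ) : IsHessianForm Ω E ρ Q' where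
  symm Φ Ψ hΦ hΨ := by rw [hQ Φ Ψ hΦ hΨ, hQ Ψ Φ hΨ hΦ, h.symm Φ Ψ hΦ hΨ]
  add_left Φ₁ Φ₂ Ψ h₁ h₂ hΨ := by
    rw [hQ _ _ (h₁.add h₂) hΨ, hQ _ _ h₁ hΨ, hQ _ _ h₂ hΨ, h.add_left _ _ _ h₁ h₂ hΨ]
  smul_left c Φ Ψ hΦ hΨ := by
    rw [hQ _ _ (hΦ.smul c) hΨ, hQ _ _ hΦ hΨ, h.smul_left c Φ Ψ hΦ hΨ]
  value Φ hΦ := by rw [hQ Φ Φ hΦ hΦ]; exact h.value Φ hΦ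

end HessianForm

/-! ### Limits of gradients in L²(ρ). -/

section EnergyLimits

variable {d : ℕ} {Ω : Set (Sp d)} {ρ Φ : Sp d → ℝ} {φ : ℕ → Sp d → ℝ}

/-- Young's inequality with a free weight l; it plays the role of Cauchy–Schwarz under the integral.
-/
theorem abs_dotProduct_mul_le {u v : Fin d → ℝ} {c l : ℝ} (hc : 0 ≤ c) (hl : 0 < l) :
    |(u ⬝ᵥ v) * c| ≤ l * ((u ⬝ᵥ u) * c) + l⁻¹ * ((v ⬝ᵥ v) * c) := by
  rw [abs_mul, abs_of_nonneg hc, ← mul_assoc, ← mul_assoc, ← add_mul]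
  refine mul_le_mul_of_nonneg_right ?_ hc
  simp only [dotProduct, Finset.mul_sum]
  rw [← Finset.sum_add_distrib]
  refine (Finset.abs_sum_le_sum_abs _ _).trans (Finset.sum_le_sum fun i _ => ?_)
  have h1 : 0 ≤ l * u i ^ 2 := by positivity
  have h2 : 0 ≤ l⁻¹ * v i ^ 2 := by positivity
  have h3 : 0 ≤ (l * u i - v i) ^ 2 * l⁻¹ := by positivity
  have h4 : 0 ≤ (l * u i + v i) ^ 2 * l⁻¹ := by positivity
  have e3 : (l * u i - v i) ^ 2 * l⁻¹ = l * u i ^ 2 + l⁻¹ * v i ^ 2 - 2 * (u i * v i) := by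
    field_simp; ring
  have e4 : (l * u i + v i) ^ 2 * l⁻¹ = l * u i ^ 2 + l⁻¹ * v i ^ 2 + 2 * (u i * v i) := by
    field_simp; ring
  rw [abs_le]
  constructor <;> nlinarith

theorem dotProduct_self_mul_nonneg (u : Fin d → ℝ) {c : ℝ} (hc : 0 ≤ c) : 0 ≤ (u ⬝ᵥ u) * c :=
  mul_nonneg (Finset.sum_nonneg fun _ _ => mul_self_nonneg _) hc

theorem integrableOn_dotProduct_mul_of_sq (hΩ : IsOpen Ω) {U V : Sp d → Fin d → ℝ}
    (hU : ∀ i, ContinuousOn (fun x => U x i) Ω) (hV : ∀ i, ContinuousOn (fun x => V x i) Ω)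
    (hρ : ContinuousOn ρ Ω) (hρ0 : ∀ x, 0 ≤ ρ x)
    (hU2 : IntegrableOn (fun x => (U x ⬝ᵥ U x) * ρ x) Ω)
    (hV2 : IntegrableOn (fun x => (V x ⬝ᵥ V x) * ρ x) Ω) :
    IntegrableOn (fun x => (U x ⬝ᵥ V x) * ρ x) Ω := by
  refine Integrable.mono' ((hU2.const_mul 1).add (hV2.const_mul (1 : ℝ)⁻¹))
    (((continuousOn_dotProduct hU hV).mul hρ).aestronglyMeasurable hΩ.measurableSet)
    (Eventually.of_forall fun x => ?_)
  exact abs_dotProduct_mul_le (hρ0 x) one_pos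

theorem EnergyTendsto.eventually_integrableOn (hΩ : IsOpen Ω) (hρ : Density Ω ρ)
    (hΦ : ContDiffOn ℝ 1 Φ Ω) (hφ : ∀ n, IsTest Ω (φ n)) (h : EnergyTendsto Ω ρ φ Φ) :
    (∀ᶠ n in atTop, IntegrableOn
      (fun x => ((grad Φ x - grad (φ n) x) ⬝ᵥ (grad Φ x - grad (φ n) x)) * ρ x) Ω) ∧
    Tendsto (fun n => ∫ x in Ω,
      ((grad Φ x - grad (φ n) x) ⬝ᵥ (grad Φ x - grad (φ n) x)) * ρ x) atTop (𝓝 0) := by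
  have hm : ∀ n, AEStronglyMeasurable
      (fun x => ((grad Φ x - grad (φ n) x) ⬝ᵥ (grad Φ x - grad (φ n) x)) * ρ x)
      (volume.restrict Ω) := fun n => by
    have hc : ∀ i, ContinuousOn (fun x => (grad Φ x - grad (φ n) x) i) Ω := fun i =>
      (pd_continuousOn hΩ hΦ i).sub ((hφ n).pd_continuous i).continuousOn
    exact ((continuousOn_dotProduct hc hc).mul hρ.smooth.continuousOn).aestronglyMeasurable
      hΩ.measurableSet
  have hnn : ∀ n, 0 ≤ᵐ[volume.restrict Ω]
      fun x => ((grad Φ x - grad (φ n) x) ⬝ᵥ (grad Φ x - grad (φ n) x)) * ρ x := fun n =>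
    Eventually.of_forall fun x => dotProduct_self_mul_nonneg _ (hρ.nonneg x)
  constructor
  · filter_upwards [h.eventually_lt_const ENNReal.zero_lt_top] with n hn
    exact ⟨hm n, (hasFiniteIntegral_iff_ofReal (hnn n)).2 hn⟩
  · have := (ENNReal.tendsto_toReal ENNReal.zero_ne_top).comp h
    refine this.congr fun n => ?_
    rw [integral_eq_lintegral_of_nonneg_ae (hnn n) (hm n)]
    rfl

/-- Weak continuity: pairing with a fixed field V in L²(ρ) is continuous for the energy norm.
Integrability for Φ itself follows by adding a single approximation back. -/
theorem EnergyTendsto.integrableOn_and_tendsto (hΩ : IsOpen Ω) (hρ : Density Ω ρ)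
    (hΦ : ContDiffOn ℝ 1 Φ Ω) (hφ : ∀ n, IsTest Ω (φ n)) (h : EnergyTendsto Ω ρ φ Φ)
    {V : Sp d → Fin d → ℝ} (hV : ∀ i, ContinuousOn (fun x => V x i) Ω)
    (hV2 : IntegrableOn (fun x => (V x ⬝ᵥ V x) * ρ x) Ω) :
    IntegrableOn (fun x => (grad Φ x ⬝ᵥ V x) * ρ x) Ω ∧
    Tendsto (fun n => ∫ x in Ω, (grad (φ n) x ⬝ᵥ V x) * ρ x) atTop
      (𝓝 (∫ x in Ω, (grad Φ x ⬝ᵥ V x) * ρ x)) := by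
  obtain ⟨hint, hlim⟩ := h.eventually_integrableOn hΩ hρ hΦ hφ
  have hρc := hρ.smooth.continuousOn
  have hc : ∀ n, ∀ i, ContinuousOn (fun x => (grad Φ x - grad (φ n) x) i) Ω := fun n i =>
    (pd_continuousOn hΩ hΦ i).sub ((hφ n).pd_continuous i).continuousOn
  have htest : ∀ n, IntegrableOn (fun x => (grad (φ n) x ⬝ᵥ V x) * ρ x) Ω := fun n =>
    integrableOn_grad_dotProduct_mul hΩ (hφ n) hV hρc
  have hdiff : ∀ᶠ n in atTop, IntegrableOn
      (fun x => ((grad Φ x - grad (φ n) x) ⬝ᵥ V x) * ρ x) Ω := by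
    filter_upwards [hint] with n hn
    exact integrableOn_dotProduct_mul_of_sq hΩ (hc n) hV hρc hρ.nonneg hn hV2
  have hI : IntegrableOn (fun x => (grad Φ x ⬝ᵥ V x) * ρ x) Ω := by
    obtain ⟨n, hn⟩ := hdiff.exists
    refine (hn.add (htest n)).congr (Eventually.of_forall fun x => ?_)
    simp only [sub_dotProduct]
    simp
    ring
  refine ⟨hI, ?_⟩
  rw [Metric.tendsto_atTop']
  intro ε hε
  set B := ∫ x in Ω, (V x ⬝ᵥ V x) * ρ x with hB
  have hB0 : 0 ≤ B := integral_nonneg fun x => dotProduct_self_mul_nonneg _ (hρ.nonneg x)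
  -- Chosen so that the V-part of Young's inequality stays below ε/2; the added 1 covers B = 0. The
  -- gradient part is then made small by taking n large.
  set l : ℝ := 2 * (B + 1) / ε with hl
  have hlpos : 0 < l := by positivity
  have hlB : l⁻¹ * B < ε / 2 := by
    rw [hl, inv_div, div_mul_eq_mul_div, div_lt_iff₀ (by positivity)]
    nlinarith
  have hsmall := hlim.eventually_lt_const (show 0 < l⁻¹ * (ε / 2) by positivity)
  obtain ⟨N, hN⟩ := eventually_atTop.1 (hsmall.and (hint.and hdiff))
  refine ⟨N, fun n hn => ?_⟩
  obtain ⟨h1, h2, h3⟩ := hN n hn.le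
  rw [dist_comm, Real.dist_eq, ← integral_sub hI (htest n)]
  have e : ∀ x, (grad Φ x ⬝ᵥ V x) * ρ x - (grad (φ n) x ⬝ᵥ V x) * ρ x =
      ((grad Φ x - grad (φ n) x) ⬝ᵥ V x) * ρ x := fun x => by rw [sub_dotProduct]; ring
  simp only [e]
  calc |∫ x in Ω, ((grad Φ x - grad (φ n) x) ⬝ᵥ V x) * ρ x|
      ≤ ∫ x in Ω, |((grad Φ x - grad (φ n) x) ⬝ᵥ V x) * ρ x| := abs_integral_le_integral_abs
    _ ≤ ∫ x in Ω, (l * (((grad Φ x - grad (φ n) x) ⬝ᵥ (grad Φ x - grad (φ n) x)) * ρ x) +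
          l⁻¹ * ((V x ⬝ᵥ V x) * ρ x)) :=
        integral_mono h3.abs ((h2.const_mul l).add (hV2.const_mul l⁻¹))
          fun x => abs_dotProduct_mul_le (hρ.nonneg x) hlpos
    _ = l * (∫ x in Ω, ((grad Φ x - grad (φ n) x) ⬝ᵥ (grad Φ x - grad (φ n) x)) * ρ x) +
          l⁻¹ * B := by
        rw [integral_add (h2.const_mul l) (hV2.const_mul l⁻¹), integral_const_mul,
          integral_const_mul]
    _ < l * (l⁻¹ * (ε / 2)) + ε / 2 := by gcongr
    _ = ε := by rw [mul_inv_cancel_left₀ hlpos.ne']; ring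

/-- One approximating test function φ suffices, by |∇Φ|² ≤ 2|∇Φ - ∇φ|² + 2|∇φ|². -/
theorem IsPotential.integrableOn_sq (hΩ : IsOpen Ω) (hρ : Density Ω ρ) (h : IsPotential Ω ρ Φ) :
    IntegrableOn (fun x => (grad Φ x ⬝ᵥ grad Φ x) * ρ x) Ω := by
  obtain ⟨hΦ, φ, hφ, hE⟩ := h
  have hΦ1 : ContDiffOn ℝ 1 Φ Ω := hΦ.of_le (by decide)
  have hc : ∀ i, ContinuousOn (fun x => grad Φ x i) Ω := fun i => pd_continuousOn hΩ hΦ1 i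
  obtain ⟨n, hn⟩ := (hE.eventually_integrableOn hΩ hρ hΦ1 hφ).1.exists
  have ht : IntegrableOn (fun x => (grad (φ n) x ⬝ᵥ grad (φ n) x) * ρ x) Ω :=
    integrableOn_grad_dotProduct_mul hΩ (hφ n) (fun i => ((hφ n).pd_continuous i).continuousOn)
      hρ.smooth.continuousOn
  refine Integrable.mono' ((hn.const_mul 2).add (ht.const_mul 2))
    (((continuousOn_dotProduct hc hc).mul hρ.smooth.continuousOn).aestronglyMeasurable
      hΩ.measurableSet) (Eventually.of_forall fun x => ?_)
  rw [Real.norm_of_nonneg (dotProduct_self_mul_nonneg _ (hρ.nonneg x))]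
  simp only [Pi.add_apply]
  rw [← mul_assoc, ← mul_assoc, ← add_mul]
  refine mul_le_mul_of_nonneg_right ?_ (hρ.nonneg x)
  simp only [dotProduct, Finset.mul_sum]
  rw [← Finset.sum_add_distrib]
  refine Finset.sum_le_sum fun i _ => ?_
  simp only [Pi.sub_apply]
  nlinarith [sq_nonneg (grad Φ x i - 2 * grad (φ n) x i)]

end EnergyLimits

/-! ### Newton's flows of a general functional. -/

section NewtonFlow

variable {d : ℕ} {Ω : Set (Sp d)} {A : Set (Sp d → ℝ)} {E : (Sp d → ℝ) → ℝ}
  {D : (Sp d → ℝ) → Sp d → ℝ} {L : (Sp d → ℝ) → (Sp d → ℝ) → Sp d → ℝ} {ρ Φ : Sp d → ℝ}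

/-- For fixed Ψ both terms pair the gradient in the left slot with a field in L²(ρ): the first by
`MixedL2`, the second because ∇Ψ has compact support. -/
theorem tendsto_hessFormL (hΩ : IsOpen Ω) (hA : EnergyDomain Ω A) (hV : HasVariations Ω A E D L)
    (hρA : ρ ∈ A) (hM : MixedL2 Ω L ρ) (hΦ : ContDiffOn ℝ 1 Φ Ω) {φ : ℕ → Sp d → ℝ}
    (hφ : ∀ n, IsTest Ω (φ n)) (h : EnergyTendsto Ω ρ φ Φ) {Ψ : Sp d → ℝ} (hΨ : IsTest Ω Ψ) :
    Tendsto (fun n => hessFormL Ω D L ρ (φ n) Ψ) atTop (𝓝 (hessFormL Ω D L ρ Φ Ψ)) := by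
  have hρ := hA.density ρ hρA
  have hc := continuousOn_hess_mulVec_grad hΩ (hV.first_regular ρ hρA)
    (hΨ.smooth.contDiffOn.of_le (by decide))
  refine (h.integrableOn_and_tendsto hΩ hρ hΦ hφ
    (mixedAction_continuousOn hΩ hV hρA hρ.smooth hΨ) (hM Ψ hΨ)).2.add
    (h.integrableOn_and_tendsto hΩ hρ hΦ hφ hc ?_).2
  refine integrableOn_of_zero_off hΩ ((continuousOn_dotProduct hc hc).mul hρ.smooth.continuousOn)
    hΨ.isCompact hΨ.support fun y _ hy => ?_
  rw [hΨ.grad_zero_off hy, mulVec_zero, zero_dotProduct, zero_mul]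

theorem hessOpEq_iff (hΩ : IsOpen Ω) (hA : EnergyDomain Ω A) (hV : HasVariations Ω A E D L)
    (hρA : ρ ∈ A) (hM : MixedL2 Ω L ρ) (hΦ : IsPotential Ω ρ Φ) {η : Sp d → ℝ}
    (hη : ContinuousOn η Ω) :
    HessOpEq Ω E ρ Φ η ↔
      ∀ Ψ, IsTest Ω Ψ → hessFormL Ω D L ρ Φ Ψ = ∫ x in Ω, Ψ x * η x := by
  have hΦ1 : ContDiffOn ℝ 1 Φ Ω := hΦ.1.of_le (by decide)
  constructor
  · rintro ⟨-, Q, hQ, hlim⟩ Ψ hΨ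
    -- A potential has at least one approximating sequence, so the limit prescribed by `HessOpEq`
    -- can be compared with the limit of the explicit form.
    obtain ⟨-, φ, hφ, hE⟩ := hΦ
    refine tendsto_nhds_unique (tendsto_hessFormL hΩ hA hV hρA hM hΦ1 hφ hE hΨ)
      ((hlim Ψ hΨ φ hφ hE).congr fun n => ?_)
    exact hQ.unique (isHessianForm_hessFormL hΩ hA hV hρA) (hφ n) hΨ
  · intro h
    refine ⟨hη, _, isHessianForm_hessFormL hΩ hA hV hρA, fun Ψ hΨ φ hφ hE => ?_⟩
    rw [← h Ψ hΨ]
    exact tendsto_hessFormL hΩ hA hV hρA hM hΦ1 hφ hE hΨ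

theorem continuousOn_wDiv_first (hΩ : IsOpen Ω) (hA : EnergyDomain Ω A)
    (hV : HasVariations Ω A E D L) (hρA : ρ ∈ A) : ContinuousOn (wDiv ρ (D ρ)) Ω :=
  (wDiv_contDiffOn hΩ (l := 0) (hA.density ρ hρA).smooth (hV.first_regular ρ hρA)
    (by decide) (by norm_num)).continuousOn

theorem isNewtonFlow_iff (hΩ : IsOpen Ω) (hA : EnergyDomain Ω A) (hV : HasVariations Ω A E D L)
    {J : Set ℝ} {r : ℝ → Sp d → ℝ} (hr : ∀ t ∈ J, r t ∈ A ∧ MixedL2 Ω L (r t)) :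
    IsNewtonFlow Ω E D J r ↔
      ∃ Φ : ℝ → Sp d → ℝ, FlowEquation Ω J r Φ ∧
        ∀ t ∈ J, ∀ Ψ, IsTest Ω Ψ →
          hessFormL Ω D L (r t) (Φ t) Ψ = ∫ x in Ω, Ψ x * wDiv (r t) (D (r t)) x := by
  have hη : ∀ t, (fun x => -wGrad D (r t) x) = wDiv (r t) (D (r t)) := fun t => by
    funext x; simp [wGrad]
  have hiff : ∀ t ∈ J, ∀ Φ, IsPotential Ω (r t) Φ →
      (HessOpEq Ω E (r t) Φ (fun x => -wGrad D (r t) x) ↔ ∀ Ψ, IsTest Ω Ψ →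
        hessFormL Ω D L (r t) Φ Ψ = ∫ x in Ω, Ψ x * wDiv (r t) (D (r t)) x) := by
    intro t ht Φ hΦ
    rw [hη]
    exact hessOpEq_iff hΩ hA hV (hr t ht).1 (hr t ht).2 hΦ
      (continuousOn_wDiv_first hΩ hA hV (hr t ht).1)
  constructor
  · intro h
    choose! σ hσ hH using h
    choose! Φ hΦ using hH
    refine ⟨Φ, fun t ht => ⟨(hΦ t ht).1, fun x hx => ?_⟩, fun t ht =>
      (hiff t ht _ (hΦ t ht).1).1 (hΦ t ht).2.2⟩
    rw [← (hΦ t ht).2.1 x hx]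
    exact hσ t ht x hx
  · rintro ⟨Φ, hF, hH⟩ t ht
    exact ⟨fun x => -wDiv (r t) (Φ t) x, (hF t ht).2, Φ t, (hF t ht).1, fun _ _ => rfl,
      (hiff t ht _ (hF t ht).1).2 (hH t ht)⟩

end NewtonFlow

end WassersteinNewton

namespace WassersteinNewton

/-! ### Differentiation under the integral sign. -/

section ParametricIntegrals

variable {d : ℕ} {Ω K : Set (Sp d)} {F : Sp d → Sp d → ℝ} {f : Sp d → ℝ}

theorem hasFDerivAt_left {x y : Sp d}
    (h : DifferentiableAt ℝ (fun p : Sp d × Sp d => F p.1 p.2) (x, y)) :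
    HasFDerivAt (fun x' => F x' y) ((fderiv ℝ (fun p : Sp d × Sp d => F p.1 p.2) (x, y)).comp
      (ContinuousLinearMap.inl ℝ (Sp d) (Sp d))) x :=
  HasFDerivAt.comp x (g := fun p : Sp d × Sp d => F p.1 p.2) (f := fun x' => (x', y))
    h.hasFDerivAt (hasFDerivAt_prodMk_left x y)

theorem hasFDerivAt_right {x y : Sp d}
    (h : DifferentiableAt ℝ (fun p : Sp d × Sp d => F p.1 p.2) (x, y)) :
    HasFDerivAt (F x) ((fderiv ℝ (fun p : Sp d × Sp d => F p.1 p.2) (x, y)).comp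
      (ContinuousLinearMap.inr ℝ (Sp d) (Sp d))) y :=
  HasFDerivAt.comp y (g := fun p : Sp d × Sp d => F p.1 p.2) h.hasFDerivAt
    (hasFDerivAt_prodMk_right x y)

theorem differentiableAt_of_contDiffOn_prod (hΩ : IsOpen Ω) {n : WithTop ℕ∞} (hn : n ≠ 0)
    (hF : ContDiffOn ℝ n (fun p : Sp d × Sp d => F p.1 p.2) (Ω ×ˢ Ω)) {x y : Sp d} (hx : x ∈ Ω)
    (hy : y ∈ Ω) : DifferentiableAt ℝ (fun p : Sp d × Sp d => F p.1 p.2) (x, y) :=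
  (hF.contDiffAt ((hΩ.prod hΩ).mem_nhds (mk_mem_prod hx hy))).differentiableAt hn

theorem contDiffOn_left {n : WithTop ℕ∞}
    (hF : ContDiffOn ℝ n (fun p : Sp d × Sp d => F p.1 p.2) (Ω ×ˢ Ω)) {y : Sp d} (hy : y ∈ Ω) :
    ContDiffOn ℝ n (fun x => F x y) Ω :=
  hF.comp (contDiffOn_id.prodMk contDiffOn_const) fun _ hx => mk_mem_prod hx hy

theorem contDiffOn_right {n : WithTop ℕ∞}
    (hF : ContDiffOn ℝ n (fun p : Sp d × Sp d => F p.1 p.2) (Ω ×ˢ Ω)) {x : Sp d} (hx : x ∈ Ω) :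
    ContDiffOn ℝ n (F x) Ω :=
  hF.comp (contDiffOn_const.prodMk contDiffOn_id) fun _ hy => mk_mem_prod hx hy

theorem contDiffOn_pd_left (hΩ : IsOpen Ω) {m n : WithTop ℕ∞}
    (hF : ContDiffOn ℝ n (fun p : Sp d × Sp d => F p.1 p.2) (Ω ×ˢ Ω)) (hmn : m + 1 ≤ n)
    (i : Fin d) :
    ContDiffOn ℝ m (fun p : Sp d × Sp d => pd i (fun x' => F x' p.2) p.1) (Ω ×ˢ Ω) := by
  have hn : n ≠ 0 := by
    rintro rfl
    simp at hmn
  refine ((hF.fderiv_of_isOpen (hΩ.prod hΩ) hmn).clm_apply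
    (contDiffOn_const (c := ((EuclideanSpace.single i 1 : Sp d), (0 : Sp d))))).congr
    fun p hp => ?_
  rw [pd, (hasFDerivAt_left (differentiableAt_of_contDiffOn_prod hΩ hn hF hp.1 hp.2)).fderiv]
  simp

theorem contDiffOn_pd_right (hΩ : IsOpen Ω) {m n : WithTop ℕ∞}
    (hF : ContDiffOn ℝ n (fun p : Sp d × Sp d => F p.1 p.2) (Ω ×ˢ Ω)) (hmn : m + 1 ≤ n)
    (i : Fin d) :
    ContDiffOn ℝ m (fun p : Sp d × Sp d => pd i (F p.1) p.2) (Ω ×ˢ Ω) := by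
  have hn : n ≠ 0 := by
    rintro rfl
    simp at hmn
  refine ((hF.fderiv_of_isOpen (hΩ.prod hΩ) hmn).clm_apply
    (contDiffOn_const (c := ((0 : Sp d), (EuclideanSpace.single i 1 : Sp d))))).congr
    fun p hp => ?_
  rw [pd, (hasFDerivAt_right (differentiableAt_of_contDiffOn_prod hΩ hn hF hp.1 hp.2)).fderiv]
  simp

/-- The `x`-derivatives of `F(x,y) f(y)` up to order `n` are, locally uniformly in `x`, bounded by
integrable functions of `y`. -/
def DominatedDerivs (Ω : Set (Sp d)) (n : ℕ) (F : Sp d → Sp d → ℝ) (f : Sp d → ℝ) : Prop :=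
  ∀ m ≤ n, ∀ K : Set (Sp d), IsCompact K → K ⊆ Ω → ∃ b : Sp d → ℝ, IntegrableOn b Ω ∧
    ∀ x ∈ K, ∀ y ∈ Ω, ‖iteratedFDeriv ℝ m (fun x' => F x' y) x‖ * |f y| ≤ b y

theorem DominatedDerivs.mono {m n : ℕ} (h : DominatedDerivs Ω n F f) (hmn : m ≤ n) :
    DominatedDerivs Ω m F f := fun k hk => h k (hk.trans hmn)

/-- A partial derivative is the differential evaluated on a unit vector, which does not increase
norms; the same bounds serve one order lower. -/
theorem DominatedDerivs.pd (hΩ : IsOpen Ω) {n : ℕ} (h : DominatedDerivs Ω (n + 1) F f)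
    (hF : ContDiffOn ℝ (n + 1 : ℕ) (fun p : Sp d × Sp d => F p.1 p.2) (Ω ×ˢ Ω)) (i : Fin d) :
    DominatedDerivs Ω n (fun x y => pd i (fun x' => F x' y) x) f := by
  intro m hm K hK hKΩ
  obtain ⟨b, hb, hle⟩ := h (m + 1) (by omega) K hK hKΩ
  refine ⟨b, hb, fun x hx y hy => le_trans ?_ (hle x hx y hy)⟩
  refine mul_le_mul_of_nonneg_right ?_ (abs_nonneg _)
  have hc : ContDiffAt ℝ n (fderiv ℝ (fun x' => F x' y)) x :=
    ((contDiffOn_left hF hy).contDiffAt (hΩ.mem_nhds (hKΩ hx))).fderiv_right (by norm_cast)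
  have := (ContinuousLinearMap.apply ℝ ℝ
    (EuclideanSpace.single i 1 : Sp d)).norm_iteratedFDeriv_comp_left hc (n := m)
    (by exact_mod_cast hm)
  rw [norm_iteratedFDeriv_fderiv] at this
  refine this.trans (mul_le_of_le_one_left (norm_nonneg _) ?_)
  refine ContinuousLinearMap.opNorm_le_bound _ zero_le_one fun T => ?_
  have := T.le_opNorm (EuclideanSpace.single i 1 : Sp d)
  simpa using this

theorem exists_closedBall_subset (hΩ : IsOpen Ω) {x : Sp d} (hx : x ∈ Ω) :
    ∃ ε > 0, Metric.closedBall x ε ⊆ Ω :=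
  Metric.nhds_basis_closedBall.mem_iff.1 (hΩ.mem_nhds hx)

theorem continuousOn_integral_of_dominated (hΩ : IsOpen Ω)
    (hF : ContinuousOn (fun p : Sp d × Sp d => F p.1 p.2) (Ω ×ˢ Ω)) (hf : ContinuousOn f Ω)
    (h : DominatedDerivs Ω 0 F f) : ContinuousOn (fun x => ∫ y in Ω, F x y * f y) Ω := by
  intro x hx
  obtain ⟨ε, hε, hball⟩ := exists_closedBall_subset hΩ hx
  obtain ⟨b, hb, hle⟩ := h 0 le_rfl _ (isCompact_closedBall x ε) hball
  refine ContinuousAt.continuousWithinAt ?_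
  have hnhds := Metric.closedBall_mem_nhds x hε
  refine MeasureTheory.continuousAt_of_dominated (bound := b) ?_ ?_ hb ?_
  · filter_upwards [hnhds] with z hz
    exact ((hF.comp (continuousOn_const.prodMk continuousOn_id) fun y hy =>
      mk_mem_prod (hball hz) hy).mul hf).aestronglyMeasurable hΩ.measurableSet
  · filter_upwards [hnhds] with z hz
    filter_upwards [ae_restrict_mem hΩ.measurableSet] with y hy
    simpa [abs_mul] using hle z hz y hy
  · filter_upwards [ae_restrict_mem hΩ.measurableSet] with y hy
    refine ContinuousAt.mul ?_ continuousAt_const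
    exact (hF.comp (continuousOn_id.prodMk continuousOn_const) fun z hz =>
      mk_mem_prod hz hy).continuousAt (hΩ.mem_nhds hx)

theorem DominatedDerivs.integrableOn (hΩ : IsOpen Ω) {n : ℕ} (h : DominatedDerivs Ω n F f)
    (hF : ContinuousOn (fun p : Sp d × Sp d => F p.1 p.2) (Ω ×ˢ Ω)) (hf : ContinuousOn f Ω)
    {x : Sp d} (hx : x ∈ Ω) : IntegrableOn (fun y => F x y * f y) Ω := by
  obtain ⟨b, hb, hle⟩ := h 0 (Nat.zero_le _) _ isCompact_singleton (singleton_subset_iff.2 hx)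
  refine Integrable.mono' hb (((hF.comp (continuousOn_const.prodMk continuousOn_id) fun y hy =>
      mk_mem_prod hx hy).mul hf).aestronglyMeasurable hΩ.measurableSet) ?_
  filter_upwards [ae_restrict_mem hΩ.measurableSet] with y hy
  simpa [abs_mul] using hle x rfl y hy

theorem hasFDerivAt_integral_mul (hΩ : IsOpen Ω)
    (hF : ContDiffOn ℝ 1 (fun p : Sp d × Sp d => F p.1 p.2) (Ω ×ˢ Ω)) (hf : ContinuousOn f Ω)
    (h : DominatedDerivs Ω 1 F f) {x : Sp d} (hx : x ∈ Ω) :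
    IntegrableOn (fun y => f y • fderiv ℝ (fun x' => F x' y) x) Ω ∧
    HasFDerivAt (fun x => ∫ y in Ω, F x y * f y)
      (∫ y in Ω, f y • fderiv ℝ (fun x' => F x' y) x) x := by
  obtain ⟨ε, hε, hball⟩ := exists_closedBall_subset hΩ hx
  obtain ⟨b, hb, hle⟩ := h 1 le_rfl _ (isCompact_closedBall x ε) hball
  have hnhds := Metric.closedBall_mem_nhds x hε
  have hFc := hF.continuousOn
  have hd : ∀ z ∈ Ω, ∀ y ∈ Ω, DifferentiableAt ℝ (fun p : Sp d × Sp d => F p.1 p.2) (z, y) :=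
    fun z hz y hy => differentiableAt_of_contDiffOn_prod hΩ one_ne_zero hF hz hy
  have hbound : ∀ᵐ y ∂volume.restrict Ω, ∀ z ∈ Metric.closedBall x ε,
      ‖f y • fderiv ℝ (fun x' => F x' y) z‖ ≤ b y := by
    filter_upwards [ae_restrict_mem hΩ.measurableSet] with y hy z hz
    have := hle z hz y hy
    rw [norm_iteratedFDeriv_one] at this
    rwa [norm_smul, Real.norm_eq_abs, mul_comm]
  have hmeas : AEStronglyMeasurable (fun y => f y • fderiv ℝ (fun x' => F x' y) x)
      (volume.restrict Ω) := by
    refine ContinuousOn.aestronglyMeasurable ?_ hΩ.measurableSet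
    refine hf.smul ?_
    have h1 : ContinuousOn (fun y => (fderiv ℝ (fun p : Sp d × Sp d => F p.1 p.2) (x, y)).comp
        (ContinuousLinearMap.inl ℝ (Sp d) (Sp d))) Ω :=
      (((hF.fderiv_of_isOpen (hΩ.prod hΩ) (m := 0) (by simp)).continuousOn.comp
        (continuousOn_const.prodMk continuousOn_id) fun y hy => mk_mem_prod hx hy)).clm_comp
        continuousOn_const
    exact h1.congr fun y hy => (hasFDerivAt_left (hd x hx y hy)).fderiv
  refine ⟨Integrable.mono' hb hmeas (hbound.mono fun y hy =>
    hy x (Metric.mem_closedBall_self hε.le)), ?_⟩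
  refine hasFDerivAt_integral_of_dominated_of_fderiv_le (bound := b)
    (F' := fun z y => f y • fderiv ℝ (fun x' => F x' y) z) hnhds ?_
    ((h.integrableOn hΩ hFc hf hx)) hmeas hbound hb ?_
  · filter_upwards [hnhds] with z hz
    exact ((hFc.comp (continuousOn_const.prodMk continuousOn_id) fun y hy =>
      mk_mem_prod (hball hz) hy).mul hf).aestronglyMeasurable hΩ.measurableSet
  · filter_upwards [ae_restrict_mem hΩ.measurableSet] with y hy z hz
    exact ((hasFDerivAt_left (hd z (hball hz) y hy)).differentiableAt.hasFDerivAt).mul_const (f y)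

theorem pd_integral_mul (hΩ : IsOpen Ω)
    (hF : ContDiffOn ℝ 1 (fun p : Sp d × Sp d => F p.1 p.2) (Ω ×ˢ Ω)) (hf : ContinuousOn f Ω)
    (h : DominatedDerivs Ω 1 F f) {x : Sp d} (hx : x ∈ Ω) (i : Fin d) :
    pd i (fun x => ∫ y in Ω, F x y * f y) x = ∫ y in Ω, pd i (fun x' => F x' y) x * f y := by
  obtain ⟨hint, hd⟩ := hasFDerivAt_integral_mul hΩ hF hf h hx
  rw [pd, hd.fderiv, ContinuousLinearMap.integral_apply hint]
  simp [pd, mul_comm]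

/-- Induction on n: each partial derivative is again an integral of this type, with ∂ᵢF in place of
F, so F has to vary. -/
theorem contDiffOn_integral_mul (hΩ : IsOpen Ω) (hf : ContinuousOn f Ω) (n : ℕ) :
    ∀ {F : Sp d → Sp d → ℝ},
    ContDiffOn ℝ n (fun p : Sp d × Sp d => F p.1 p.2) (Ω ×ˢ Ω) → DominatedDerivs Ω n F f →
    ContDiffOn ℝ n (fun x => ∫ y in Ω, F x y * f y) Ω := by
  induction n with
  | zero =>
    intro F hF h
    exact_mod_cast contDiffOn_zero.2 (continuousOn_integral_of_dominated hΩ hF.continuousOn hf h)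
  | succ n ih =>
    intro F hF h
    have hF1 : ContDiffOn ℝ 1 (fun p : Sp d × Sp d => F p.1 p.2) (Ω ×ˢ Ω) :=
      hF.of_le (by exact_mod_cast Nat.le_add_left 1 n)
    have h1 := h.mono (Nat.le_add_left 1 n)
    refine contDiffOn_succ_of_pd hΩ (fun x hx => (hasFDerivAt_integral_mul hΩ hF1 hf h1
      hx).2.differentiableAt.differentiableWithinAt) fun i => ?_
    refine (ih (contDiffOn_pd_left hΩ hF (by norm_cast) i) (h.pd hΩ hF i)).congr fun x hx => ?_
    exact pd_integral_mul hΩ hF1 hf h1 hx i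

theorem norm_iteratedFDeriv_prodMk_le (x y : Sp d) {m : ℕ} (hm : 1 ≤ m) :
    ‖iteratedFDeriv ℝ m (fun x' : Sp d => (x', y)) x‖ ≤ 1 := by
  obtain ⟨k, rfl⟩ := Nat.exists_eq_add_of_le' hm
  have h : fderiv ℝ (fun x' : Sp d => (x', y)) =
      fun _ => ContinuousLinearMap.inl ℝ (Sp d) (Sp d) :=
    funext fun x => (hasFDerivAt_prodMk_left x y).fderiv
  rw [← norm_iteratedFDeriv_fderiv, h]
  rcases k with _ | k
  · rw [norm_iteratedFDeriv_zero]
    refine ContinuousLinearMap.opNorm_le_bound _ zero_le_one fun v => ?_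
    simp [Prod.norm_def]
  · rw [iteratedFDeriv_succ_const]; simp

/-- The joint derivatives are bounded on K × K' by compactness. Freezing y is composition with x' ↦
(x', y), whose derivatives of positive order have norm at most 1, so the bound for compositions
applies. -/
theorem exists_bound_iteratedFDeriv_left (hΩ : IsOpen Ω) {m : ℕ}
    (hF : ContDiffOn ℝ m (fun p : Sp d × Sp d => F p.1 p.2) (Ω ×ˢ Ω)) (hK : IsCompact K)
    (hKΩ : K ⊆ Ω) {K' : Set (Sp d)} (hK' : IsCompact K') (hKΩ' : K' ⊆ Ω) :
    ∃ C, 0 ≤ C ∧ ∀ x ∈ K, ∀ y ∈ K', ‖iteratedFDeriv ℝ m (fun x' => F x' y) x‖ ≤ C := by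
  have hO := hΩ.prod hΩ
  have hex : ∀ i ≤ m, ∃ C, ∀ p ∈ K ×ˢ K',
      ‖iteratedFDerivWithin ℝ i (fun p : Sp d × Sp d => F p.1 p.2) (Ω ×ˢ Ω) p‖ ≤ C := fun i hi =>
    (hK.prod hK').exists_bound_of_continuousOn
      ((hF.continuousOn_iteratedFDerivWithin (by exact_mod_cast hi) hO.uniqueDiffOn).mono
        (prod_mono hKΩ hKΩ'))
  choose! C hC using hex
  -- The composition bound has the form m! · C · Dᵐ: the sum dominates the bounds of all orders up
  -- to m at once, and D = 1.
  refine ⟨m.factorial * (∑ i ∈ Finset.range (m + 1), |C i|) * 1 ^ m, by positivity,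
    fun x hx y hy => ?_⟩
  rw [← iteratedFDerivWithin_of_isOpen m hΩ (hKΩ hx)]
  refine norm_iteratedFDerivWithin_comp_le (g := fun p : Sp d × Sp d => F p.1 p.2)
    (f := fun x' => (x', y)) (t := Ω ×ˢ Ω) (N := m) hF
    (contDiffOn_id.prodMk contDiffOn_const) le_rfl hO.uniqueDiffOn hΩ.uniqueDiffOn
    (fun z hz => mk_mem_prod hz (hKΩ' hy)) (hKΩ hx) (fun i hi => ?_) fun i hi _ => ?_
  · exact (hC i hi _ (mk_mem_prod hx hy)).trans ((le_abs_self _).trans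
      (Finset.single_le_sum (f := fun i => |C i|) (fun _ _ => abs_nonneg _)
        (Finset.mem_range.2 (by omega))))
  · rw [iteratedFDerivWithin_of_isOpen i hΩ (hKΩ hx), one_pow]
    exact norm_iteratedFDeriv_prodMk_le x y hi

theorem dominatedDerivs_of_zero_off (hΩ : IsOpen Ω) {n : ℕ}
    (hF : ContDiffOn ℝ n (fun p : Sp d × Sp d => F p.1 p.2) (Ω ×ˢ Ω)) (hf : ContinuousOn f Ω)
    (hK : IsCompact K) (hKΩ : K ⊆ Ω) (h0 : ∀ y ∈ Ω, y ∉ K → f y = 0) :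
    DominatedDerivs Ω n F f := by
  intro m hm K' hK' hKΩ'
  obtain ⟨C, hC, hle⟩ := exists_bound_iteratedFDeriv_left hΩ
    (hF.of_le (m := m) (by exact_mod_cast hm)) hK' hKΩ' hK hKΩ
  refine ⟨fun y => C * |f y|, ?_, fun x hx y hy => ?_⟩
  · exact ((integrableOn_of_zero_off hΩ hf hK hKΩ h0).abs.const_mul C)
  · by_cases hyK : y ∈ K
    · exact mul_le_mul_of_nonneg_right (hle x hx y hyK) (abs_nonneg _)
    · simp [h0 y hy hyK]

end ParametricIntegrals

/-! ### Second variations given by C² kernels. -/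

section Kernels

variable {d : ℕ} {Ω : Set (Sp d)} {k : (Sp d → ℝ) → Sp d → Sp d → ℝ}
  {D : (Sp d → ℝ) → Sp d → ℝ} {ρ Φ Ψ : Sp d → ℝ}

/-- Integration by parts in y moves the divergence onto the kernel as -∂_y. Differentiating under
the integral in x, and the minus sign in `mixedAction`, then give the literal mixed Hessian. -/
theorem mixedAction_kernelOp (hΩ : IsOpen Ω) (hρ : ContDiffOn ℝ ∞ ρ Ω)
    (hk : ContDiffOn ℝ 2 (fun p : Sp d × Sp d => k ρ p.1 p.2) (Ω ×ˢ Ω)) (hΨ : IsTest Ω Ψ)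
    {x : Sp d} (hx : x ∈ Ω) (i : Fin d) :
    mixedAction (kernelOp Ω k) ρ Ψ x i =
      ∫ y in Ω, (mixedHess (k ρ) x y *ᵥ grad Ψ y) i * ρ y := by
  have hΨ' : ∀ j, ∀ y ∉ tsupport Ψ, pd j Ψ y * ρ y = 0 := fun j y hy => by
    have := congrFun (hΨ.grad_zero_off hy) j
    rw [show pd j Ψ y = 0 from this, zero_mul]
  have hw : ∀ j, ContinuousOn (fun y => pd j Ψ y * ρ y) Ω := fun j =>
    (hΨ.pd_continuous j).continuousOn.mul hρ.continuousOn
  have hkj : ∀ j, ContDiffOn ℝ 1 (fun p : Sp d × Sp d => pd j (k ρ p.1) p.2) (Ω ×ˢ Ω) := fun j =>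
    contDiffOn_pd_right hΩ hk (by norm_num) j
  have hdom : ∀ j, DominatedDerivs Ω 1 (fun x y => pd j (k ρ x) y) (fun y => pd j Ψ y * ρ y) :=
    fun j => dominatedDerivs_of_zero_off hΩ (hkj j) (hw j) hΨ.isCompact hΨ.support
      fun y _ hy => hΨ' j y hy
  have hint : ∀ z ∈ Ω, ∀ j, IntegrableOn (fun y => pd j (k ρ z) y * (pd j Ψ y * ρ y)) Ω :=
    fun z hz j => (hdom j).integrableOn hΩ (hkj j).continuousOn (hw j) hz
  have hrep : ∀ z ∈ Ω, kernelOp Ω k ρ (wDiv ρ Ψ) z =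
      -∑ j, ∫ y in Ω, pd j (k ρ z) y * (pd j Ψ y * ρ y) := fun z hz => by
    rw [kernelOp, integral_mul_wDiv hΩ ((contDiffOn_right hk hz).of_le (by norm_num))
      (hρ.of_le (by decide)) (hΨ.smooth.contDiffOn.of_le (by decide)) hΨ.isCompact hΨ.support
      (Or.inr fun y hy => hΨ.zero_off y hy), ← integral_finsetSum _ fun j _ => hint z hz j]
    congr 1
    refine integral_congr_ae (Eventually.of_forall fun y => ?_)
    simp [dotProduct, grad, Finset.sum_mul, mul_assoc]
  have hpd : ∀ j, pd i (fun z => ∫ y in Ω, pd j (k ρ z) y * (pd j Ψ y * ρ y)) x =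
      ∫ y in Ω, pd i (fun x' => pd j (k ρ x') y) x * (pd j Ψ y * ρ y) := fun j =>
    pd_integral_mul hΩ (hkj j) (hw j) (hdom j) hx i
  have hint2 : ∀ j, IntegrableOn
      (fun y => pd i (fun x' => pd j (k ρ x') y) x * (pd j Ψ y * ρ y)) Ω := fun j =>
    ((hdom j).pd (n := 0) hΩ (hkj j) i).integrableOn hΩ
      (contDiffOn_pd_left (m := 0) hΩ (hkj j) (by norm_num) i).continuousOn (hw j) hx
  have hneg : mixedAction (kernelOp Ω k) ρ Ψ x i =
      -pd i (kernelOp Ω k ρ (wDiv ρ Ψ)) x := rfl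
  rw [hneg, pd_congr_on hΩ hrep hx, pd_neg, neg_neg, pd_sum _ fun j _ =>
    (hasFDerivAt_integral_mul hΩ (hkj j) (hw j) (hdom j) hx).2.differentiableAt]
  simp only [hpd]
  rw [← integral_finsetSum _ fun j _ => hint2 j]
  refine integral_congr_ae (Eventually.of_forall fun y => ?_)
  simp [mulVec, dotProduct, mixedHess, grad, Finset.sum_mul, mul_assoc]

theorem continuousOn_mixedHess (hΩ : IsOpen Ω) {W : Sp d → Sp d → ℝ}
    (hW : ContDiffOn ℝ 2 (fun p : Sp d × Sp d => W p.1 p.2) (Ω ×ˢ Ω)) (i j : Fin d) :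
    ContinuousOn (fun p : Sp d × Sp d => mixedHess W p.1 p.2 i j) (Ω ×ˢ Ω) :=
  (contDiffOn_pd_left (F := fun x y => pd j (W x) y) (m := 0) hΩ
    (contDiffOn_pd_right (m := 1) hΩ hW (by norm_num) j) (by norm_num) i).continuousOn

theorem integrableOn_mixedHess_mulVec (hΩ : IsOpen Ω) {W : Sp d → Sp d → ℝ} (hρ : ContinuousOn ρ Ω)
    (hW : ContDiffOn ℝ 2 (fun p : Sp d × Sp d => W p.1 p.2) (Ω ×ˢ Ω)) (hΨ : IsTest Ω Ψ)
    {x : Sp d} (hx : x ∈ Ω) (i : Fin d) :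
    IntegrableOn (fun y => (mixedHess W x y *ᵥ grad Ψ y) i * ρ y) Ω := by
  refine integrableOn_of_zero_off hΩ (ContinuousOn.mul ?_ hρ) hΨ.isCompact hΨ.support
    fun y _ hy => by rw [hΨ.grad_zero_off hy, mulVec_zero, Pi.zero_apply, zero_mul]
  have : ContinuousOn (fun y => ∑ j, mixedHess W x y i j * pd j Ψ y) Ω :=
    continuousOn_finsetSum _ fun j _ => ((continuousOn_mixedHess hΩ hW i j).comp
      (continuousOn_const.prodMk continuousOn_id) fun y hy => mk_mem_prod hx hy).mul
      (hΨ.pd_continuous j).continuousOn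
  exact this

theorem hessFormK_eq_hessFormL (hΩ : IsOpen Ω) (hρ : ContDiffOn ℝ ∞ ρ Ω)
    (hk : ContDiffOn ℝ 2 (fun p : Sp d × Sp d => k ρ p.1 p.2) (Ω ×ˢ Ω)) (hΨ : IsTest Ω Ψ) :
    hessFormK Ω D k ρ Φ Ψ = hessFormL Ω D (kernelOp Ω k) ρ Φ Ψ := by
  unfold hessFormK hessFormL
  congr 1
  refine setIntegral_congr_fun hΩ.measurableSet fun x hx => ?_
  have hint := integrableOn_mixedHess_mulVec hΩ hρ.continuousOn hk hΨ hx
  simp only [dotProduct, mixedAction_kernelOp hΩ hρ hk hΨ hx, ← integral_const_mul]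
  rw [← integral_finsetSum _ fun i _ => (hint i).const_mul _, ← integral_mul_const]
  refine integral_congr_ae (Eventually.of_forall fun y => ?_)
  simp only [Finset.sum_mul]
  exact Finset.sum_congr rfl fun i _ => by ring

end Kernels

end WassersteinNewton

namespace WassersteinNewton

/-! ### Double integrals against a kernel. -/

section ProductIntegrals

variable {d : ℕ} {Ω K : Set (Sp d)} {F : Sp d → Sp d → ℝ} {f g h : Sp d → ℝ}

theorem ae_prod_mem (hΩ : IsOpen Ω) :
    ∀ᵐ p ∂((volume.restrict Ω).prod (volume.restrict Ω)), p ∈ Ω ×ˢ Ω := by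
  rw [Measure.prod_restrict]
  exact ae_restrict_mem (hΩ.prod hΩ).measurableSet

/-- On the support K of f the kernel times h is dominated by some b(y), so the integrand is bounded
by |f(x)| b(y), a product of integrable functions. -/
theorem integrable_prod_of_dominated (hΩ : IsOpen Ω)
    (hF : ContinuousOn (fun p : Sp d × Sp d => F p.1 p.2) (Ω ×ˢ Ω)) (hh : ContinuousOn h Ω)
    (hdom : DominatedDerivs Ω 0 F h) (hf : ContinuousOn f Ω) (hK : IsCompact K) (hKΩ : K ⊆ Ω)
    (h0 : ∀ y ∈ Ω, y ∉ K → f y = 0) :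
    Integrable (fun p : Sp d × Sp d => f p.1 * F p.1 p.2 * h p.2)
      ((volume.restrict Ω).prod (volume.restrict Ω)) := by
  obtain ⟨b, hb, hle⟩ := hdom 0 le_rfl K hK hKΩ
  have hfi : IntegrableOn f Ω := integrableOn_of_zero_off hΩ hf hK hKΩ h0
  refine (hfi.norm.mul_prod hb).mono' ?_ ?_
  · rw [Measure.prod_restrict]
    refine ContinuousOn.aestronglyMeasurable ?_ (hΩ.prod hΩ).measurableSet
    exact ((hf.comp continuousOn_fst fun p hp => hp.1).mul hF).mul
      (hh.comp continuousOn_snd fun p hp => hp.2)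
  · filter_upwards [ae_prod_mem hΩ] with p hp
    by_cases hpK : p.1 ∈ K
    · have := hle p.1 hpK p.2 hp.2
      rw [norm_iteratedFDeriv_zero] at this
      rw [norm_mul, norm_mul, mul_assoc]
      exact mul_le_mul_of_nonneg_left this (norm_nonneg _)
    · simp [h0 p.1 hp.1 hpK]

theorem integrable_prod_swap_of_symm (hΩ : IsOpen Ω) (hsymm : ∀ x ∈ Ω, ∀ y ∈ Ω, F x y = F y x)
    (hi : Integrable (fun p : Sp d × Sp d => f p.1 * F p.1 p.2 * h p.2)
      ((volume.restrict Ω).prod (volume.restrict Ω))) :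
    Integrable (fun p : Sp d × Sp d => h p.1 * F p.1 p.2 * f p.2)
      ((volume.restrict Ω).prod (volume.restrict Ω)) := by
  refine hi.swap.congr ?_
  filter_upwards [ae_prod_mem hΩ] with p hp
  simp only [Function.comp, Prod.fst_swap, Prod.snd_swap]
  rw [hsymm p.2 hp.2 p.1 hp.1]
  ring

theorem integral_prod_swap_of_symm (hΩ : IsOpen Ω)
    (hsymm : ∀ x ∈ Ω, ∀ y ∈ Ω, F x y = F y x) :
    ∫ p : Sp d × Sp d, f p.1 * F p.1 p.2 * h p.2 ∂(volume.restrict Ω).prod (volume.restrict Ω) =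
    ∫ p : Sp d × Sp d, h p.1 * F p.1 p.2 * f p.2
      ∂(volume.restrict Ω).prod (volume.restrict Ω) := by
  rw [← integral_prod_swap]
  refine integral_congr_ae ?_
  filter_upwards [ae_prod_mem hΩ] with p hp
  simp only [Prod.fst_swap, Prod.snd_swap]
  rw [hsymm p.2 hp.2 p.1 hp.1]
  ring

theorem integral_prod_eq (hi : Integrable (fun p : Sp d × Sp d => f p.1 * F p.1 p.2 * h p.2)
      ((volume.restrict Ω).prod (volume.restrict Ω))) :
    ∫ p : Sp d × Sp d, f p.1 * F p.1 p.2 * h p.2 ∂(volume.restrict Ω).prod (volume.restrict Ω) =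
    ∫ x in Ω, f x * ∫ y in Ω, F x y * h y := by
  rw [integral_prod _ hi]
  simp only [mul_assoc, integral_const_mul]

theorem dominatedDerivs_test (hΩ : IsOpen Ω) {n : ℕ} {σ : Sp d → ℝ} (hσ : IsTest Ω σ)
    (hF : ContDiffOn ℝ n (fun p : Sp d × Sp d => F p.1 p.2) (Ω ×ˢ Ω)) :
    DominatedDerivs Ω n F σ :=
  dominatedDerivs_of_zero_off hΩ hF hσ.continuous.continuousOn hσ.isCompact hσ.support
    fun y _ hy => hσ.zero_off y hy

end ProductIntegrals

/-! ### Variations of the interaction energy. -/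

section Interaction

variable {d : ℕ} {Ω K : Set (Sp d)} {W : Sp d → Sp d → ℝ} {ν ρ ρ' σ τ : Sp d → ℝ}

theorem dominatedDerivs_of_mem_interactionDomain (hρ : ρ ∈ interactionDomain Ω W ν) :
    DominatedDerivs Ω 3 W (fun y => ρ y - ν y) := by
  intro m hm K hK hKΩ
  obtain ⟨g, h1, h2, hle⟩ := hρ.2.2 K hK hKΩ m hm
  refine ⟨fun y => g y * ρ y + |g y * ν y|, h1.add h2.abs, fun x hx y hy => ?_⟩
  have hg := hle x hx y hy
  have hg0 : 0 ≤ g y := (norm_nonneg _).trans hg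
  have hρ0 := hρ.1.nonneg y
  calc _ ≤ g y * |ρ y - ν y| := mul_le_mul_of_nonneg_right hg (abs_nonneg _)
    _ ≤ g y * (ρ y + |ν y|) := by
        refine mul_le_mul_of_nonneg_left ((abs_sub _ _).trans ?_) hg0
        rw [abs_of_nonneg hρ0]
    _ = _ := by simp only [abs_mul, abs_of_nonneg hg0, mul_add]

theorem integrable_interaction (hρ : ρ ∈ interactionDomain Ω W ν) :
    Integrable (fun p : Sp d × Sp d => (ρ p.1 - ν p.1) * W p.1 p.2 * (ρ p.2 - ν p.2))
      ((volume.restrict Ω).prod (volume.restrict Ω)) := by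
  rw [Measure.prod_restrict]
  exact hρ.2.1

/-- The cross term is not controlled by finiteness of the energy, but by the compact support of σ
and the domination of W on it. -/
theorem integrable_test_interaction (hΩ : IsOpen Ω)
    (hW : ContDiffOn ℝ ∞ (fun p : Sp d × Sp d => W p.1 p.2) (Ω ×ˢ Ω)) (hν : ContinuousOn ν Ω)
    (hρ : ρ ∈ interactionDomain Ω W ν) (hσ : IsTest Ω σ) :
    Integrable (fun p : Sp d × Sp d => σ p.1 * W p.1 p.2 * (ρ p.2 - ν p.2))
      ((volume.restrict Ω).prod (volume.restrict Ω)) :=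
  integrable_prod_of_dominated (h := fun y => ρ y - ν y) hΩ hW.continuousOn
    (hρ.1.smooth.continuousOn.sub hν)
    ((dominatedDerivs_of_mem_interactionDomain hρ).mono (Nat.zero_le 3))
    hσ.continuous.continuousOn hσ.isCompact hσ.support fun y _ hy => hσ.zero_off y hy

theorem integrable_test_test (hΩ : IsOpen Ω)
    (hW : ContDiffOn ℝ ∞ (fun p : Sp d × Sp d => W p.1 p.2) (Ω ×ˢ Ω)) (hσ : IsTest Ω σ)
    (hτ : IsTest Ω τ) :
    Integrable (fun p : Sp d × Sp d => σ p.1 * W p.1 p.2 * τ p.2)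
      ((volume.restrict Ω).prod (volume.restrict Ω)) :=
  integrable_prod_of_dominated hΩ hW.continuousOn hτ.continuous.continuousOn
    (dominatedDerivs_test hΩ hτ (hW.of_le (by decide))) hσ.continuous.continuousOn hσ.isCompact
    hσ.support fun y _ hy => hσ.zero_off y hy

/-- Expanding the energy density around ρ leaves four integrable terms. The dominating functions are
adjusted only where the density changes. -/
theorem energyDomain_interactionDomain (hΩ : IsOpen Ω)
    (hW : ContDiffOn ℝ ∞ (fun p : Sp d × Sp d => W p.1 p.2) (Ω ×ˢ Ω))
    (hsymm : ∀ x ∈ Ω, ∀ y ∈ Ω, W x y = W y x) (hν : ContinuousOn ν Ω) :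
    EnergyDomain Ω (interactionDomain Ω W ν) where
  density ρ hρ := hρ.1
  stable ρ hρ ρ' hρ' hσ _ := by
    have hcross := integrable_test_interaction hΩ hW hν hρ hσ
    refine ⟨hρ', ?_, fun K hK hKΩ m hm => ?_⟩
    · rw [IntegrableOn, Measure.volume_eq_prod, ← Measure.prod_restrict]
      refine (((integrable_interaction hρ).add hcross).add
        ((integrable_prod_swap_of_symm (f := ρ' - ρ) (h := fun y => ρ y - ν y) hΩ hsymm
          hcross).add (integrable_test_test hΩ hW hσ hσ))).congr
        (Eventually.of_forall fun p => ?_)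
      simp only [Pi.add_apply, Pi.sub_apply]
      ring
    · obtain ⟨g, h1, h2, hle⟩ := hρ.2.2 K hK hKΩ m hm
      obtain ⟨C, -, hC⟩ := exists_bound_iteratedFDeriv_left (m := m) hΩ
        (hW.of_le (by exact_mod_cast le_top)) hK hKΩ hσ.isCompact hσ.support
      classical
      have hS : MeasurableSet (tsupport (ρ' - ρ)) := (isClosed_tsupport _).measurableSet
      have hint : ∀ {u : Sp d → ℝ}, ContinuousOn u Ω →
          IntegrableOn (fun y => C * u y) (tsupport (ρ' - ρ)) := fun hu =>
        ((continuousOn_const.mul hu).mono hσ.support).integrableOn_compact hσ.isCompact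
      -- The old g need not be integrable against ρ' where ρ vanishes and ρ' does not. On the
      -- support of the change it is replaced by the compactness bound C; elsewhere ρ' = ρ.
      refine ⟨(tsupport (ρ' - ρ)).piecewise (fun _ => C) g, ?_, ?_, fun x hx y hy => ?_⟩
      · refine (Integrable.piecewise (μ := volume.restrict Ω) hS
          ((hint hρ'.smooth.continuousOn).mono_measure Measure.restrict_le_self)
          (h1.integrableOn (s := (tsupport (ρ' - ρ))ᶜ))).congr
          (Eventually.of_forall fun y => ?_)
        by_cases hy : y ∈ tsupport (ρ' - ρ)
        · simp [hy]
        · have : ρ' y = ρ y := sub_eq_zero.1 (hσ.zero_off y hy)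
          simp [hy, this]
      · refine (Integrable.piecewise (μ := volume.restrict Ω) hS
          ((hint hν).mono_measure Measure.restrict_le_self)
          (h2.integrableOn (s := (tsupport (ρ' - ρ))ᶜ))).congr
          (Eventually.of_forall fun y => ?_)
        by_cases hy : y ∈ tsupport (ρ' - ρ) <;> simp [hy]
      · by_cases hyS : y ∈ tsupport (ρ' - ρ)
        · rw [piecewise_eq_of_mem _ _ _ hyS]; exact hC x hx y hyS
        · rw [piecewise_eq_of_notMem _ _ _ hyS]; exact hle x hx y hy

/-- The energy is exactly a quadratic polynomial in t, symmetry of W merging the two cross terms;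
the first variation is its linear coefficient. -/
theorem interactionEnergy_add_smul (hΩ : IsOpen Ω)
    (hW : ContDiffOn ℝ ∞ (fun p : Sp d × Sp d => W p.1 p.2) (Ω ×ˢ Ω))
    (hsymm : ∀ x ∈ Ω, ∀ y ∈ Ω, W x y = W y x) (hν : ContinuousOn ν Ω)
    (hρ : ρ ∈ interactionDomain Ω W ν) (hσ : IsTest Ω σ) (t : ℝ) :
    interactionEnergy Ω W ν (ρ + t • σ) = interactionEnergy Ω W ν ρ +
      t * (∫ x in Ω, interactionFirst Ω W ν ρ x * σ x) +
      t ^ 2 * ((1 / 2) * ∫ x in Ω, σ x * ∫ y in Ω, W x y * σ y) := by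
  have i1 := integrable_interaction hρ
  have i2 := integrable_test_interaction hΩ hW hν hρ hσ
  have i3 := integrable_prod_swap_of_symm (f := σ) (h := fun y => ρ y - ν y) hΩ hsymm i2
  have i4 := integrable_test_test hΩ hW hσ hσ
  have e1 : ∀ p : Sp d × Sp d, ((ρ + t • σ) p.1 - ν p.1) * W p.1 p.2 * ((ρ + t • σ) p.2 - ν p.2) =
      (ρ p.1 - ν p.1) * W p.1 p.2 * (ρ p.2 - ν p.2) +
      (t * (σ p.1 * W p.1 p.2 * (ρ p.2 - ν p.2)) + t * ((ρ p.1 - ν p.1) * W p.1 p.2 * σ p.2)) +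
      t ^ 2 * (σ p.1 * W p.1 p.2 * σ p.2) := fun p => by
    simp only [Pi.add_apply, Pi.smul_apply, smul_eq_mul]; ring
  have i5 := (i1.add ((i2.const_mul t).add (i3.const_mul t))).add (i4.const_mul (t ^ 2))
  have hE : interactionEnergy Ω W ν (ρ + t • σ) =
      (1 / 2) * ∫ p : Sp d × Sp d, ((ρ + t • σ) p.1 - ν p.1) * W p.1 p.2 *
        ((ρ + t • σ) p.2 - ν p.2) ∂(volume.restrict Ω).prod (volume.restrict Ω) := by
    rw [integral_prod]
    · rfl
    · exact i5.congr (Eventually.of_forall fun p => (e1 p).symm)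
  have hE0 : interactionEnergy Ω W ν ρ = (1 / 2) * ∫ p : Sp d × Sp d,
      (ρ p.1 - ν p.1) * W p.1 p.2 * (ρ p.2 - ν p.2)
        ∂(volume.restrict Ω).prod (volume.restrict Ω) := by
    rw [integral_prod _ i1]
    rfl
  rw [hE, hE0, integral_congr_ae (Eventually.of_forall e1)]
  have s1 := integral_add (i1.add ((i2.const_mul t).add (i3.const_mul t))) (i4.const_mul (t ^ 2))
  have s2 := integral_add i1 ((i2.const_mul t).add (i3.const_mul t))
  have s3 := integral_add (i2.const_mul t) (i3.const_mul t)
  simp only [Pi.add_apply] at s1 s2 s3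
  rw [s1, s2, s3]
  simp only [integral_const_mul]
  rw [← integral_prod_swap_of_symm (f := σ) (h := fun y => ρ y - ν y) hΩ hsymm,
    integral_prod_eq (h := fun y => ρ y - ν y) i2, integral_prod_eq i4]
  simp only [interactionFirst, mul_comm (∫ y in Ω, W _ y * (ρ y - ν y))]
  ring

theorem integrableOn_kernel_test (hΩ : IsOpen Ω)
    (hW : ContDiffOn ℝ ∞ (fun p : Sp d × Sp d => W p.1 p.2) (Ω ×ˢ Ω)) (hσ : IsTest Ω σ)
    {x : Sp d} (hx : x ∈ Ω) : IntegrableOn (fun y => W x y * σ y) Ω :=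
  (dominatedDerivs_test (n := 0) hΩ hσ (hW.of_le (by decide))).integrableOn hΩ hW.continuousOn
    hσ.continuous.continuousOn hx

theorem interactionFirst_add_smul (hΩ : IsOpen Ω)
    (hW : ContDiffOn ℝ ∞ (fun p : Sp d × Sp d => W p.1 p.2) (Ω ×ˢ Ω)) (hν : ContinuousOn ν Ω)
    (hρ : ρ ∈ interactionDomain Ω W ν) (hσ : IsTest Ω σ) (t : ℝ) {x : Sp d} (hx : x ∈ Ω) :
    interactionFirst Ω W ν (ρ + t • σ) x =
      interactionFirst Ω W ν ρ x + t * ∫ y in Ω, W x y * σ y := by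
  unfold interactionFirst
  rw [← integral_const_mul, ← integral_add
    ((dominatedDerivs_of_mem_interactionDomain hρ).integrableOn hΩ hW.continuousOn
      (hρ.1.smooth.continuousOn.sub hν) hx) ((integrableOn_kernel_test hΩ hW hσ hx).const_mul t)]
  refine integral_congr_ae (Eventually.of_forall fun y => ?_)
  simp only [Pi.add_apply, Pi.smul_apply, smul_eq_mul]
  ring

theorem contDiffOn_interactionFirst (hΩ : IsOpen Ω)
    (hW : ContDiffOn ℝ ∞ (fun p : Sp d × Sp d => W p.1 p.2) (Ω ×ˢ Ω)) (hν : ContinuousOn ν Ω)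
    (hρ : ρ ∈ interactionDomain Ω W ν) : ContDiffOn ℝ 3 (interactionFirst Ω W ν ρ) Ω :=
  contDiffOn_integral_mul hΩ (hρ.1.smooth.continuousOn.sub hν) 3 (hW.of_le (by decide))
    (dominatedDerivs_of_mem_interactionDomain hρ)

theorem tendstoLocallyUniformlyOn_kernel (hΩ : IsOpen Ω)
    (hW : ContDiffOn ℝ ∞ (fun p : Sp d × Sp d => W p.1 p.2) (Ω ×ˢ Ω)) {σs : ℕ → Sp d → ℝ}
    (h : TestTendsto Ω σs σ) :
    TendstoLocallyUniformlyOn (fun n x => ∫ y in Ω, W x y * σs n y)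
      (fun x => ∫ y in Ω, W x y * σ y) atTop Ω := by
  rw [tendstoLocallyUniformlyOn_iff_forall_isCompact hΩ]
  intro K hKΩ hK
  obtain ⟨S, hS, hSΩ, hsupp⟩ := h.2.2.1
  have hT : IsCompact (S ∪ tsupport σ) := hS.union h.2.1.isCompact
  have hTΩ : S ∪ tsupport σ ⊆ Ω := union_subset hSΩ h.2.1.support
  obtain ⟨C, hC⟩ := (hK.prod hT).exists_bound_of_continuousOn
    (hW.continuousOn.mono (prod_mono hKΩ hTΩ))
  set m := volume.real (S ∪ tsupport σ) with hm
  have hm0 : 0 ≤ m := measureReal_nonneg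
  rw [Metric.tendstoUniformlyOn_iff]
  intro ε hε
  -- |C| bounds W on K times the common support and m is the volume of that support, so closeness δ
  -- of the test functions yields an error at most |C| δ m < ε.
  have hδ : 0 < ε / (|C| * m + 1) := by positivity
  filter_upwards [Metric.tendstoUniformlyOn_iff.1 (h.tendstoUniformlyOn univ) _ hδ] with n hn x hx
  have hxΩ := hKΩ hx
  rw [Real.dist_eq, ← integral_sub (integrableOn_kernel_test hΩ hW h.2.1 hxΩ)
    (integrableOn_kernel_test hΩ hW (h.1 n) hxΩ), setIntegral_of_zero_off hΩ hTΩ]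
  · have hb : ∀ y ∈ S ∪ tsupport σ, ‖W x y * σ y - W x y * σs n y‖ ≤
        |C| * (ε / (|C| * m + 1)) := fun y hy => by
      rw [← mul_sub, norm_mul]
      refine mul_le_mul ((hC (x, y) (mk_mem_prod hx hy)).trans (le_abs_self C)) ?_ (norm_nonneg _)
        (abs_nonneg _)
      have := hn y (mem_univ y)
      rw [Real.dist_eq] at this
      exact this.le
    have := norm_setIntegral_le_of_norm_le_const (hT.measure_lt_top (μ := volume)) hb
    rw [Real.norm_eq_abs] at this
    refine this.trans_lt ?_
    rw [← hm]
    calc |C| * (ε / (|C| * m + 1)) * m = (|C| * m) / (|C| * m + 1) * ε := by ring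
      _ < 1 * ε := by
        refine mul_lt_mul_of_pos_right ?_ hε
        rw [div_lt_one (by positivity)]
        linarith
      _ = ε := one_mul ε
  · intro y _ hy
    have h1 : σ y = 0 := h.2.1.zero_off y fun h' => hy (Or.inr h')
    have h2 : σs n y = 0 := (h.1 n).zero_off y fun h' => hy (Or.inl (hsupp n h'))
    simp [h1, h2]

theorem hasVariations_interaction (hΩ : IsOpen Ω)
    (hW : ContDiffOn ℝ ∞ (fun p : Sp d × Sp d => W p.1 p.2) (Ω ×ˢ Ω))
    (hsymm : ∀ x ∈ Ω, ∀ y ∈ Ω, W x y = W y x) (hν : ContinuousOn ν Ω) :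
    HasVariations Ω (interactionDomain Ω W ν) (interactionEnergy Ω W ν)
      (interactionFirst Ω W ν) (kernelOp Ω fun _ => W) where
  first_regular ρ hρ := (contDiffOn_interactionFirst hΩ hW hν hρ).of_le (by norm_num)
  first ρ hρ ρ' _ hσ := by
    have hd : HasDerivAt (fun t : ℝ => interactionEnergy Ω W ν ρ +
        t * (∫ x in Ω, interactionFirst Ω W ν ρ x * (ρ' - ρ) x) +
        t ^ 2 * ((1 / 2) * ∫ x in Ω, (ρ' - ρ) x * ∫ y in Ω, W x y * (ρ' - ρ) y))
        (∫ x in Ω, interactionFirst Ω W ν ρ x * (ρ' x - ρ x)) 0 := by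
      refine ((((hasDerivAt_id (0 : ℝ)).mul_const _).const_add _).add
        ((hasDerivAt_pow 2 (0 : ℝ)).mul_const _)).congr_deriv ?_
      simp
    refine (hd.congr_of_eventuallyEq (Eventually.of_forall fun t => ?_)).hasDerivWithinAt
    exact interactionEnergy_add_smul hΩ hW hsymm hν hρ hσ t
  second ρ hρ ρ' _ hσ x hx := by
    have hd : HasDerivAt (fun t : ℝ => interactionFirst Ω W ν ρ x +
        t * ∫ y in Ω, W x y * (ρ' - ρ) y) (kernelOp Ω (fun _ => W) ρ (ρ' - ρ) x) 0 := by
      refine (((hasDerivAt_id (0 : ℝ)).mul_const _).const_add _).congr_deriv ?_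
      simp [kernelOp]
    refine (hd.congr_of_eventuallyEq (Eventually.of_forall fun t => ?_)).hasDerivWithinAt
    exact interactionFirst_add_smul hΩ hW hν hρ hσ t hx
  second_regular ρ _ σ hσ := by
    have h1 : ContDiffOn ℝ (1 : ℕ) (fun p : Sp d × Sp d => W p.1 p.2) (Ω ×ˢ Ω) :=
      hW.of_le (by exact_mod_cast le_top)
    exact_mod_cast contDiffOn_integral_mul hΩ hσ.1.continuous.continuousOn 1 h1
      (dominatedDerivs_test hΩ hσ.1 h1)
  second_add ρ _ σ τ hσ hτ x hx := by
    unfold kernelOp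
    rw [← integral_add (integrableOn_kernel_test hΩ hW hσ.1 hx)
      (integrableOn_kernel_test hΩ hW hτ.1 hx)]
    simp only [Pi.add_apply, mul_add]
  second_smul ρ _ c σ _ x _ := by
    unfold kernelOp
    rw [← integral_const_mul]
    simp only [Pi.smul_apply, smul_eq_mul, mul_left_comm]
  second_symm ρ _ σ τ hσ hτ := by
    unfold kernelOp
    rw [← integral_prod_eq (integrable_test_test hΩ hW hτ.1 hσ.1),
      integral_prod_swap_of_symm hΩ hsymm,
      integral_prod_eq (integrable_test_test hΩ hW hσ.1 hτ.1)]
  first_continuous ρ hρ ρs _ h := by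
    have h0 := tendstoLocallyUniformlyOn_kernel hΩ hW h
    rw [tendstoLocallyUniformlyOn_iff_forall_isCompact hΩ] at h0 ⊢
    intro K hKΩ hK
    have h1 := h0 K hKΩ hK
    rw [Metric.tendstoUniformlyOn_iff] at h1 ⊢
    intro ε hε
    filter_upwards [h1 ε hε] with n hn x hx
    have h2 := interactionFirst_add_smul hΩ hW hν hρ (h.1 n) 1 (hKΩ hx)
    rw [one_smul, add_sub_cancel] at h2
    have h3 := hn x hx
    rw [h2, dist_comm, Real.dist_eq]
    rw [dist_comm, Real.dist_eq] at h3
    simpa using h3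
  second_continuous ρ _ ρs _ _ σ σs _ _ h := tendstoLocallyUniformlyOn_kernel hΩ hW h

end Interaction

end WassersteinNewton

namespace WassersteinNewton

/-! ### Symmetries of the mixed second derivatives of W. -/

section MixedDerivatives

variable {d : ℕ} {Ω : Set (Sp d)} {W : Sp d → Sp d → ℝ}

theorem pd_left_pd_right_comm (hΩ : IsOpen Ω)
    (hW : ContDiffOn ℝ 2 (fun p : Sp d × Sp d => W p.1 p.2) (Ω ×ˢ Ω)) {x y : Sp d} (hx : x ∈ Ω)
    (hy : y ∈ Ω) (i j : Fin d) :
    pd i (fun x' => pd j (W x') y) x = pd j (fun y' => pd i (fun x' => W x' y') x) y := by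
  have hc : ContDiffAt ℝ 2 (fun p : Sp d × Sp d => W p.1 p.2) (x, y) :=
    hW.contDiffAt ((hΩ.prod hΩ).mem_nhds (mk_mem_prod hx hy))
  have hs : IsSymmSndFDerivAt ℝ (fun p : Sp d × Sp d => W p.1 p.2) (x, y) :=
    hc.isSymmSndFDerivAt (by simp)
  have hd : DifferentiableAt ℝ (fderiv ℝ (fun p : Sp d × Sp d => W p.1 p.2)) (x, y) :=
    (hc.fderiv_right (m := 1) (by norm_num)).differentiableAt (by simp)
  have hdiff := fun (a b : Sp d) (ha : a ∈ Ω) (hb : b ∈ Ω) =>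
    differentiableAt_of_contDiffOn_prod hΩ (by norm_num) hW ha hb
  have h1 : pd i (fun x' => pd j (W x') y) x =
      fderiv ℝ (fderiv ℝ (fun p : Sp d × Sp d => W p.1 p.2)) (x, y)
        (EuclideanSpace.single i 1, 0) (0, EuclideanSpace.single j 1) := by
    rw [pd_congr_on (g := fun x' => fderiv ℝ (fun p : Sp d × Sp d => W p.1 p.2) (x', y)
      (0, EuclideanSpace.single j 1)) hΩ (fun x' hx' => ?_) hx]
    · have h2 : HasFDerivAt (fun x' => fderiv ℝ (fun p : Sp d × Sp d => W p.1 p.2) (x', y)) _ x :=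
        HasFDerivAt.comp x (f := fun x' => (x', y)) hd.hasFDerivAt (hasFDerivAt_prodMk_left x y)
      rw [pd, (h2.clm_apply (hasFDerivAt_const _ _)).fderiv]
      simp
    · rw [pd, (hasFDerivAt_right (hdiff x' y hx' hy)).fderiv]
      simp
  have h2 : pd j (fun y' => pd i (fun x' => W x' y') x) y =
      fderiv ℝ (fderiv ℝ (fun p : Sp d × Sp d => W p.1 p.2)) (x, y)
        (0, EuclideanSpace.single j 1) (EuclideanSpace.single i 1, 0) := by
    rw [pd_congr_on (g := fun y' => fderiv ℝ (fun p : Sp d × Sp d => W p.1 p.2) (x, y')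
      (EuclideanSpace.single i 1, 0)) hΩ (fun y' hy' => ?_) hy]
    · have h2 : HasFDerivAt (fun y' => fderiv ℝ (fun p : Sp d × Sp d => W p.1 p.2) (x, y')) _ y :=
        HasFDerivAt.comp y (f := fun y' => (x, y')) hd.hasFDerivAt (hasFDerivAt_prodMk_right x y)
      rw [pd, (h2.clm_apply (hasFDerivAt_const _ _)).fderiv]
      simp
    · rw [pd, (hasFDerivAt_left (hdiff x y' hx hy')).fderiv]
      simp
  rw [h1, h2, hs]

/-- Symmetry of W exchanges the roles of the two variables, and Schwarz's theorem for the joint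
function restores the order of differentiation. -/
theorem mixedHess_swap (hΩ : IsOpen Ω)
    (hW : ContDiffOn ℝ 2 (fun p : Sp d × Sp d => W p.1 p.2) (Ω ×ˢ Ω))
    (hsymm : ∀ x ∈ Ω, ∀ y ∈ Ω, W x y = W y x) {x y : Sp d} (hx : x ∈ Ω) (hy : y ∈ Ω)
    (i j : Fin d) : mixedHess W y x j i = mixedHess W x y i j := by
  have h : pd j (fun y' => pd i (W y') x) y = pd j (fun y' => pd i (fun x' => W x' y') x) y :=
    pd_congr_on hΩ (fun y' hy' => pd_congr_on hΩ (fun x' hx' => hsymm y' hy' x' hx') hx i) hy j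
  exact h.trans (pd_left_pd_right_comm hΩ hW hx hy i j).symm

theorem hess_right_eq (hΩ : IsOpen Ω) (hsymm : ∀ x ∈ Ω, ∀ y ∈ Ω, W x y = W y x) {x y : Sp d}
    (hx : x ∈ Ω) (hy : y ∈ Ω) : hess (fun y' => W x y') y = hess (fun x' => W x' x) y := by
  ext i j
  exact pd_congr_on hΩ (fun z hz => pd_congr_on hΩ (fun w hw => hsymm x hx w hw) hz j) hy i

theorem div_congr_on (hΩ : IsOpen Ω) {U V : Sp d → Fin d → ℝ} (h : ∀ y ∈ Ω, U y = V y) {x : Sp d}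
    (hx : x ∈ Ω) : div U x = div V x :=
  Finset.sum_congr rfl fun i _ => pd_congr_on hΩ (fun y hy => by rw [h y hy]) hx i

theorem continuousOn_div (hΩ : IsOpen Ω) {V : Sp d → Fin d → ℝ}
    (hV : ∀ i, ContDiffOn ℝ 1 (fun y => V y i) Ω) : ContinuousOn (div V) Ω :=
  continuousOn_finsetSum _ fun i _ => pd_continuousOn hΩ (hV i) i

theorem contDiffOn_hess_mulVec_grad (hΩ : IsOpen Ω) {f g : Sp d → ℝ} (hf : ContDiffOn ℝ 3 f Ω)
    (hg : ContDiffOn ℝ 2 g Ω) (i : Fin d) :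
    ContDiffOn ℝ 1 (fun x => (hess f x *ᵥ grad g x) i) Ω := by
  have : ContDiffOn ℝ 1 (fun x => ∑ j, pd i (pd j f) x * pd j g x) Ω :=
    ContDiffOn.sum fun j _ => (pd_contDiffOn (n := 2) hΩ
      (pd_contDiffOn hΩ hf (by norm_num) j) (by norm_num) i).mul
        (pd_contDiffOn hΩ hg (by norm_num) j)
  exact this

end MixedDerivatives

/-! ### Hessian operator and Newton's flow of the interaction energy. -/

section InteractionHessian

variable {d : ℕ} {Ω K : Set (Sp d)} {W : Sp d → Sp d → ℝ} {ν ρ Φ Ψ : Sp d → ℝ}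

/-- Three dominated derivatives are assumed: two go into the Hessian, and one remains for the
divergence in `interactionOp`. -/
theorem dominatedDerivs_hess (hΩ : IsOpen Ω)
    (hW : ContDiffOn ℝ ∞ (fun p : Sp d × Sp d => W p.1 p.2) (Ω ×ˢ Ω))
    (hρ : ρ ∈ interactionDomain Ω W ν) (i j : Fin d) :
    DominatedDerivs Ω 1 (fun x y => hess (fun x' => W x' y) x i j) (fun y => ρ y - ν y) :=
  ((dominatedDerivs_of_mem_interactionDomain hρ).pd (n := 2) hΩ (hW.of_le (by decide)) j).pd
    (n := 1) hΩ (contDiffOn_pd_left (n := ∞) hΩ hW (by decide) j) i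

theorem contDiffOn_hess_left (hΩ : IsOpen Ω)
    (hW : ContDiffOn ℝ ∞ (fun p : Sp d × Sp d => W p.1 p.2) (Ω ×ˢ Ω)) (i j : Fin d) :
    ContDiffOn ℝ ∞ (fun p : Sp d × Sp d => hess (fun x' => W x' p.2) p.1 i j) (Ω ×ˢ Ω) :=
  contDiffOn_pd_left (F := fun x y => pd j (fun x' => W x' y) x) (n := ∞) hΩ
    (contDiffOn_pd_left (n := ∞) hΩ hW (by decide) j) (by decide) i

theorem contDiffOn_mixedHess (hΩ : IsOpen Ω)
    (hW : ContDiffOn ℝ ∞ (fun p : Sp d × Sp d => W p.1 p.2) (Ω ×ˢ Ω)) (i j : Fin d) :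
    ContDiffOn ℝ ∞ (fun p : Sp d × Sp d => mixedHess W p.1 p.2 i j) (Ω ×ˢ Ω) :=
  contDiffOn_pd_left (F := fun x y => pd j (W x) y) (n := ∞) hΩ
    (contDiffOn_pd_right (n := ∞) hΩ hW (by decide) j) (by decide) i

theorem hess_interactionFirst (hΩ : IsOpen Ω)
    (hW : ContDiffOn ℝ ∞ (fun p : Sp d × Sp d => W p.1 p.2) (Ω ×ˢ Ω)) (hν : ContinuousOn ν Ω)
    (hρ : ρ ∈ interactionDomain Ω W ν) {x : Sp d} (hx : x ∈ Ω) :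
    hess (interactionFirst Ω W ν ρ) x = Matrix.of fun i j =>
      ∫ y in Ω, hess (fun x' => W x' y) x i j * (ρ y - ν y) := by
  have hq := hρ.1.smooth.continuousOn.sub hν
  have hdom := dominatedDerivs_of_mem_interactionDomain hρ
  ext i j
  have h1 : ∀ z ∈ Ω, pd j (interactionFirst Ω W ν ρ) z =
      ∫ y in Ω, pd j (fun x' => W x' y) z * (ρ y - ν y) := fun z hz =>
    pd_integral_mul hΩ (hW.of_le (by decide)) hq (hdom.mono (by norm_num)) hz j
  have h2 : pd i (fun z => ∫ y in Ω, pd j (fun x' => W x' y) z * (ρ y - ν y)) x = _ :=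
    pd_integral_mul hΩ (contDiffOn_pd_left (n := ∞) hΩ hW (by decide) j) hq
      ((hdom.mono (m := 2) (by norm_num)).pd hΩ (hW.of_le (by decide)) j) hx i
  exact (pd_congr_on hΩ h1 hx i).trans h2

theorem dominatedDerivs_mixedHess_of_isTest (hΩ : IsOpen Ω)
    (hW : ContDiffOn ℝ ∞ (fun p : Sp d × Sp d => W p.1 p.2) (Ω ×ˢ Ω)) (hρ : ContinuousOn ρ Ω)
    (hΦ : IsTest Ω Φ) (i j : Fin d) :
    DominatedDerivs Ω 1 (fun x y => mixedHess W x y i j) (fun y => pd j Φ y * ρ y) :=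
  dominatedDerivs_of_zero_off hΩ ((contDiffOn_mixedHess hΩ hW i j).of_le (by decide))
    ((hΦ.pd_continuous j).continuousOn.mul hρ) hΦ.isCompact hΦ.support fun y _ hy => by
      rw [show pd j Φ y = 0 from congrFun (hΦ.grad_zero_off hy) j, zero_mul]

/-- The gradient of a potential need not have compact support. The product g |∂ⱼΦ| is bounded by g²
+ |∇Φ|², both ρ-integrable by `InteractionL2` and `IsPotential.integrableOn_sq`. -/
theorem dominatedDerivs_mixedHess_of_isPotential (hΩ : IsOpen Ω) (hρ : Density Ω ρ)
    (hL : InteractionL2 Ω W ρ) (hΦ : IsPotential Ω ρ Φ) (i j : Fin d) :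
    DominatedDerivs Ω 1 (fun x y => mixedHess W x y i j) (fun y => pd j Φ y * ρ y) := by
  intro m hm K hK hKΩ
  obtain ⟨g, hg, hle⟩ := hL K hK hKΩ
  -- The full differential is bounded by the sum of d partial derivatives; the extra 1 covers order
  -- zero.
  refine ⟨fun y => (d + 1) * (g y ^ 2 * ρ y + (grad Φ y ⬝ᵥ grad Φ y) * ρ y),
    Integrable.const_mul (Integrable.fun_add hg (hΦ.integrableOn_sq hΩ hρ)) ((d : ℝ) + 1),
    fun x hx y hy => ?_⟩
  obtain ⟨h0, h1⟩ := hle x hx y hy i j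
  have hg0 : 0 ≤ g y := (abs_nonneg _).trans h0
  have hρ0 := hρ.nonneg y
  have hd : (0 : ℝ) ≤ d := Nat.cast_nonneg d
  have hnorm : ‖iteratedFDeriv ℝ m (fun x' => mixedHess W x' y i j) x‖ ≤ (d + 1) * g y := by
    interval_cases m
    · rw [norm_iteratedFDeriv_zero]
      refine h0.trans ?_
      nlinarith
    · rw [norm_iteratedFDeriv_one, fderiv_eq_sum_pd]
      refine (norm_sum_le _ _).trans ((Finset.sum_le_sum (g := fun _ => g y) fun l _ => ?_).trans ?_)
      · rw [norm_smul]
        have hp : ‖(EuclideanSpace.proj l : Sp d →L[ℝ] ℝ)‖ ≤ 1 :=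
          ContinuousLinearMap.opNorm_le_bound _ zero_le_one fun v => by
            simpa using PiLp.norm_apply_le v l
        exact (mul_le_of_le_one_right (norm_nonneg _) hp).trans (h1 l)
      · simp only [Finset.sum_const, Finset.card_univ, Fintype.card_fin, nsmul_eq_mul]
        nlinarith
  have hsq : pd j Φ y ^ 2 ≤ grad Φ y ⬝ᵥ grad Φ y := by
    rw [sq]
    exact Finset.single_le_sum (f := fun l => grad Φ y l * grad Φ y l)
      (fun l _ => mul_self_nonneg _) (Finset.mem_univ j)
  have hmul : g y * |pd j Φ y| ≤ g y ^ 2 + grad Φ y ⬝ᵥ grad Φ y := by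
    have := two_mul_le_add_sq (g y) |pd j Φ y|
    rw [sq_abs] at this
    nlinarith [mul_nonneg hg0 (abs_nonneg (pd j Φ y))]
  calc _ ≤ ((d + 1) * g y) * |pd j Φ y * ρ y| := mul_le_mul_of_nonneg_right hnorm (abs_nonneg _)
    _ = ((d + 1) * ρ y) * (g y * |pd j Φ y|) := by rw [abs_mul, abs_of_nonneg hρ0]; ring
    _ ≤ ((d + 1) * ρ y) * (g y ^ 2 + grad Φ y ⬝ᵥ grad Φ y) :=
        mul_le_mul_of_nonneg_left hmul (by positivity)
    _ = _ := by ring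

theorem integrableOn_mixedHess_mulVec_of_dominated (hΩ : IsOpen Ω)
    (hW : ContDiffOn ℝ ∞ (fun p : Sp d × Sp d => W p.1 p.2) (Ω ×ˢ Ω)) (hρ : ContinuousOn ρ Ω)
    (hΦ : ContDiffOn ℝ ∞ Φ Ω)
    (hdom : ∀ i j, DominatedDerivs Ω 1 (fun x y => mixedHess W x y i j) (fun y => pd j Φ y * ρ y))
    {x : Sp d} (hx : x ∈ Ω) (i : Fin d) :
    IntegrableOn (fun y => (mixedHess W x y *ᵥ grad Φ y) i * ρ y) Ω ∧
    ∫ y in Ω, (mixedHess W x y *ᵥ grad Φ y) i * ρ y =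
      ∑ j, ∫ y in Ω, mixedHess W x y i j * (pd j Φ y * ρ y) := by
  have hint : ∀ j, IntegrableOn (fun y => mixedHess W x y i j * (pd j Φ y * ρ y)) Ω := fun j =>
    (hdom i j).integrableOn hΩ (contDiffOn_mixedHess hΩ hW i j).continuousOn
      ((pd_continuousOn hΩ (hΦ.of_le (by decide)) j).mul hρ) hx
  have he : (fun y => (mixedHess W x y *ᵥ grad Φ y) i * ρ y) =
      fun y => ∑ j, mixedHess W x y i j * (pd j Φ y * ρ y) := by
    funext y
    simp [mulVec, dotProduct, grad, Finset.sum_mul, mul_assoc]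
  rw [he]
  exact ⟨integrable_finsetSum _ fun j _ => hint j, integral_finsetSum _ fun j _ => hint j⟩

theorem contDiffOn_integral_mixedHess (hΩ : IsOpen Ω)
    (hW : ContDiffOn ℝ ∞ (fun p : Sp d × Sp d => W p.1 p.2) (Ω ×ˢ Ω)) (hρ : ContinuousOn ρ Ω)
    (hΦ : ContDiffOn ℝ ∞ Φ Ω)
    (hdom : ∀ i j, DominatedDerivs Ω 1 (fun x y => mixedHess W x y i j) (fun y => pd j Φ y * ρ y))
    (i : Fin d) :
    ContDiffOn ℝ 1 (fun x => ∫ y in Ω, (mixedHess W x y *ᵥ grad Φ y) i * ρ y) Ω := by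
  refine ContDiffOn.congr (f := fun x => ∑ j, ∫ y in Ω, mixedHess W x y i j * (pd j Φ y * ρ y)) ?_
    fun x hx => (integrableOn_mixedHess_mulVec_of_dominated hΩ hW hρ hΦ hdom hx i).2
  refine ContDiffOn.sum fun j _ => ?_
  exact_mod_cast contDiffOn_integral_mul hΩ
    ((pd_continuousOn hΩ (hΦ.of_le (by decide)) j).mul hρ) 1
    ((contDiffOn_mixedHess hΩ hW i j).of_le (by decide)) (hdom i j)

theorem integral_dotProduct_mixedHess (hΩ : IsOpen Ω)
    (hW : ContDiffOn ℝ ∞ (fun p : Sp d × Sp d => W p.1 p.2) (Ω ×ˢ Ω)) (hρ : ContinuousOn ρ Ω)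
    (hΦ : ContDiffOn ℝ ∞ Φ Ω)
    (hdom : ∀ i j, DominatedDerivs Ω 1 (fun x y => mixedHess W x y i j) (fun y => pd j Φ y * ρ y))
    {x : Sp d} (hx : x ∈ Ω) (u : Fin d → ℝ) (c : ℝ) :
    ∫ y in Ω, (u ⬝ᵥ (mixedHess W x y *ᵥ grad Φ y)) * c * ρ y =
      (u ⬝ᵥ fun i => ∫ y in Ω, (mixedHess W x y *ᵥ grad Φ y) i * ρ y) * c := by
  have hint := fun i => (integrableOn_mixedHess_mulVec_of_dominated hΩ hW hρ hΦ hdom hx i).1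
  simp only [dotProduct, ← integral_const_mul]
  rw [← integral_finsetSum _ fun i _ => (hint i).const_mul _, ← integral_mul_const]
  refine integral_congr_ae (Eventually.of_forall fun y => ?_)
  simp only [Finset.sum_mul]
  exact Finset.sum_congr rfl fun i _ => by ring

theorem interactionOp_eq (hΩ : IsOpen Ω)
    (hW : ContDiffOn ℝ ∞ (fun p : Sp d × Sp d => W p.1 p.2) (Ω ×ˢ Ω)) (hν : ContinuousOn ν Ω)
    (hρ : ρ ∈ interactionDomain Ω W ν) {x : Sp d} (hx : x ∈ Ω) :
    interactionOp Ω W ν ρ Φ x =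
      -div (fun y => ρ y • fun i => ∫ z in Ω, (mixedHess W y z *ᵥ grad Φ z) i * ρ z) x
      - div (fun y => ρ y • (hess (interactionFirst Ω W ν ρ) y *ᵥ grad Φ y)) x := by
  have h : div (fun y => ρ y • ((Matrix.of fun i j =>
      ∫ z in Ω, hess (fun y' => W y' z) y i j * (ρ z - ν z)) *ᵥ grad Φ y)) x =
      div (fun y => ρ y • (hess (interactionFirst Ω W ν ρ) y *ᵥ grad Φ y)) x :=
    div_congr_on hΩ (fun y hy => by rw [hess_interactionFirst hΩ hW hν hρ hy]) hx
  rw [interactionOp, h]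

theorem contDiffOn_smul_integral_mixedHess (hΩ : IsOpen Ω)
    (hW : ContDiffOn ℝ ∞ (fun p : Sp d × Sp d => W p.1 p.2) (Ω ×ˢ Ω)) (hρ : ContDiffOn ℝ ∞ ρ Ω)
    (hΦ : ContDiffOn ℝ ∞ Φ Ω)
    (hdom : ∀ i j, DominatedDerivs Ω 1 (fun x y => mixedHess W x y i j) (fun y => pd j Φ y * ρ y))
    (i : Fin d) :
    ContDiffOn ℝ 1 (fun y => (ρ y • fun i => ∫ z in Ω,
      (mixedHess W y z *ᵥ grad Φ z) i * ρ z) i) Ω :=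
  (hρ.of_le (by decide)).mul (contDiffOn_integral_mixedHess hΩ hW hρ.continuousOn hΦ hdom i)

theorem contDiffOn_smul_hess_mulVec_grad (hΩ : IsOpen Ω) {f : Sp d → ℝ}
    (hρ : ContDiffOn ℝ ∞ ρ Ω) (hf : ContDiffOn ℝ 3 f Ω) (hΦ : ContDiffOn ℝ ∞ Φ Ω) (i : Fin d) :
    ContDiffOn ℝ 1 (fun y => (ρ y • (hess f y *ᵥ grad Φ y)) i) Ω :=
  (hρ.of_le (by decide)).mul (contDiffOn_hess_mulVec_grad hΩ hf (hΦ.of_le (by decide)) i)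

theorem continuousOn_interactionOp (hΩ : IsOpen Ω)
    (hW : ContDiffOn ℝ ∞ (fun p : Sp d × Sp d => W p.1 p.2) (Ω ×ˢ Ω)) (hν : ContinuousOn ν Ω)
    (hρ : ρ ∈ interactionDomain Ω W ν) (hΦ : ContDiffOn ℝ ∞ Φ Ω)
    (hdom : ∀ i j, DominatedDerivs Ω 1 (fun x y => mixedHess W x y i j)
      (fun y => pd j Φ y * ρ y)) :
    ContinuousOn (interactionOp Ω W ν ρ Φ) Ω :=
  ((continuousOn_div hΩ (contDiffOn_smul_integral_mixedHess hΩ hW hρ.1.smooth hΦ hdom)).neg.sub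
    (continuousOn_div hΩ (contDiffOn_smul_hess_mulVec_grad hΩ hρ.1.smooth
      (contDiffOn_interactionFirst hΩ hW hν hρ) hΦ))).congr
    fun _ hx => interactionOp_eq hΩ hW hν hρ hx

theorem IsTest.integrableOn_mul (hΩ : IsOpen Ω) {f : Sp d → ℝ} (hΨ : IsTest Ω Ψ)
    (hf : ContinuousOn f Ω) : IntegrableOn (fun x => Ψ x * f x) Ω :=
  integrableOn_of_zero_off hΩ (hΨ.continuous.continuousOn.mul hf) hΨ.isCompact hΨ.support
    fun y _ hy => by rw [hΨ.zero_off y hy, zero_mul]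

/-- The compact support sits in Ψ, so Φ may be a potential. Integrating both divergences by parts
puts Ψ in the left slot of the form. -/
theorem integral_mul_interactionOp (hΩ : IsOpen Ω)
    (hW : ContDiffOn ℝ ∞ (fun p : Sp d × Sp d => W p.1 p.2) (Ω ×ˢ Ω)) (hν : ContinuousOn ν Ω)
    (hρ : ρ ∈ interactionDomain Ω W ν) (hΦ : ContDiffOn ℝ ∞ Φ Ω)
    (hdom : ∀ i j, DominatedDerivs Ω 1 (fun x y => mixedHess W x y i j) (fun y => pd j Φ y * ρ y))
    (hΨ : IsTest Ω Ψ) :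
    ∫ x in Ω, Ψ x * interactionOp Ω W ν ρ Φ x =
      hessFormK Ω (interactionFirst Ω W ν) (fun _ => W) ρ Ψ Φ := by
  have hV := contDiffOn_smul_integral_mixedHess hΩ hW hρ.1.smooth hΦ hdom
  have hT := contDiffOn_smul_hess_mulVec_grad hΩ hρ.1.smooth
    (contDiffOn_interactionFirst hΩ hW hν hρ) hΦ
  have i1 := hΨ.integrableOn_mul hΩ (continuousOn_div hΩ hV)
  have i2 := hΨ.integrableOn_mul hΩ (continuousOn_div hΩ hT)
  have hΨ1 : ContDiffOn ℝ 1 Ψ Ω := hΨ.smooth.contDiffOn.of_le (by decide)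
  have hoff : ∀ y, y ∉ tsupport Ψ → Ψ y = 0 := fun y hy => hΨ.zero_off y hy
  rw [setIntegral_congr_fun (g := fun x => -(Ψ x * div (fun y => ρ y • fun i => ∫ z in Ω,
      (mixedHess W y z *ᵥ grad Φ z) i * ρ z) x) -
      Ψ x * div (fun y => ρ y • (hess (interactionFirst Ω W ν ρ) y *ᵥ grad Φ y)) x)
    hΩ.measurableSet fun x hx => by
      simp only [interactionOp_eq hΩ hW hν hρ hx]; ring,
    integral_sub (f := fun x => -(Ψ x * div (fun y => ρ y • fun i => ∫ z in Ω,
      (mixedHess W y z *ᵥ grad Φ z) i * ρ z) x)) i1.neg i2, integral_neg, integral_mul_div hΩ hΨ1 hV hΨ.isCompact hΨ.support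
      (Or.inl hoff), integral_mul_div hΩ hΨ1 hT hΨ.isCompact hΨ.support (Or.inl hoff), neg_neg,
    sub_neg_eq_add]
  unfold hessFormK
  congr 1
  · refine setIntegral_congr_fun hΩ.measurableSet fun x hx => ?_
    simp only [integral_dotProduct_mixedHess hΩ hW hρ.1.smooth.continuousOn hΦ hdom hx,
      dotProduct_smul, smul_eq_mul]
    ring
  · refine integral_congr_ae (Eventually.of_forall fun x => ?_)
    simp only [dotProduct_smul, smul_eq_mul]
    ring

theorem integrable_prod_mixedHess (hΩ : IsOpen Ω)
    (hW : ContDiffOn ℝ ∞ (fun p : Sp d × Sp d => W p.1 p.2) (Ω ×ˢ Ω)) (hρ : ContinuousOn ρ Ω)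
    (hΦ : ContDiffOn ℝ ∞ Φ Ω)
    (hdom : ∀ i j, DominatedDerivs Ω 1 (fun x y => mixedHess W x y i j) (fun y => pd j Φ y * ρ y))
    (hΨ : IsTest Ω Ψ) :
    Integrable (fun p : Sp d × Sp d =>
      (grad Ψ p.1 ⬝ᵥ (mixedHess W p.1 p.2 *ᵥ grad Φ p.2)) * ρ p.1 * ρ p.2)
      ((volume.restrict Ω).prod (volume.restrict Ω)) := by
  have h : Integrable (fun p : Sp d × Sp d => ∑ i, ∑ j, (pd i Ψ p.1 * ρ p.1) *
      mixedHess W p.1 p.2 i j * (pd j Φ p.2 * ρ p.2))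
      ((volume.restrict Ω).prod (volume.restrict Ω)) :=
    integrable_finsetSum _ fun i _ => integrable_finsetSum _ fun j _ =>
      integrable_prod_of_dominated (f := fun x => pd i Ψ x * ρ x)
        (h := fun y => pd j Φ y * ρ y) (F := fun x y => mixedHess W x y i j) hΩ
        (contDiffOn_mixedHess hΩ hW i j).continuousOn
        ((pd_continuousOn hΩ (hΦ.of_le (by decide)) j).mul hρ) ((hdom i j).mono (Nat.zero_le 1))
        ((hΨ.pd_continuous i).continuousOn.mul hρ) hΨ.isCompact hΨ.support fun y _ hy => by
          rw [show pd i Ψ y = 0 from congrFun (hΨ.grad_zero_off hy) i, zero_mul]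
  refine h.congr (Eventually.of_forall fun p => ?_)
  simp only [dotProduct, mulVec, grad, Finset.sum_mul, Finset.mul_sum]
  exact Finset.sum_congr rfl fun i _ => Finset.sum_congr rfl fun j _ => by ring

theorem dotProduct_mixedHess_swap (hΩ : IsOpen Ω)
    (hW : ContDiffOn ℝ ∞ (fun p : Sp d × Sp d => W p.1 p.2) (Ω ×ˢ Ω))
    (hsymm : ∀ x ∈ Ω, ∀ y ∈ Ω, W x y = W y x) {x y : Sp d} (hx : x ∈ Ω) (hy : y ∈ Ω)
    (u v : Fin d → ℝ) : u ⬝ᵥ (mixedHess W y x *ᵥ v) = v ⬝ᵥ (mixedHess W x y *ᵥ u) := by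
  have h : (mixedHess W y x)ᵀ = mixedHess W x y := by
    ext i j
    exact mixedHess_swap hΩ (hW.of_le (by decide)) hsymm hx hy i j
  rw [dotProduct_mulVec, ← mulVec_transpose, h, dotProduct_comm]

/-- `IsHessianForm.symm` only covers test functions. Here Φ may be a potential, and Fubini's theorem
is justified by the support of Ψ together with the domination. -/
theorem hessFormK_interaction_symm (hΩ : IsOpen Ω)
    (hW : ContDiffOn ℝ ∞ (fun p : Sp d × Sp d => W p.1 p.2) (Ω ×ˢ Ω))
    (hsymm : ∀ x ∈ Ω, ∀ y ∈ Ω, W x y = W y x) (hν : ContinuousOn ν Ω)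
    (hρ : ρ ∈ interactionDomain Ω W ν) (hΦ : ContDiffOn ℝ ∞ Φ Ω)
    (hdom : ∀ i j, DominatedDerivs Ω 1 (fun x y => mixedHess W x y i j) (fun y => pd j Φ y * ρ y))
    (hΨ : IsTest Ω Ψ) :
    hessFormK Ω (interactionFirst Ω W ν) (fun _ => W) ρ Φ Ψ =
      hessFormK Ω (interactionFirst Ω W ν) (fun _ => W) ρ Ψ Φ := by
  unfold hessFormK
  congr 1
  · rw [integral_integral_swap (f := fun x y =>
      (grad Ψ x ⬝ᵥ (mixedHess W x y *ᵥ grad Φ y)) * ρ x * ρ y)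
      (integrable_prod_mixedHess hΩ hW hρ.1.smooth.continuousOn hΦ hdom hΨ)]
    refine setIntegral_congr_fun hΩ.measurableSet fun x hx =>
      setIntegral_congr_fun hΩ.measurableSet fun y hy => ?_
    simp only [dotProduct_mixedHess_swap hΩ hW hsymm hx hy]
    ring
  · refine setIntegral_congr_fun hΩ.measurableSet fun x hx => ?_
    simp only [dotProduct_hess_mulVec_comm (((contDiffOn_interactionFirst hΩ hW hν hρ).contDiffAt
      (hΩ.mem_nhds hx)).of_le (by norm_num)) (grad Φ x)]

theorem integrable_prod_hess (hΩ : IsOpen Ω)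
    (hW : ContDiffOn ℝ ∞ (fun p : Sp d × Sp d => W p.1 p.2) (Ω ×ˢ Ω)) (hν : ContinuousOn ν Ω)
    (hρ : ρ ∈ interactionDomain Ω W ν) (hΦ : IsTest Ω Φ) :
    Integrable (fun p : Sp d × Sp d =>
      (grad Φ p.1 ⬝ᵥ (hess (fun x' => W x' p.2) p.1 *ᵥ grad Φ p.1)) * ρ p.1 * (ρ p.2 - ν p.2))
      ((volume.restrict Ω).prod (volume.restrict Ω)) := by
  have hc := hρ.1.smooth.continuousOn
  have h : Integrable (fun p : Sp d × Sp d => ∑ i, ∑ j, (pd i Φ p.1 * pd j Φ p.1 * ρ p.1) *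
      hess (fun x' => W x' p.2) p.1 i j * (ρ p.2 - ν p.2))
      ((volume.restrict Ω).prod (volume.restrict Ω)) :=
    integrable_finsetSum _ fun i _ => integrable_finsetSum _ fun j _ =>
      integrable_prod_of_dominated (f := fun x => pd i Φ x * pd j Φ x * ρ x)
        (h := fun y => ρ y - ν y) (F := fun x y => hess (fun x' => W x' y) x i j) hΩ
        (contDiffOn_hess_left hΩ hW i j).continuousOn (hc.sub hν)
        ((dominatedDerivs_hess hΩ hW hρ i j).mono (Nat.zero_le 1))
        (((hΦ.pd_continuous i).mul (hΦ.pd_continuous j)).continuousOn.mul hc) hΦ.isCompact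
        hΦ.support fun y _ hy => by
          rw [show pd i Φ y = 0 from congrFun (hΦ.grad_zero_off hy) i, zero_mul, zero_mul]
  refine h.congr (Eventually.of_forall fun p => ?_)
  simp only [dotProduct, mulVec, grad, Finset.sum_mul, Finset.mul_sum]
  exact Finset.sum_congr rfl fun i _ => Finset.sum_congr rfl fun j _ => by ring

theorem integral_hess_interaction (hΩ : IsOpen Ω)
    (hW : ContDiffOn ℝ ∞ (fun p : Sp d × Sp d => W p.1 p.2) (Ω ×ˢ Ω)) (hν : ContinuousOn ν Ω)
    (hρ : ρ ∈ interactionDomain Ω W ν) (u : Fin d → ℝ) (c : ℝ) {x : Sp d} (hx : x ∈ Ω) :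
    ∫ y in Ω, (u ⬝ᵥ (hess (fun x' => W x' y) x *ᵥ u)) * c * (ρ y - ν y) =
      (u ⬝ᵥ (hess (interactionFirst Ω W ν ρ) x *ᵥ u)) * c := by
  have hint : ∀ i j, IntegrableOn (fun y => hess (fun x' => W x' y) x i j * (ρ y - ν y)) Ω :=
    fun i j => (dominatedDerivs_hess hΩ hW hρ i j).integrableOn hΩ
      (contDiffOn_hess_left hΩ hW i j).continuousOn (hρ.1.smooth.continuousOn.sub hν) hx
  rw [hess_interactionFirst hΩ hW hν hρ hx]
  simp only [dotProduct, mulVec, Matrix.of_apply, Finset.mul_sum, Finset.sum_mul]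
  rw [integral_finsetSum _ fun i _ => integrable_finsetSum _ fun j _ =>
    ((hint i j).const_mul (u i * u j * c)).congr (Eventually.of_forall fun y => by
      simp only; ring)]
  refine Finset.sum_congr rfl fun i _ => ?_
  rw [integral_finsetSum _ fun j _ =>
    ((hint i j).const_mul (u i * u j * c)).congr (Eventually.of_forall fun y => by
      simp only; ring)]
  refine Finset.sum_congr rfl fun j _ => ?_
  rw [integral_congr_ae (g := fun y => (u i * u j * c) *
    (hess (fun x' => W x' y) x i j * (ρ y - ν y))) (Eventually.of_forall fun y => by
      simp only; ring), integral_const_mul]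
  ring

theorem sumElim_dotProduct_fromBlocks (A B C : Matrix (Fin d) (Fin d) ℝ) (u v : Fin d → ℝ) :
    Sum.elim u v ⬝ᵥ (Matrix.fromBlocks A B Bᵀ C *ᵥ Sum.elim u v) =
      u ⬝ᵥ (A *ᵥ u) + 2 * (u ⬝ᵥ (B *ᵥ v)) + v ⬝ᵥ (C *ᵥ v) := by
  have h : v ⬝ᵥ (Bᵀ *ᵥ u) = u ⬝ᵥ (B *ᵥ v) := by
    rw [dotProduct_mulVec, vecMul_transpose, dotProduct_comm]
  have h2 : ∀ a b : Fin d → ℝ, Sum.elim u v ⬝ᵥ Sum.elim a b = u ⬝ᵥ a + v ⬝ᵥ b := fun a b => by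
    simp [dotProduct]
  rw [fromBlocks_mulVec, h2]
  simp only [Sum.elim_comp_inl, Sum.elim_comp_inr, dotProduct_add, h]
  ring

/-- By symmetry of W the lower right block is the upper left one with x and y exchanged. The block
integrand is thus H + 2M + H∘swap, whose integral is twice the Hessian form; ν = 0 lets H carry the
same weight ρ(x)ρ(y). -/
theorem hessFormK_interaction_eq_blocks (hΩ : IsOpen Ω)
    (hW : ContDiffOn ℝ ∞ (fun p : Sp d × Sp d => W p.1 p.2) (Ω ×ˢ Ω))
    (hsymm : ∀ x ∈ Ω, ∀ y ∈ Ω, W x y = W y x) (hρ : ρ ∈ interactionDomain Ω W 0)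
    (hΦ : IsTest Ω Φ) :
    hessFormK Ω (interactionFirst Ω W 0) (fun _ => W) ρ Φ Φ =
      (1 / 2) * ∫ x in Ω, ∫ y in Ω,
        (Sum.elim (grad Φ x) (grad Φ y) ⬝ᵥ
          (Matrix.fromBlocks
              (hess (fun x' => W x' y) x) (mixedHess W x y)
              (mixedHess W x y)ᵀ (hess (fun y' => W x y') y) *ᵥ
            Sum.elim (grad Φ x) (grad Φ y))) * ρ x * ρ y := by
  have hν : ContinuousOn (0 : Sp d → ℝ) Ω := continuousOn_const
  have hρc := hρ.1.smooth.continuousOn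
  set H : Sp d × Sp d → ℝ := fun p =>
    (grad Φ p.1 ⬝ᵥ (hess (fun x' => W x' p.2) p.1 *ᵥ grad Φ p.1)) * ρ p.1 * ρ p.2 with hH
  set M : Sp d × Sp d → ℝ := fun p =>
    (grad Φ p.1 ⬝ᵥ (mixedHess W p.1 p.2 *ᵥ grad Φ p.2)) * ρ p.1 * ρ p.2 with hM
  have iH : Integrable H ((volume.restrict Ω).prod (volume.restrict Ω)) := by
    simpa using integrable_prod_hess hΩ hW hν hρ hΦ
  have iM : Integrable M ((volume.restrict Ω).prod (volume.restrict Ω)) :=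
    integrable_prod_mixedHess hΩ hW hρc hΦ.smooth.contDiffOn
      (dominatedDerivs_mixedHess_of_isTest hΩ hW hρc hΦ) hΦ
  have e1 : ∫ x in Ω, ∫ y in Ω, M (x, y) =
      ∫ p, M p ∂(volume.restrict Ω).prod (volume.restrict Ω) := (integral_prod _ iM).symm
  have e2 : ∫ x in Ω, (grad Φ x ⬝ᵥ (hess (interactionFirst Ω W 0 ρ) x *ᵥ grad Φ x)) * ρ x =
      ∫ p, H p ∂(volume.restrict Ω).prod (volume.restrict Ω) := by
    rw [integral_prod _ iH]
    refine setIntegral_congr_fun hΩ.measurableSet fun x hx => ?_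
    have := integral_hess_interaction hΩ hW hν hρ (grad Φ x) (ρ x) hx
    simp only [Pi.zero_apply, sub_zero] at this
    exact this.symm
  have e3 : ∫ p, H p.swap ∂(volume.restrict Ω).prod (volume.restrict Ω) =
      ∫ p, H p ∂(volume.restrict Ω).prod (volume.restrict Ω) := integral_prod_swap H
  have hcongr : ∀ x ∈ Ω, ∀ y ∈ Ω, (Sum.elim (grad Φ x) (grad Φ y) ⬝ᵥ
      (Matrix.fromBlocks (hess (fun x' => W x' y) x) (mixedHess W x y)
        (mixedHess W x y)ᵀ (hess (fun y' => W x y') y) *ᵥ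
          Sum.elim (grad Φ x) (grad Φ y))) * ρ x * ρ y =
      (H + ((2 : ℝ) • M + H ∘ Prod.swap)) (x, y) := fun x hx y hy => by
    rw [sumElim_dotProduct_fromBlocks, hess_right_eq hΩ hsymm hx hy]
    simp only [hH, hM, Pi.add_apply, Pi.smul_apply, smul_eq_mul, Function.comp, Prod.swap_prod_mk]
    ring
  have e4 : ∫ x in Ω, ∫ y in Ω, (H + ((2 : ℝ) • M + H ∘ Prod.swap)) (x, y) =
      ∫ p, (H + ((2 : ℝ) • M + H ∘ Prod.swap)) p
        ∂(volume.restrict Ω).prod (volume.restrict Ω) :=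
    (integral_prod _ (iH.add ((iM.smul (2 : ℝ)).add iH.swap))).symm
  rw [setIntegral_congr_fun hΩ.measurableSet fun x hx =>
    setIntegral_congr_fun hΩ.measurableSet fun y hy => hcongr x hx y hy, e4,
    integral_add' iH ((iM.smul (2 : ℝ)).add iH.swap), integral_add' (iM.smul (2 : ℝ)) iH.swap]
  have e5 : ∫ p, (H ∘ Prod.swap) p ∂(volume.restrict Ω).prod (volume.restrict Ω) =
      ∫ p, H p ∂(volume.restrict Ω).prod (volume.restrict Ω) := e3
  have e6 : ∫ p, ((2 : ℝ) • M) p ∂(volume.restrict Ω).prod (volume.restrict Ω) =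
      2 * ∫ p, M p ∂(volume.restrict Ω).prod (volume.restrict Ω) := integral_const_mul _ _
  rw [e5, e6]
  unfold hessFormK
  rw [e2]
  change (∫ x in Ω, ∫ y in Ω, M (x, y)) + _ = _
  rw [e1]
  ring

/-- `InteractionL2` bounds the mixed Hessian for the first variable in a compact set. Here the
second variable runs over the compact support of Ψ, so `mixedHess_swap` exchanges them and the field
at x is bounded by |g x| times a constant. -/
theorem mixedL2_interaction (hΩ : IsOpen Ω)
    (hW : ContDiffOn ℝ ∞ (fun p : Sp d × Sp d => W p.1 p.2) (Ω ×ˢ Ω))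
    (hsymm : ∀ x ∈ Ω, ∀ y ∈ Ω, W x y = W y x) (hν : ContinuousOn ν Ω)
    (hρ : ρ ∈ interactionDomain Ω W ν) (hL : InteractionL2 Ω W ρ) :
    MixedL2 Ω (kernelOp Ω fun _ => W) ρ := by
  intro Ψ hΨ
  have hρs := hρ.1.smooth
  have hW2 : ContDiffOn ℝ 2 (fun p : Sp d × Sp d => W p.1 p.2) (Ω ×ˢ Ω) := hW.of_le (by decide)
  have hc := mixedAction_continuousOn hΩ (hasVariations_interaction hΩ hW hsymm hν) hρ hρs hΨ
  obtain ⟨g, hg, hle⟩ := hL _ hΨ.isCompact hΨ.support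
  have hi : ∀ j, IntegrableOn (fun y => |pd j Ψ y * ρ y|) Ω := fun j =>
    (integrableOn_of_zero_off hΩ ((hΨ.pd_continuous j).continuousOn.mul hρs.continuousOn)
      hΨ.isCompact hΨ.support fun y _ hy => by
        rw [Pi.mul_apply, show pd j Ψ y = 0 from congrFun (hΨ.grad_zero_off hy) j, zero_mul]).abs
  set C : ℝ := ∑ j, ∫ y in Ω, |pd j Ψ y * ρ y| with hC
  have hC0 : 0 ≤ C := Finset.sum_nonneg fun j _ => integral_nonneg fun y => abs_nonneg _
  have hdom := dominatedDerivs_mixedHess_of_isTest hΩ hW hρs.continuousOn hΨ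
  have hbound : ∀ x ∈ Ω, ∀ i, |mixedAction (kernelOp Ω fun _ => W) ρ Ψ x i| ≤ |g x| * C := by
    intro x hx i
    rw [mixedAction_kernelOp hΩ hρs hW2 hΨ hx,
      (integrableOn_mixedHess_mulVec_of_dominated hΩ hW hρs.continuousOn hΨ.smooth.contDiffOn
        hdom hx i).2, hC, Finset.mul_sum]
    refine (Finset.abs_sum_le_sum_abs _ _).trans (Finset.sum_le_sum fun j _ => ?_)
    rw [← integral_const_mul, ← Real.norm_eq_abs]
    refine norm_integral_le_of_norm_le ((hi j).const_mul _) ?_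
    filter_upwards [ae_restrict_mem hΩ.measurableSet] with y hy
    rw [norm_mul]
    by_cases hyS : y ∈ tsupport Ψ
    · refine mul_le_mul_of_nonneg_right ?_ (norm_nonneg _)
      rw [Real.norm_eq_abs, ← mixedHess_swap hΩ hW2 hsymm hx hy]
      exact ((hle y hyS x hx j i).1).trans (le_abs_self _)
    · rw [show pd j Ψ y = 0 from congrFun (hΨ.grad_zero_off hyS) j]
      simp
  refine Integrable.mono' (hg.const_mul (d * C ^ 2))
    (((continuousOn_dotProduct hc hc).mul hρs.continuousOn).aestronglyMeasurable
      hΩ.measurableSet) ?_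
  filter_upwards [ae_restrict_mem hΩ.measurableSet] with x hx
  rw [Real.norm_of_nonneg (dotProduct_self_mul_nonneg _ (hρ.1.nonneg x)), ← mul_assoc]
  refine mul_le_mul_of_nonneg_right ?_ (hρ.1.nonneg x)
  calc _ ≤ ∑ _i : Fin d, C ^ 2 * g x ^ 2 := Finset.sum_le_sum fun i _ => by
        have h1 := pow_le_pow_left₀ (abs_nonneg _) (hbound x hx i) 2
        rw [sq_abs, mul_pow, sq_abs] at h1
        linarith
    _ = _ := by
        simp only [Finset.sum_const, Finset.card_univ, Fintype.card_fin, nsmul_eq_mul]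
        ring

theorem integral_test_mul_eq_iff (hΩ : IsOpen Ω) {f g : Sp d → ℝ} (hf : ContinuousOn f Ω)
    (hg : ContinuousOn g Ω) :
    (∀ Ψ, IsTest Ω Ψ → ∫ x in Ω, Ψ x * f x = ∫ x in Ω, Ψ x * g x) ↔ ∀ x ∈ Ω, f x = g x := by
  constructor
  · intro h x hx
    refine sub_eq_zero.1 (eq_zero_of_integral_test_mul hΩ (hf.sub hg) (fun Ψ hΨ => ?_) x hx)
    rw [← sub_eq_zero.2 (h Ψ hΨ), ← integral_sub (hΨ.integrableOn_mul hΩ hf)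
      (hΨ.integrableOn_mul hΩ hg)]
    exact integral_congr_ae (Eventually.of_forall fun y => mul_sub _ _ _)
  · exact fun h Ψ _ => setIntegral_congr_fun hΩ.measurableSet fun x hx => by simp only [h x hx]

theorem isHessianForm_interaction (hΩ : IsOpen Ω)
    (hW : ContDiffOn ℝ ∞ (fun p : Sp d × Sp d => W p.1 p.2) (Ω ×ˢ Ω))
    (hsymm : ∀ x ∈ Ω, ∀ y ∈ Ω, W x y = W y x) (hν : ContinuousOn ν Ω)
    (hρ : ρ ∈ interactionDomain Ω W ν) :
    IsHessianForm Ω (interactionEnergy Ω W ν) ρ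
      (hessFormK Ω (interactionFirst Ω W ν) (fun _ => W) ρ) :=
  (isHessianForm_hessFormL hΩ (energyDomain_interactionDomain hΩ hW hsymm hν)
    (hasVariations_interaction hΩ hW hsymm hν) hρ).congr fun _ _ _ hΨ =>
      hessFormK_eq_hessFormL hΩ hρ.1.smooth (hW.of_le (by decide)) hΨ

theorem isNewtonFlow_interaction_iff (hΩ : IsOpen Ω)
    (hW : ContDiffOn ℝ ∞ (fun p : Sp d × Sp d => W p.1 p.2) (Ω ×ˢ Ω))
    (hsymm : ∀ x ∈ Ω, ∀ y ∈ Ω, W x y = W y x) (hν : ContinuousOn ν Ω) {J : Set ℝ}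
    {r : ℝ → Sp d → ℝ}
    (hr : ∀ t ∈ J, r t ∈ interactionDomain Ω W ν ∧ InteractionL2 Ω W (r t)) :
    IsNewtonFlow Ω (interactionEnergy Ω W ν) (interactionFirst Ω W ν) J r ↔
      ∃ Φ : ℝ → Sp d → ℝ, FlowEquation Ω J r Φ ∧
        ∀ t ∈ J, ∀ x ∈ Ω, interactionOp Ω W ν (r t) (Φ t) x =
          wDiv (r t) (interactionFirst Ω W ν (r t)) x := by
  have hA := energyDomain_interactionDomain hΩ hW hsymm hν
  have hV := hasVariations_interaction hΩ hW hsymm hν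
  rw [isNewtonFlow_iff hΩ hA hV fun t ht =>
    ⟨(hr t ht).1, mixedL2_interaction hΩ hW hsymm hν (hr t ht).1 (hr t ht).2⟩]
  refine exists_congr fun Φ => and_congr_right fun hF => forall₂_congr fun t ht => ?_
  have hρ := (hr t ht).1
  have hΦ := (hF t ht).1
  have hdom := dominatedDerivs_mixedHess_of_isPotential hΩ hρ.1 (hr t ht).2 hΦ
  rw [← integral_test_mul_eq_iff hΩ (continuousOn_interactionOp hΩ hW hν hρ hΦ.1 hdom)
    (continuousOn_wDiv_first hΩ hA hV hρ)]
  refine forall₂_congr fun Ψ hΨ => ?_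
  rw [integral_mul_interactionOp hΩ hW hν hρ hΦ.1 hdom hΨ,
    ← hessFormK_interaction_symm hΩ hW hsymm hν hρ hΦ.1 hdom hΨ,
    hessFormK_eq_hessFormL hΩ hρ.1.smooth (hW.of_le (by decide)) hΨ]

end InteractionHessian

end WassersteinNewton

namespace WassersteinNewton

/-! ### Cross entropy and reverse Kullback–Leibler divergence, treated together. -/

section CrossEntropy

variable {d : ℕ} {Ω K : Set (Sp d)} {ρs ρ σ Φ Ψ : Sp d → ℝ} {A : Set (Sp d → ℝ)}
  {E : (Sp d → ℝ) → ℝ}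

/-- `E ρ = -∫ h(ρ) dx` on the positive densities with integrable `h(ρ)`, where
`h(ρ') - h(ρ) = (log ρ' - log ρ) ρ*`. -/
def IsLogEnergy (Ω : Set (Sp d)) (ρs : Sp d → ℝ) (A : Set (Sp d → ℝ))
    (E : (Sp d → ℝ) → ℝ) : Prop :=
  ∃ h : (Sp d → ℝ) → Sp d → ℝ,
    (∀ ρ, ρ ∈ A ↔ Density Ω ρ ∧ (∀ x ∈ Ω, 0 < ρ x) ∧ IntegrableOn (h ρ) Ω) ∧
    (∀ ρ, E ρ = -∫ x in Ω, h ρ x) ∧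
    ∀ ρ ρ' : Sp d → ℝ, ∀ x, 0 < ρ x → 0 < ρ' x →
      h ρ' x - h ρ x = ρs x * (Real.log (ρ' x) - Real.log (ρ x))

theorem isLogEnergy_crossEntropy :
    IsLogEnergy Ω ρs (crossEntropyDomain Ω ρs) (crossEntropy Ω ρs) :=
  ⟨fun ρ x => Real.log (ρ x) * ρs x, fun _ => Iff.rfl, fun _ => rfl, fun _ _ _ _ _ => by ring⟩

theorem isLogEnergy_reverseKL :
    IsLogEnergy Ω ρs (reverseKLDomain Ω ρs) (reverseKL Ω ρs) := by
  refine ⟨fun ρ x => Real.log (ρ x / ρs x) * ρs x, fun _ => Iff.rfl, fun _ => rfl,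
    fun ρ ρ' x h h' => ?_⟩
  -- Where ρ* vanishes the quotient is a default value, but the factor ρ* removes it.
  by_cases h0 : ρs x = 0
  · simp [h0]
  · simp only [Real.log_div h.ne' h0, Real.log_div h'.ne' h0]
    ring

theorem IsLogEnergy.pos (hE : IsLogEnergy Ω ρs A E) (hρ : ρ ∈ A) : ∀ x ∈ Ω, 0 < ρ x := by
  obtain ⟨h, hA, -⟩ := hE
  exact ((hA ρ).1 hρ).2.1

theorem IsLogEnergy.density (hE : IsLogEnergy Ω ρs A E) (hρ : ρ ∈ A) : Density Ω ρ := by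
  obtain ⟨h, hA, -⟩ := hE
  exact ((hA ρ).1 hρ).1

theorem integrableOn_mul_log_sub_log (hΩ : IsOpen Ω) {ρ' : Sp d → ℝ} (hρs : ContinuousOn ρs Ω)
    (hρ : ContinuousOn ρ Ω) (hρ' : ContinuousOn ρ' Ω) (h : ∀ x ∈ Ω, 0 < ρ x)
    (h' : ∀ x ∈ Ω, 0 < ρ' x) (hσ : IsTest Ω (ρ' - ρ)) :
    IntegrableOn (fun x => ρs x * (Real.log (ρ' x) - Real.log (ρ x))) Ω := by
  refine integrableOn_of_zero_off hΩ (hρs.mul ((hρ'.log fun x hx => (h' x hx).ne').sub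
    (hρ.log fun x hx => (h x hx).ne'))) hσ.isCompact hσ.support fun y _ hy => ?_
  have : ρ' y = ρ y := sub_eq_zero.1 (hσ.zero_off y hy)
  rw [this, sub_self, mul_zero]

theorem IsLogEnergy.energyDomain (hΩ : IsOpen Ω) (hρs : Density Ω ρs)
    (hE : IsLogEnergy Ω ρs A E) : EnergyDomain Ω A := by
  refine ⟨fun ρ hρ => hE.density hρ, fun ρ hρ ρ' hρ' hσ hpos => ?_⟩
  obtain ⟨h, hA, -, hh⟩ := hE
  obtain ⟨hρD, hρpos, hρi⟩ := (hA ρ).1 hρ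
  have hpos' := hpos hρpos
  refine (hA ρ').2 ⟨hρ', hpos', ?_⟩
  refine (hρi.add (integrableOn_mul_log_sub_log hΩ hρs.smooth.continuousOn
    hρD.smooth.continuousOn hρ'.smooth.continuousOn hρpos hpos' hσ)).congr_fun
    (fun x hx => ?_) hΩ.measurableSet
  rw [Pi.add_apply, ← hh ρ ρ' x (hρpos x hx) (hpos' x hx), add_sub_cancel]

theorem exists_pos_add_mul (hρ : ContinuousOn ρ Ω) (hpos : ∀ x ∈ Ω, 0 < ρ x)
    (hσ : IsTest Ω σ) : ∃ δ > 0, ∀ s ∈ Ioo (-δ) δ, ∀ x ∈ Ω, 0 < ρ x + s * σ x := by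
  obtain ⟨c, hc, hle⟩ := hσ.isCompact.exists_forall_le' (hρ.mono hσ.support)
    fun x hx => hpos x (hσ.support hx)
  obtain ⟨B, hB⟩ := hσ.isCompact.exists_bound_of_continuousOn hσ.continuous.continuousOn
  -- c is a positive lower bound for ρ on the support of σ and |B| + 1 exceeds |σ| there, so |s σ| <
  -- c.
  refine ⟨c / (|B| + 1), by positivity, fun s hs x hx => ?_⟩
  by_cases hxS : x ∈ tsupport σ
  · have h1 : |s| < c / (|B| + 1) := abs_lt.2 hs
    have h2 : |σ x| ≤ |B| + 1 := (hB x hxS).trans ((le_abs_self B).trans (by linarith))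
    have h3 : |s * σ x| < c := by
      rw [abs_mul]
      calc |s| * |σ x| ≤ |s| * (|B| + 1) := mul_le_mul_of_nonneg_left h2 (abs_nonneg _)
        _ < c / (|B| + 1) * (|B| + 1) := mul_lt_mul_of_pos_right h1 (by positivity)
        _ = c := div_mul_cancel₀ _ (by positivity)
    linarith [hle x hxS, (abs_lt.1 h3).1]
  · rw [hσ.zero_off x hxS, mul_zero, add_zero]
    exact hpos x hx

/-- Only the difference from E ρ is differentiated: its integrand is ρ* times a function of (s, x)
that is smooth on Ω for small s and supported in the support of σ. -/
theorem IsLogEnergy.hasDerivAt (hΩ : IsOpen Ω) (hρs : Density Ω ρs) (hE : IsLogEnergy Ω ρs A E)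
    (hρ : ρ ∈ A) (hσ : IsTest Ω σ) :
    HasDerivAt (fun t : ℝ => E (ρ + t • σ)) (∫ x in Ω, crossEntropyFirst ρs ρ x * σ x) 0 := by
  obtain ⟨h, hA, hEh, hh⟩ := hE
  obtain ⟨hρD, hpos, hi⟩ := (hA ρ).1 hρ
  obtain ⟨δ, hδ, hδpos⟩ := exists_pos_add_mul hρD.smooth.continuousOn hpos hσ
  have h0 : (0 : ℝ) ∈ Ioo (-δ) δ := ⟨by linarith, hδ⟩
  have hG : ContDiffOn ℝ ∞ (fun p : ℝ × Sp d => Real.log (ρ p.2 + p.1 * σ p.2) -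
      Real.log (ρ p.2)) (Ioo (-δ) δ ×ˢ Ω) := by
    have hρ2 : ContDiffOn ℝ ∞ (fun p : ℝ × Sp d => ρ p.2) (Ioo (-δ) δ ×ˢ Ω) :=
      hρD.smooth.comp contDiffOn_snd fun p hp => hp.2
    have hσ2 : ContDiffOn ℝ ∞ (fun p : ℝ × Sp d => σ p.2) (Ioo (-δ) δ ×ˢ Ω) :=
      (hσ.smooth.comp contDiff_snd).contDiffOn
    exact ((hρ2.add (contDiffOn_fst.mul hσ2)).log
      fun p hp => (hδpos p.1 hp.1 p.2 hp.2).ne').sub (hρ2.log fun p hp => (hpos p.2 hp.2).ne')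
  have hd := (hasDerivAt_integral_mul (G := fun s x => Real.log (ρ x + s * σ x) -
    Real.log (ρ x)) isOpen_Ioo hΩ hρs.smooth.continuousOn hG hσ.isCompact hσ.support
    (fun s _ y hy => by simp [hσ.zero_off y hy]) h0).const_sub (E ρ)
  have hval : -∫ x in Ω, ρs x * deriv (fun s => Real.log (ρ x + s * σ x) - Real.log (ρ x)) 0 =
      ∫ x in Ω, crossEntropyFirst ρs ρ x * σ x := by
    rw [← integral_neg]
    refine setIntegral_congr_fun hΩ.measurableSet fun x hx => ?_
    have hρx := (hpos x hx).ne'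
    have h1 : HasDerivAt (fun s : ℝ => ρ x + s * σ x) (σ x) 0 := by
      simpa using ((hasDerivAt_id (0 : ℝ)).mul_const (σ x)).const_add (ρ x)
    have h2 := (h1.log (by simpa using hρx)).sub_const (Real.log (ρ x))
    simp only [h2.deriv, crossEntropyFirst]
    simp only [zero_mul, add_zero]
    ring
  rw [hval] at hd
  refine hd.congr_of_eventuallyEq ?_
  filter_upwards [Ioo_mem_nhds h0.1 h0.2] with s hs
  have hpos' : ∀ x ∈ Ω, 0 < (ρ + s • σ) x := hδpos s hs
  have hint := integrableOn_mul_log_sub_log hΩ (ρ' := ρ + s • σ) hρs.smooth.continuousOn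
    hρD.smooth.continuousOn
    (hρD.smooth.continuousOn.add (continuousOn_const.smul hσ.continuous.continuousOn))
    hpos hpos' (by rw [add_sub_cancel_left]; exact hσ.smul s)
  have he : ∫ x in Ω, h (ρ + s • σ) x = ∫ x in Ω, (h ρ x +
      ρs x * (Real.log ((ρ + s • σ) x) - Real.log (ρ x))) :=
    setIntegral_congr_fun hΩ.measurableSet fun x hx => by
      simp only [← hh ρ (ρ + s • σ) x (hpos x hx) (hpos' x hx)]
      ring
  rw [hEh, hEh, he, integral_add hi hint]
  simp only [Pi.add_apply, Pi.smul_apply, smul_eq_mul]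
  ring

theorem contDiffOn_crossEntropyFirst (hρs : ContDiffOn ℝ ∞ ρs Ω) (hρ : ContDiffOn ℝ ∞ ρ Ω)
    (hpos : ∀ x ∈ Ω, 0 < ρ x) : ContDiffOn ℝ ∞ (crossEntropyFirst ρs ρ) Ω :=
  (hρs.div hρ fun x hx => (hpos x hx).ne').neg

theorem contDiffOn_crossEntropySecond (hρs : ContDiffOn ℝ ∞ ρs Ω) (hρ : ContDiffOn ℝ ∞ ρ Ω)
    (hpos : ∀ x ∈ Ω, 0 < ρ x) (hσ : ContDiffOn ℝ ∞ σ Ω) :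
    ContDiffOn ℝ ∞ (crossEntropySecond ρs ρ σ) Ω :=
  (hρs.div (hρ.pow 2) fun x hx => pow_ne_zero 2 (hpos x hx).ne').mul hσ

theorem tendstoLocallyUniformlyOn_of_sub {ρn : ℕ → Sp d → ℝ}
    (h : TestTendsto Ω (fun n => ρn n - ρ) 0) : TendstoLocallyUniformlyOn ρn ρ atTop Ω := by
  refine TendstoUniformlyOn.tendstoLocallyUniformlyOn ?_
  have h1 := h.tendstoUniformlyOn Ω
  rw [Metric.tendstoUniformlyOn_iff] at h1 ⊢
  intro ε hε
  filter_upwards [h1 ε hε] with n hn x hx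
  have := hn x hx
  rw [dist_comm, Real.dist_eq] at this ⊢
  simpa using this

theorem IsLogEnergy.hasVariations (hΩ : IsOpen Ω) (hρs : Density Ω ρs)
    (hE : IsLogEnergy Ω ρs A E) :
    HasVariations Ω A E (crossEntropyFirst ρs) (crossEntropySecond ρs) where
  first_regular ρ hρ := (contDiffOn_crossEntropyFirst hρs.smooth (hE.density hρ).smooth
    (hE.pos hρ)).of_le (by decide)
  first ρ hρ ρ' _ hσ := (hE.hasDerivAt hΩ hρs hρ hσ).hasDerivWithinAt
  second ρ hρ ρ' _ _ x hx := by
    have hρx := (hE.pos hρ x hx).ne'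
    have h1 : HasDerivAt (fun t : ℝ => (ρ + t • (ρ' - ρ)) x) ((ρ' - ρ) x) 0 := by
      simpa using ((hasDerivAt_id (0 : ℝ)).mul_const ((ρ' - ρ) x)).const_add (ρ x)
    have h2 := (((hasDerivAt_const (0 : ℝ) (ρs x)).div h1 (by simpa using hρx)).neg)
    refine (h2.congr_deriv ?_).hasDerivWithinAt
    simp [crossEntropySecond]
    ring
  second_regular ρ hρ σ hσ := (contDiffOn_crossEntropySecond hρs.smooth (hE.density hρ).smooth
    (hE.pos hρ) hσ.1.smooth.contDiffOn).of_le (by decide)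
  second_add ρ _ σ τ _ _ x _ := mul_add _ _ _
  second_smul ρ _ c σ _ x _ := mul_left_comm _ _ _
  second_symm ρ _ σ τ _ _ := by
    refine integral_congr_ae (Eventually.of_forall fun x => ?_)
    simp only [crossEntropySecond]
    ring
  first_continuous ρ hρ ρn _ h := by
    have hconst : TendstoLocallyUniformlyOn (fun _ : ℕ => ρs) ρs atTop Ω := fun u hu x _ =>
      ⟨univ, univ_mem, Eventually.of_forall fun n y _ => refl_mem_uniformity hu⟩
    exact (hconst.fun_div₀ (tendstoLocallyUniformlyOn_of_sub h) hρs.smooth.continuousOn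
      (hE.density hρ).smooth.continuousOn fun x hx => (hE.pos hρ x hx).ne').neg
  second_continuous ρ hρ ρn _ h σ σn hσ _ h' := by
    have hconst : TendstoLocallyUniformlyOn (fun _ : ℕ => ρs) ρs atTop Ω := fun u hu x _ =>
      ⟨univ, univ_mem, Eventually.of_forall fun n y _ => refl_mem_uniformity hu⟩
    have hρc := (hE.density hρ).smooth.continuousOn
    have h1 := tendstoLocallyUniformlyOn_of_sub h
    have h2 := h1.fun_mul₀ h1 hρc hρc
    have hne : ∀ x ∈ Ω, ρ x * ρ x ≠ 0 := fun x hx => (mul_pos (hE.pos hρ x hx)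
      (hE.pos hρ x hx)).ne'
    have h3 := (hconst.fun_div₀ h2 hρs.smooth.continuousOn (hρc.mul hρc) hne).fun_mul₀
      (h'.tendstoUniformlyOn Ω).tendstoLocallyUniformlyOn
      (hρs.smooth.continuousOn.div (hρc.mul hρc) hne) hσ.1.continuous.continuousOn
    simp only [← sq] at h3
    exact h3

/-- The second variation is a multiplication operator, so the field keeps the support of Ψ; this is
why the flow statement needs no growth condition. -/
theorem IsLogEnergy.mixedL2 (hΩ : IsOpen Ω) (hρs : Density Ω ρs) (hE : IsLogEnergy Ω ρs A E)
    (hρ : ρ ∈ A) : MixedL2 Ω (crossEntropySecond ρs) ρ := by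
  intro Ψ hΨ
  have hρD := hE.density hρ
  have hc := mixedAction_continuousOn hΩ (hE.hasVariations hΩ hρs) hρ hρD.smooth hΨ
  refine integrableOn_of_zero_off hΩ ((continuousOn_dotProduct hc hc).mul hρD.smooth.continuousOn)
    hΨ.isCompact hΨ.support fun y _ hy => ?_
  have h : mixedAction (crossEntropySecond ρs) ρ Ψ y = 0 := by
    rw [mixedAction, grad_eq_zero_off hΨ.isCompact.isClosed (fun z hz => ?_) hy,
      neg_zero]
    rw [crossEntropySecond, wDiv_zero_off hΨ.isCompact.isClosed hΨ.zero_off hz, mul_zero]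
  rw [h, zero_dotProduct, zero_mul]

theorem hess_crossEntropyFirst (x : Sp d) :
    hess (crossEntropyFirst ρs ρ) x = -hess (fun z => ρs z / ρ z) x := by
  ext i j
  have h : pd j (crossEntropyFirst ρs ρ) = fun y => -pd j (fun z => ρs z / ρ z) y :=
    funext fun y => pd_neg j
  simp only [hess, Matrix.of_apply, Matrix.neg_apply, h, pd_neg]

theorem IsLogEnergy.hessFormL_self (hΩ : IsOpen Ω) (hρs : Density Ω ρs)
    (hE : IsLogEnergy Ω ρs A E) (hρ : ρ ∈ A) (hΦ : IsTest Ω Φ) :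
    hessFormL Ω (crossEntropyFirst ρs) (crossEntropySecond ρs) ρ Φ Φ =
      (∫ x in Ω, ((ρ x)⁻¹ * wDiv ρ Φ x) ^ 2 * ρs x) -
        ∫ x in Ω, (grad Φ x ⬝ᵥ (hess (fun z => ρs z / ρ z) x *ᵥ grad Φ x)) * ρ x := by
  unfold hessFormL
  rw [integral_grad_mixedAction hΩ (hE.hasVariations hΩ hρs) hρ (hE.density hρ).smooth hΦ hΦ,
    sub_eq_add_neg, ← integral_neg]
  congr 1
  · refine integral_congr_ae (Eventually.of_forall fun x => ?_)
    simp only [crossEntropySecond, div_eq_mul_inv, mul_pow, inv_pow]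
    ring
  · simp only [hess_crossEntropyFirst, neg_mulVec, dotProduct_neg, neg_mul]

theorem contDiffOn_div_mul_wDiv (hΩ : IsOpen Ω) (hρs : ContDiffOn ℝ ∞ ρs Ω)
    (hρ : ContDiffOn ℝ ∞ ρ Ω) (hpos : ∀ x ∈ Ω, 0 < ρ x) (hΦ : ContDiffOn ℝ ∞ Φ Ω) :
    ContDiffOn ℝ ∞ (fun y => ρs y / ρ y ^ 2 * wDiv ρ Φ y) Ω :=
  contDiffOn_crossEntropySecond hρs hρ hpos
    (wDiv_contDiffOn hΩ (l := ∞) hρ hΦ (by decide) (by decide))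

theorem continuousOn_crossEntropyOp (hΩ : IsOpen Ω) (hρs : ContDiffOn ℝ ∞ ρs Ω)
    (hρ : ContDiffOn ℝ ∞ ρ Ω) (hpos : ∀ x ∈ Ω, 0 < ρ x) (hΦ : ContDiffOn ℝ ∞ Φ Ω) :
    ContinuousOn (crossEntropyOp ρs ρ Φ) Ω := by
  refine ContinuousOn.add ?_ ?_
  · exact (wDiv_contDiffOn hΩ (l := 0) hρ (contDiffOn_div_mul_wDiv hΩ hρs hρ hpos hΦ)
      (by decide) (by decide)).continuousOn
  · exact continuousOn_div hΩ (contDiffOn_smul_hess_mulVec_grad hΩ hρ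
      ((hρs.div hρ fun x hx => (hpos x hx).ne').of_le (by decide)) hΦ)

/-- Every integration by parts takes its compact support from Ψ, so the identity holds for every
smooth Φ, in particular for potentials. -/
theorem hessFormL_crossEntropy_eq (hΩ : IsOpen Ω) (hρs : ContDiffOn ℝ ∞ ρs Ω)
    (hρ : ContDiffOn ℝ ∞ ρ Ω) (hpos : ∀ x ∈ Ω, 0 < ρ x) (hΦ : ContDiffOn ℝ ∞ Φ Ω)
    (hΨ : IsTest Ω Ψ) :
    hessFormL Ω (crossEntropyFirst ρs) (crossEntropySecond ρs) ρ Φ Ψ =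
      ∫ x in Ω, Ψ x * crossEntropyOp ρs ρ Φ x := by
  have hK := hΨ.isCompact
  have hΨs : ContDiffOn ℝ ∞ Ψ Ω := hΨ.smooth.contDiffOn
  have hρ1 : ContDiffOn ℝ 1 ρ Ω := hρ.of_le (by decide)
  have haΦ := contDiffOn_div_mul_wDiv hΩ hρs hρ hpos hΦ
  have haΨ := contDiffOn_div_mul_wDiv hΩ hρs hρ hpos hΨs
  have hq : ContDiffOn ℝ ∞ (fun z => ρs z / ρ z) Ω := hρs.div hρ fun x hx => (hpos x hx).ne'
  have hT := contDiffOn_smul_hess_mulVec_grad hΩ hρ (hq.of_le (by decide)) hΦ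
  have e1 : ∫ x in Ω, (grad Φ x ⬝ᵥ mixedAction (crossEntropySecond ρs) ρ Ψ x) * ρ x =
      ∫ x in Ω, (ρs x / ρ x ^ 2 * wDiv ρ Ψ x) * wDiv ρ Φ x := by
    rw [integral_mul_wDiv hΩ (haΨ.of_le (by decide)) hρ1 (hΦ.of_le (by decide)) hK hΨ.support
      (Or.inl fun y hy => by rw [wDiv_zero_off hK.isClosed hΨ.zero_off hy, mul_zero]),
      ← integral_neg]
    refine integral_congr_ae (Eventually.of_forall fun x => ?_)
    simp only [mixedAction, dotProduct_neg]
    rw [dotProduct_comm, neg_mul]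
    rfl
  -- The weight is regrouped with the divergence of Φ; applying Green's identity in both directions
  -- then frees Ψ of derivatives.
  have e2 : ∫ x in Ω, (ρs x / ρ x ^ 2 * wDiv ρ Ψ x) * wDiv ρ Φ x =
      ∫ x in Ω, Ψ x * wDiv ρ (fun y => ρs y / ρ y ^ 2 * wDiv ρ Φ y) x := by
    rw [integral_mul_wDiv hΩ (hΨs.of_le (by decide)) hρ1 (haΦ.of_le (by decide)) hK hΨ.support
      (Or.inl hΨ.zero_off)]
    have := integral_mul_wDiv hΩ (haΦ.of_le (by decide)) hρ1 (hΨs.of_le (by decide)) hK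
      hΨ.support (Or.inr hΨ.zero_off)
    simp only [dotProduct_comm (grad Ψ _)]
    rw [← this]
    refine integral_congr_ae (Eventually.of_forall fun x => ?_)
    ring
  have e3 : ∫ x in Ω, (grad Φ x ⬝ᵥ (hess (crossEntropyFirst ρs ρ) x *ᵥ grad Ψ x)) * ρ x =
      ∫ x in Ω, Ψ x * div (fun y => ρ y • (hess (fun z => ρs z / ρ z) y *ᵥ grad Φ y)) x := by
    rw [integral_mul_div hΩ (hΨs.of_le (by decide)) hT hK hΨ.support (Or.inl hΨ.zero_off),
      ← integral_neg]
    refine setIntegral_congr_fun hΩ.measurableSet fun x hx => ?_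
    simp only [hess_crossEntropyFirst, neg_mulVec, dotProduct_neg, dotProduct_smul, smul_eq_mul]
    rw [dotProduct_hess_mulVec_comm ((hq.contDiffAt (hΩ.mem_nhds hx)).of_le (by decide))]
    ring
  unfold hessFormL
  rw [e1, e2, e3, ← integral_add]
  · refine integral_congr_ae (Eventually.of_forall fun x => ?_)
    simp only [crossEntropyOp]
    ring
  · exact hΨ.integrableOn_mul hΩ (wDiv_contDiffOn hΩ (l := 0) hρ haΦ
      (by decide) (by decide)).continuousOn
  · exact hΨ.integrableOn_mul hΩ (continuousOn_div hΩ hT)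

theorem IsLogEnergy.isNewtonFlow_iff (hΩ : IsOpen Ω) (hρs : Density Ω ρs)
    (hE : IsLogEnergy Ω ρs A E) {J : Set ℝ} {r : ℝ → Sp d → ℝ} (hr : ∀ t ∈ J, r t ∈ A) :
    IsNewtonFlow Ω E (crossEntropyFirst ρs) J r ↔
      ∃ Φ : ℝ → Sp d → ℝ, FlowEquation Ω J r Φ ∧
        ∀ t ∈ J, ∀ x ∈ Ω, crossEntropyOp ρs (r t) (Φ t) x =
          wDiv (r t) (crossEntropyFirst ρs (r t)) x := by
  have hA := hE.energyDomain hΩ hρs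
  have hV := hE.hasVariations hΩ hρs
  rw [WassersteinNewton.isNewtonFlow_iff hΩ hA hV fun t ht =>
    ⟨hr t ht, hE.mixedL2 hΩ hρs (hr t ht)⟩]
  refine exists_congr fun Φ => and_congr_right fun hF => forall₂_congr fun t ht => ?_
  have hρ := (hE.density (hr t ht)).smooth
  have hpos := hE.pos (hr t ht)
  have hΦ := (hF t ht).1.1
  rw [← integral_test_mul_eq_iff hΩ (continuousOn_crossEntropyOp hΩ hρs.smooth hρ hpos hΦ)
    (continuousOn_wDiv_first hΩ hA hV (hr t ht))]
  refine forall₂_congr fun Ψ hΨ => ?_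
  rw [hessFormL_crossEntropy_eq hΩ hρs.smooth hρ hpos hΦ hΨ]

end CrossEntropy

end WassersteinNewton

theorem mainTheorem7 {d : ℕ} (Ω : Set (Sp d)) (hΩ : IsOpen Ω) :
    -- general functional, second variation a possibly distributional kernel
    (∀ (A : Set (Sp d → ℝ)) (E : (Sp d → ℝ) → ℝ) (D : (Sp d → ℝ) → Sp d → ℝ)
        (L : (Sp d → ℝ) → (Sp d → ℝ) → Sp d → ℝ),
      EnergyDomain Ω A → HasVariations Ω A E D L →
        (∀ ρ ∈ A, IsHessianForm Ω E ρ (hessFormL Ω D L ρ)) ∧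
        ∀ (J : Set ℝ) (r : ℝ → Sp d → ℝ), (∀ t ∈ J, r t ∈ A ∧ MixedL2 Ω L (r t)) →
          (IsNewtonFlow Ω E D J r ↔
            ∃ Φ : ℝ → Sp d → ℝ, FlowEquation Ω J r Φ ∧
              ∀ t ∈ J, ∀ Ψ, IsTest Ω Ψ →
                hessFormL Ω D L (r t) (Φ t) Ψ = ∫ x in Ω, Ψ x * wDiv (r t) (D (r t)) x)) ∧
    -- general functional, second variation a C² function
    (∀ (A : Set (Sp d → ℝ)) (E : (Sp d → ℝ) → ℝ) (D : (Sp d → ℝ) → Sp d → ℝ)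
        (k : (Sp d → ℝ) → Sp d → Sp d → ℝ),
      EnergyDomain Ω A → HasVariations Ω A E D (kernelOp Ω k) →
      (∀ ρ ∈ A, ContDiffOn ℝ 2 (fun p : Sp d × Sp d => k ρ p.1 p.2) (Ω ×ˢ Ω)) →
        (∀ ρ ∈ A, IsHessianForm Ω E ρ (hessFormK Ω D k ρ)) ∧
        ∀ (J : Set ℝ) (r : ℝ → Sp d → ℝ), (∀ t ∈ J, r t ∈ A ∧ MixedL2 Ω (kernelOp Ω k) (r t)) →
          (IsNewtonFlow Ω E D J r ↔
            ∃ Φ : ℝ → Sp d → ℝ, FlowEquation Ω J r Φ ∧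
              ∀ t ∈ J, ∀ Ψ, IsTest Ω Ψ →
                hessFormK Ω D k (r t) (Φ t) Ψ = ∫ x in Ω, Ψ x * wDiv (r t) (D (r t)) x)) ∧
    -- interaction energy (ν = 0) and maximum mean discrepancy (ν a density)
    (∀ (W : Sp d → Sp d → ℝ) (ν : Sp d → ℝ),
      ContDiffOn ℝ ∞ (fun p : Sp d × Sp d => W p.1 p.2) (Ω ×ˢ Ω) →
      (∀ x ∈ Ω, ∀ y ∈ Ω, W x y = W y x) → (ν = 0 ∨ Density Ω ν) →
        EnergyDomain Ω (interactionDomain Ω W ν) ∧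
        HasVariations Ω (interactionDomain Ω W ν) (interactionEnergy Ω W ν)
          (interactionFirst Ω W ν) (kernelOp Ω fun _ => W) ∧
        (∀ ρ ∈ interactionDomain Ω W ν,
          ∃ Q, IsHessianForm Ω (interactionEnergy Ω W ν) ρ Q ∧
            (∀ Φ, IsTest Ω Φ →
              Q Φ Φ =
                (∫ x in Ω, ∫ y in Ω,
                  (grad Φ x ⬝ᵥ (mixedHess W x y *ᵥ grad Φ y)) * ρ x * ρ y) +
                ∫ x in Ω, (grad Φ x ⬝ᵥ ((Matrix.of fun i j =>
                  ∫ y in Ω, hess (fun x' => W x' y) x i j * (ρ y - ν y)) *ᵥ grad Φ x)) * ρ x) ∧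
            (ν = 0 → ∀ Φ, IsTest Ω Φ →
              Q Φ Φ = (1 / 2) * ∫ x in Ω, ∫ y in Ω,
                (Sum.elim (grad Φ x) (grad Φ y) ⬝ᵥ
                  (Matrix.fromBlocks
                      (hess (fun x' => W x' y) x) (mixedHess W x y)
                      (mixedHess W x y)ᵀ (hess (fun y' => W x y') y) *ᵥ
                    Sum.elim (grad Φ x) (grad Φ y))) * ρ x * ρ y) ∧
            ∀ Φ Ψ, IsTest Ω Φ → IsTest Ω Ψ →
              Q Φ Ψ = ∫ x in Ω, Ψ x * interactionOp Ω W ν ρ Φ x) ∧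
        ∀ (J : Set ℝ) (r : ℝ → Sp d → ℝ),
          (∀ t ∈ J, r t ∈ interactionDomain Ω W ν ∧ InteractionL2 Ω W (r t)) →
          (IsNewtonFlow Ω (interactionEnergy Ω W ν) (interactionFirst Ω W ν) J r ↔
            ∃ Φ : ℝ → Sp d → ℝ, FlowEquation Ω J r Φ ∧
              ∀ t ∈ J, ∀ x ∈ Ω, interactionOp Ω W ν (r t) (Φ t) x =
                wDiv (r t) (interactionFirst Ω W ν (r t)) x)) ∧
    -- cross entropy and reverse Kullback–Leibler divergence
    (∀ (ρs : Sp d → ℝ) (A : Set (Sp d → ℝ)) (E : (Sp d → ℝ) → ℝ), Density Ω ρs →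
      ((A = crossEntropyDomain Ω ρs ∧ E = crossEntropy Ω ρs) ∨
        (A = reverseKLDomain Ω ρs ∧ E = reverseKL Ω ρs)) →
        EnergyDomain Ω A ∧
        HasVariations Ω A E (crossEntropyFirst ρs) (crossEntropySecond ρs) ∧
        (∀ ρ ∈ A, ∃ Q, IsHessianForm Ω E ρ Q ∧
          (∀ Φ, IsTest Ω Φ →
            Q Φ Φ = (∫ x in Ω, ((ρ x)⁻¹ * wDiv ρ Φ x) ^ 2 * ρs x) -
              ∫ x in Ω, (grad Φ x ⬝ᵥ (hess (fun z => ρs z / ρ z) x *ᵥ grad Φ x)) * ρ x) ∧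
          ∀ Φ Ψ, IsTest Ω Φ → IsTest Ω Ψ →
            Q Φ Ψ = ∫ x in Ω, Ψ x * crossEntropyOp ρs ρ Φ x) ∧
        ∀ (J : Set ℝ) (r : ℝ → Sp d → ℝ), (∀ t ∈ J, r t ∈ A) →
          (IsNewtonFlow Ω E (crossEntropyFirst ρs) J r ↔
            ∃ Φ : ℝ → Sp d → ℝ, FlowEquation Ω J r Φ ∧
              ∀ t ∈ J, ∀ x ∈ Ω, crossEntropyOp ρs (r t) (Φ t) x =
                wDiv (r t) (crossEntropyFirst ρs (r t)) x)) := by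
  refine ⟨fun A E D L hA hV => ⟨fun ρ hρ => isHessianForm_hessFormL hΩ hA hV hρ,
    fun J r hr => isNewtonFlow_iff hΩ hA hV hr⟩, fun A E D k hA hV hk => ⟨fun ρ hρ => ?_,
    fun J r hr => ?_⟩, fun W ν hW hsymm hν => ?_, fun ρs A E hρs hAE => ?_⟩
  · exact (isHessianForm_hessFormL hΩ hA hV hρ).congr fun _ _ _ hΨ =>
      hessFormK_eq_hessFormL hΩ (hA.density ρ hρ).smooth (hk ρ hρ) hΨ
  · rw [isNewtonFlow_iff hΩ hA hV hr]
    refine exists_congr fun Φ => and_congr_right fun _ => forall₂_congr fun t ht =>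
      forall₂_congr fun Ψ hΨ => ?_
    rw [hessFormK_eq_hessFormL hΩ (hA.density _ (hr t ht).1).smooth (hk _ (hr t ht).1) hΨ]
  · have hνc : ContinuousOn ν Ω := by
      rcases hν with rfl | hν
      · exact continuousOn_const
      · exact hν.smooth.continuousOn
    refine ⟨energyDomain_interactionDomain hΩ hW hsymm hνc,
      hasVariations_interaction hΩ hW hsymm hνc, fun ρ hρ =>
      ⟨_, isHessianForm_interaction hΩ hW hsymm hνc hρ, fun Φ hΦ => ?_, fun h0 Φ hΦ => ?_,
        fun Φ Ψ hΦ hΨ => ?_⟩, fun J r hr => isNewtonFlow_interaction_iff hΩ hW hsymm hνc hr⟩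
    · refine congrArg (_ + ·) (setIntegral_congr_fun hΩ.measurableSet fun x hx => ?_)
      simp only [hess_interactionFirst hΩ hW hνc hρ hx]
    · subst h0
      exact hessFormK_interaction_eq_blocks hΩ hW hsymm hρ hΦ
    · have hdom := dominatedDerivs_mixedHess_of_isTest hΩ hW hρ.1.smooth.continuousOn hΦ
      rw [integral_mul_interactionOp hΩ hW hνc hρ hΦ.smooth.contDiffOn hdom hΨ]
      exact hessFormK_interaction_symm hΩ hW hsymm hνc hρ hΦ.smooth.contDiffOn hdom hΨ
  · have hE : IsLogEnergy Ω ρs A E := by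
      rcases hAE with ⟨rfl, rfl⟩ | ⟨rfl, rfl⟩
      · exact isLogEnergy_crossEntropy
      · exact isLogEnergy_reverseKL
    have hA := hE.energyDomain hΩ hρs
    have hV := hE.hasVariations hΩ hρs
    exact ⟨hA, hV, fun ρ hρ => ⟨_, isHessianForm_hessFormL hΩ hA hV hρ, fun Φ hΦ =>
      hE.hessFormL_self hΩ hρs hρ hΦ, fun Φ Ψ hΦ hΨ => hessFormL_crossEntropy_eq hΩ hρs.smooth
        (hE.density hρ).smooth (hE.pos hρ) hΦ.smooth.contDiffOn hΨ⟩,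
      fun J r hr => hE.isNewtonFlow_iff hΩ hρs hr⟩
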